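/- **Setting.** Let $G=(V,E)$ be a finite simple connected graph with $n$ vertices, $m$ edges and $T\ge 1$ triangles (so $G$ is not bipartite), with a fixed linear order on $V$. Write $d(v)$ for the degree of $v$. Put $u\prec v$ if $d(u)<d(v)$, or $d(u)=d(v)$ and $u$ precedes $v$ in the fixed order. A triangle $v_1\prec v_2\prec v_3$ is assigned to the edge $\{v_1,v_2\}$; $t_{\max}$ is the largest number of triangles assigned to one edge. For $e=\{u,v\}\in E$ let $d_e=\min\{d(u),d(v)\}$, and let $N(e)$ be the neighborhood of the endpoint of smaller degree (of either endpoint if the degrees agree). The degeneracy $\alpha$ is the least $k$ such that every nonempty subgraph of $G$ has a vertex of degree at most $k$ in that subgraph. The mixing time $\tau_{mix}$ is the least $t$ such that from every starting vertex the simple random walk on $G$ after $t$ steps is within total variation distance $1/4$ of the stationary distribution $\pi(v)=d(v)/2m$. Logarithms are to base 2. **Access model.** The algorithm is given an arbitrary seed vertex $s$ and learns about $G$ only through queries on vertices it has seen: a uniform random neighbor of $v$, the degree of $v$, whether $\{u,v\}\in E$. Run time is counted on a unit-cost machine (queries, uniform random integers, arithmetic, comparisons, array and dictionary accesses cost one step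 each; the median of $k$ numbers costs $O(k)$ steps); space is the number of memory cells allocated. **Algorithm TETRIS$(r,\ell,\hat\tau)$.** Let $R=(e_1,\dots,e_r)$ be the edges of an $r$-step random walk from $s$ and $d_R=\sum_{e\in R}d_e$. For $i=1,\dots,\ell$ independently: sample $e\in R$ with probability $d_e/d_R$, query a uniform random $w\in N(e)$, and set $Y_i=1$ if $e$ and $w$ form a triangle that is assigned to $e$, otherwise $Y_i=0$. For $i=1,\dots,\hat\tau$ let $R_i=(e_i,e_{i+\hat\tau},e_{i+2\hat\tau},\dots)$, let $c_i$ be the number of pairs of equal edges in $R_i$, and let $\overline m=\frac1{\hat\tau}\sum_{i}\binom{|R_i|}{2}/c_i$, a term with $c_i=0$ being counted as $0$. Return $X=\frac{\overline m}{r}\cdot d_R\cdot\frac1\ell\sum_{i=1}^{\ell}Y_i$. For smaller error probabilities the algorithm is run $k$ times independently from $s$ and the median of the $k$ results is returned. **Theorem.** There are an absolute constant $C$, choices of $r,\ell,\hat\tau$ as functions of $(n,m,\alpha,T,t_{\max},\tau_{mix},\varepsilon)$ only, and of $k$ as a function of $\delta$ only, with $k=1$ whenever $\delta\ge 1/3$,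 such that for every such graph $G$, every $\varepsilon\in(0,1]$ and every $\delta\in(0,1]$ we have $\hat\tau\ge\tau_{mix}$ and, for every seed vertex $s$, the following holds. The output of TETRIS (the median of $k$ independent runs with parameters $r,\ell,\hat\tau$) lies in $[(1-\varepsilon)T,(1+\varepsilon)T]$ with probability at least $1-\delta$, and in every execution the number of queries, the run time and the space are each at most $$C\cdot\max\Bigl\{1,\log\frac1\delta\Bigr\}\cdot\frac{\log n}{\varepsilon^2}\left(\frac{m\,\tau_{mix}\,t_{\max}}{T}+\frac{m\,\alpha}{T}+\sqrt m\,\tau_{mix}\right).$$ -/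

import Mathlib

/-! ## Graph quantities -/

namespace Tetris

section GraphQuantities

variable {V : Type} [Fintype V] [LinearOrder V] (G : SimpleGraph V) [DecidableRel G.Adj]

/-- The total number of triangles. -/
def triangleCount : ℕ := (G.cliqueFinset 3).card

/-- The degree ordering of the vertices; ties are broken by the fixed linear order of `V`. -/
def DegPrec (u v : V) : Prop :=
  G.degree u < G.degree v ∨ (G.degree u = G.degree v ∧ u < v)

instance (u v : V) : Decidable (DegPrec G u v) := by
  unfold DegPrec; infer_instance

/-- The number of triangles assigned to the edge `{u, v}`: a triangle is assigned to the edge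
joining its two smallest vertices in the degree ordering, so these are the triangles
`{u, v, w}` whose third vertex `w` comes after both `u` and `v`. -/
def assignedTriangles (u v : V) : ℕ :=
  (Finset.univ.filter fun w : V =>
    G.Adj u w ∧ G.Adj v w ∧ DegPrec G u w ∧ DegPrec G v w).card

/-- The largest number of triangles assigned to a single edge. -/
def maxAssigned : ℕ :=
  (Finset.univ.filter fun p : V × V => G.Adj p.1 p.2).sup fun p => assignedTriangles G p.1 p.2

/-- The degeneracy: the least `k` such that every nonempty subgraph has a vertex of degree at
most `k` (degrees taken in the subgraph). -/
noncomputable def degeneracy : ℕ :=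
  sInf {k : ℕ | ∀ H : G.Subgraph, H.verts.Nonempty →
    ∃ v ∈ H.verts, (H.neighborSet v).ncard ≤ k}

/-- The transition matrix of the simple random walk. -/
noncomputable def walkMatrix : Matrix V V ℝ :=
  Matrix.of fun u v => if G.Adj u v then ((G.degree u : ℕ) : ℝ)⁻¹ else 0

/-- The stationary distribution `d(v) / 2m`. -/
noncomputable def stationary (v : V) : ℝ :=
  (G.degree v : ℝ) / (2 * (G.edgeFinset.card : ℝ))

/-- Total variation distance between the law of the walk from `s` after `t` steps and the
stationary distribution. -/
noncomputable def tvDist (t : ℕ) (s : V) : ℝ :=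
  (1 / 2) * ∑ v, |(walkMatrix G ^ t) s v - stationary G v|

/-- The mixing time: the least number of steps after which, from every starting vertex, the walk
is within total variation distance `1/4` of the stationary distribution. -/
noncomputable def mixingTime : ℕ :=
  sInf {t : ℕ | ∀ s : V, tvDist G t s ≤ 1 / 4}

end GraphQuantities

/-- The numerical data of a graph on which the input parameters of the algorithm may depend. -/
structure GraphStats where
  /-- number of vertices -/
  n : ℕ
  /-- number of edges -/
  m : ℕ
  /-- degeneracy -/
  degen : ℕ
  /-- number of triangles -/
  T : ℕ
  /-- largest number of triangles assigned to one edge -/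
  tmax : ℕ
  /-- mixing time -/
  mix : ℕ

/-- The data of a given graph. -/
noncomputable def graphStats {V : Type} [Fintype V] [LinearOrder V] (G : SimpleGraph V)
    [DecidableRel G.Adj] : GraphStats where
  n := Fintype.card V
  m := G.edgeFinset.card
  degen := degeneracy G
  T := triangleCount G
  tmax := maxAssigned G
  mix := mixingTime G

/-- The expression `(log n / ε²) (m τ t_max / T + m α / T + √m τ)`, logarithm in base 2. -/
noncomputable def complexityBound (g : GraphStats) (ε : ℝ) : ℝ :=
  Real.logb 2 g.n / ε ^ 2 *
    ((g.m : ℝ) * g.mix * g.tmax / g.T + (g.m : ℝ) * g.degen / g.T + √(g.m : ℝ) * g.mix)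

/-! ## The random walk access model -/

/-- Randomized programs in the random walk access model. A program does not see the graph: it
gets information only from the answers to its queries, and a program defined for every type `V`
can only name vertices that it was given as a seed or obtained as query answers. `work t`
charges `t` elementary local operations (unit-cost arithmetic, comparisons, array and dictionary
accesses), `alloc c` charges `c` memory cells. -/
inductive Prog (V : Type) (α : Type) : Type
  /-- stop with a result -/
  | ret (a : α) : Prog V α
  /-- random neighbor query -/
  | nbr (v : V) (k : V → Prog V α) : Prog V α
  /-- degree query -/
  | deg (v : V) (k : ℕ → Prog V α) : Prog V α
  /-- edge query -/
  | adj (u v : V) (k : Bool → Prog V α) : Prog V α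
  /-- draw a uniform random element of `{0, …, N - 1}` -/
  | rand (N : ℕ) (k : ℕ → Prog V α) : Prog V α
  /-- local computation -/
  | work (t : ℕ) (k : Prog V α) : Prog V α
  /-- memory allocation -/
  | alloc (c : ℕ) (k : Prog V α) : Prog V α

namespace Prog

variable {V : Type} {α β : Type}

/-- Sequential composition. -/
def bind : Prog V α → (α → Prog V β) → Prog V β
  | ret a, f => f a
  | nbr v k, f => nbr v fun w => bind (k w) f
  | deg v k, f => deg v fun d => bind (k d) f
  | adj u v k, f => adj u v fun b => bind (k b) f
  | rand N k, f => rand N fun j => bind (k j) f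
  | work t k, f => work t (bind k f)
  | alloc c k, f => alloc c (bind k f)

instance : Monad (Prog V) where
  pure := ret
  bind := bind

end Prog

/-- Resources used by a run. Queries and random draws also count as steps; memory is never
released, so that `cells` is an upper bound for the memory in use at any time. -/
structure Cost where
  /-- number of queries to the graph -/
  queries : ℕ
  /-- number of elementary steps -/
  steps : ℕ
  /-- number of memory cells -/
  cells : ℕ

/-- Add resources to the outcome (result, resources used) of a run. -/
def charge {α : Type} (q t c : ℕ) (o : α × Cost) : α × Cost :=
  (o.1, ⟨q + o.2.queries, t + o.2.steps, c + o.2.cells⟩)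

/-- A uniform random neighbor of `v` (`v` itself if it is isolated). -/
noncomputable def uniformNbr {V : Type} [Fintype V] (G : SimpleGraph V)
    [DecidableRel G.Adj] (v : V) : PMF V :=
  if h : (G.neighborFinset v).Nonempty then PMF.uniformOfFinset (G.neighborFinset v) h
  else PMF.pure v

/-- A uniform random element of `{0, …, N - 1}` (`0` if `N = 0`). -/
noncomputable def uniformBelow (N : ℕ) : PMF ℕ :=
  if h : (Finset.range N).Nonempty then PMF.uniformOfFinset (Finset.range N) h
  else PMF.pure 0

/-- The joint law of the result and the resources used when a program runs on `G`, all random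
answers and draws being independent. -/
noncomputable def run {V : Type} [Fintype V] (G : SimpleGraph V) [DecidableRel G.Adj]
    {α : Type} : Prog V α → PMF (α × Cost)
  | .ret a => PMF.pure (a, ⟨0, 0, 0⟩)
  | .nbr v k => (uniformNbr G v).bind fun w => (run G (k w)).map (charge 1 1 0)
  | .deg v k => (run G (k (G.degree v))).map (charge 1 1 0)
  | .adj u v k => (run G (k (decide (G.Adj u v)))).map (charge 1 1 0)
  | .rand N k => (uniformBelow N).bind fun j => (run G (k j)).map (charge 0 1 0)
  | .work t k => (run G k).map (charge 0 t 0)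
  | .alloc c k => (run G k).map (charge 0 0 c)

/-! ## The algorithm

Lists stand for arrays: reading an entry is one elementary operation. -/

section Algorithm

variable {V : Type}

/-- Random neighbor query. -/
def askNbr (v : V) : Prog V V := .nbr v .ret
/-- Degree query. -/
def askDeg (v : V) : Prog V ℕ := .deg v .ret
/-- Edge query. -/
def askAdj (u v : V) : Prog V Bool := .adj u v .ret
/-- Uniform random element of `{0, …, N - 1}`. -/
def draw (N : ℕ) : Prog V ℕ := .rand N .ret
/-- Local computation of `t` elementary operations. -/
def spend (t : ℕ) : Prog V Unit := .work t (.ret ())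
/-- Allocation of `c` memory cells. -/
def reserve (c : ℕ) : Prog V Unit := .alloc c (.ret ())

/-- A traversed edge `{u, v}` together with the degrees of its endpoints. -/
structure WalkEdge (V : Type) where
  /-- first endpoint -/
  u : V
  /-- second endpoint -/
  v : V
  /-- degree of the first endpoint -/
  du : ℕ
  /-- degree of the second endpoint -/
  dv : ℕ

namespace WalkEdge

/-- The degree `d_e` of an edge. -/
def edgeDeg (e : WalkEdge V) : ℕ := min e.du e.dv
/-- The endpoint whose neighborhood is `N(e)`. -/
def low (e : WalkEdge V) : V := if e.du < e.dv then e.u else e.v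
/-- The other endpoint. -/
def high (e : WalkEdge V) : V := if e.du < e.dv then e.v else e.u

end WalkEdge

/-- The array of the edges of an `r`-step random walk from `u`, a vertex of degree `du`. -/
def walk : ℕ → V → ℕ → Prog V (List (WalkEdge V))
  | 0, _, _ => pure []
  | r + 1, u, du => do
    let v ← askNbr u
    let dv ← askDeg v
    spend 4
    reserve 4
    let R ← walk r v dv
    pure (⟨u, v, du, dv⟩ :: R)

/-- A cell of an alias table: it stands for the item `fst` with probability `thr / S` and for
the item `snd` otherwise. -/
structure AliasCell (ι : Type) where
  /-- threshold -/
  thr : ℕ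
  /-- item chosen below the threshold -/
  fst : ι
  /-- item chosen from the threshold on -/
  snd : ι

/-- Construction of an alias table with total cell weight `S`, from the stacks of the items whose
(remaining) weight is below `S` and of those whose weight is at least `S`. -/
def aliasTable {ι : Type} (S : ℕ) :
    List (ℕ × ι) → List (ℕ × ι) → Prog V (List (AliasCell ι))
  | [], [] => pure []
  | [], (_, f) :: gs => do
    spend 4
    reserve 3
    let A ← aliasTable S [] gs
    pure (⟨S, f, f⟩ :: A)
  | (_, e) :: ss, [] => do
    spend 4
    reserve 3
    let A ← aliasTable S ss []
    pure (⟨S, e, e⟩ :: A)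
  | (p, e) :: ss, (q, f) :: gs => do
    spend 10
    reserve 3
    let A ← if p + q - S < S then aliasTable S ((p + q - S, f) :: ss) gs
      else aliasTable S ss ((p + q - S, f) :: gs)
    pure (⟨p, e, f⟩ :: A)
  termination_by s g => s.length + g.length

/-- Preprocessing for sampling an edge of `R` with probability `d_e / d_R`: the alias table for
the weights `|R| d_e`, with total weight `dR = d_R` in each of its `|R|` cells. -/
def samplingTable (R : List (WalkEdge V)) (dR : ℕ) : Prog V (List (AliasCell (WalkEdge V))) := do
  let weighted := R.map fun e => (R.length * e.edgeDeg, e)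
  spend (4 * R.length)
  reserve (2 * R.length)
  aliasTable dR (weighted.filter fun x => x.1 < dR) (weighted.filter fun x => dR ≤ x.1)

/-- The indicator `Y_i` of one iteration of the main loop: sample an edge `e` of `R` with
probability `d_e / d_R`, query a uniform random neighbor `w` in `N(e)`, check whether `e` and `w`
form a triangle and, if so, whether this triangle is assigned to `e`. -/
def trial [LinearOrder V] (dR : ℕ) (A : List (AliasCell (WalkEdge V))) : Prog V ℕ := do
  let j ← draw A.length
  let x ← draw dR
  spend 6
  match A[j]? with
  | none => pure 0
  | some c =>
    let e := if x < c.thr then c.fst else c.snd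
    let w ← askNbr e.low
    let isTriangle ← askAdj e.high w
    if isTriangle then do
      let du ← askDeg e.u
      let dv ← askDeg e.v
      let dw ← askDeg w
      spend 6
      if (du < dw ∨ (du = dw ∧ e.u < w)) ∧ (dv < dw ∨ (dv = dw ∧ e.v < w)) then pure 1
      else pure 0
    else pure 0

/-- The sum of `ℓ` independent trials. -/
def trials [LinearOrder V] (dR : ℕ) (A : List (AliasCell (WalkEdge V))) : ℕ → Prog V ℕ
  | 0 => pure 0
  | ℓ + 1 => do
    let y ← trial dR A
    spend 2
    let z ← trials dR A ℓ
    pure (y + z)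

/-- One pass over the entries of `R` at the positions `i, i + τ, i + 2τ, …`, by means of a
dictionary `D` that holds how often each (undirected) edge has been seen; `k` is the number of
entries and `c` the number of pairwise collisions so far. The first argument only bounds the
number of iterations; the length of `R` is always enough. -/
def collisions [DecidableEq V] (R : List (WalkEdge V)) (τ : ℕ) :
    ℕ → ℕ → (Sym2 V → ℕ) → ℕ → ℕ → Prog V (ℕ × ℕ)
  | 0, _, _, k, c => pure (k, c)
  | fuel + 1, i, D, k, c =>
    match R[i]? with
    | none => pure (k, c)
    | some e => do
      spend 8
      reserve 2
      collisions R τ fuel (i + τ) (Function.update D s(e.u, e.v) (D s(e.u, e.v) + 1))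
        (k + 1) (c + D s(e.u, e.v))

/-- The sum of the estimates `(|R_i| choose 2) / c_i` over the first residue classes of
positions, where an estimate with `c_i = 0` counts as `0`. -/
def edgeCountSum [DecidableEq V] (R : List (WalkEdge V)) (τ : ℕ) : ℕ → Prog V ℚ
  | 0 => pure 0
  | i + 1 => do
    let kc ← collisions R τ R.length i (fun _ => 0) 0 0
    spend 8
    let y ← edgeCountSum R τ i
    pure ((kc.1.choose 2 : ℚ) / (kc.2 : ℚ) + y)

/-- The collision based edge count estimator. -/
def edgeCountEstimator [DecidableEq V] (R : List (WalkEdge V)) (τ : ℕ) : Prog V ℚ := do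
  let y ← edgeCountSum R τ τ
  spend 1
  pure (y / (τ : ℚ))

/-- One run of the triangle counting estimator, with walk length `r`, number of subsamples `ℓ`,
estimate `τ` of the mixing time, and seed vertex `s`. -/
def tetris [LinearOrder V] (r ℓ τ : ℕ) (s : V) : Prog V ℚ := do
  let ds ← askDeg s
  reserve 16
  let R ← walk r s ds
  spend (3 * R.length)
  let dR := (R.map WalkEdge.edgeDeg).sum
  let A ← samplingTable R dR
  let y ← trials dR A ℓ
  let mEst ← edgeCountEstimator R τ
  spend 4
  pure (mEst / (r : ℚ) * (dR : ℚ) * ((y : ℚ) / (ℓ : ℚ)))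

/-- The results of `k` independent runs of a program. -/
def repeatRuns {α : Type} (p : Prog V α) : ℕ → Prog V (List α)
  | 0 => pure []
  | k + 1 => do
    let x ← p
    spend 1
    reserve 1
    let xs ← repeatRuns p k
    pure (x :: xs)

/-- The (upper) median of a list of numbers. -/
def median (l : List ℚ) : ℚ := (l.insertionSort (· ≤ ·)).getD (l.length / 2) 0

/-- The median of `k` independent runs of the estimator. Finding the median of `k` numbers is
charged linearly, the worst-case cost of linear-time selection. -/
def tetrisMedian [LinearOrder V] (k r ℓ τ : ℕ) (s : V) : Prog V ℚ := do
  let xs ← repeatRuns (tetris r ℓ τ s) k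
  spend (25 * k)
  reserve (2 * k)
  pure (median xs)

end Algorithm

/-- On the graph `G`, the output of the program `p` lies in `[(1 - ε) T, (1 + ε) T]` with
probability at least `1 - δ`, where `T` is the number of triangles. -/
def EstimatesTriangles {V : Type} [Fintype V] [LinearOrder V] (G : SimpleGraph V)
    [DecidableRel G.Adj] (ε δ : ℝ) (p : Prog V ℚ) : Prop :=
  ENNReal.ofReal (1 - δ) ≤ (run G p).toOuterMeasure
    {o | (1 - ε) * (triangleCount G : ℝ) ≤ (o.1 : ℝ) ∧
      (o.1 : ℝ) ≤ (1 + ε) * (triangleCount G : ℝ)}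

/-- In every run of the program `p` on `G`, the number of queries, the number of steps and the
number of memory cells are all at most `b`. -/
def ResourcesAtMost {V : Type} [Fintype V] (G : SimpleGraph V) [DecidableRel G.Adj]
    (b : ℝ) (p : Prog V ℚ) : Prop :=
  ∀ o ∈ (run G p).support,
    (o.2.queries : ℝ) ≤ b ∧ (o.2.steps : ℝ) ≤ b ∧ (o.2.cells : ℝ) ≤ b

end Tetris

/-!
Why the estimator is accurate and cheap.

A program is a finite tree of random choices, so the expected value of a function of its result is
an iterated average (`mean`); probabilities of results are expected values of indicators
(`run_toOuterMeasure`), and the resources are bounded along every branch (`Within`). For the walk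
the iterated average is governed by powers of the transition matrix. A triangle makes the chain
aperiodic, so the mixing time is attained, and the distance from stationarity is halved in every
period of `τ_mix` steps (`IsMixing.l1Dist_decay`).

Let `t_R` be the number of triangles assigned to the edges of the walk `R`, counted with
multiplicity. Given `R`, a trial succeeds with probability exactly `t_R / d_R` (`mean_trial`), so
the output is close to `m̄ t_R / r`, and three facts about the walk are needed.

* `t_R` is close to `r T / m`. Its variance is `O(τ_mix t_max r T / m)`, because after each step the
  mean of the rest of the sum is known up to `4 τ_mix t_max`
  (`IsMixing.walkMean_recordTriangles_sq_le`).
* `d_R` is `O(α r)` on average. The stationary mean of `d_e` is at most `2 α` (`sum_min_degree_le`),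
  and the deviation caused by the starting vertex is `O(τ_mix √m)`, since the next edge from any
  vertex has expected weight at most `√(2m)` (`expect_min_degree_le`). Together with the first fact
  this makes the success probability of a trial large enough for Chebyshev's inequality with
  `O(m α / (T ε²))` trials (`mean_trials_inaccurate_le`).
* `m̄` is close to `m`. Within one residue class the edges are `τ̂` steps apart and hence nearly
  independent and uniform (`IsMixing.abs_walkMean_everyNth_sub_le`). For independent edges the pairs
  of positions that hold equal edges are pairwise uncorrelated, so the number `c` of such pairs has
  variance at most its mean `μ`. This gives a relative error of order `1/√μ`, except that the
  estimate uses `1 / c`: the event of a small `c`, on which the estimate can be off by a factor `μ`,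
  must have probability `O(1/μ²)`. It does, since both halves of the sample must have few equal
  pairs (`iidMean_equalPairs_lt_le_sq`). Averaging over the residue classes is harmless because the
  error is bounded in mean (`IsMixing.walkMean_edgeEstimate_error_le`).

The spacing is `τ̂ = Θ(τ_mix log n / ε)`. The walk may have `Θ(log n / ε²)` times the length
`τ_mix (√m + m t_max / T)`, so that there is room for a factor `1/ε` in the spacing and a factor
`1/ε` in the number of edges of each residue class. The former makes the distance from independence
smaller than the required power of `ε / n` (`GraphStats.Admissible.pow_le_two_pow_spacingFactor`),
and the latter makes `μ` of order `1/ε²`.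

One run therefore fails with probability at most `1/16`. The median of `k` runs fails only if at
least half of them do, which has probability at most `2 ^ (-k)` because the expected value of `16`
to the number of failures is at most `2 ^ k` (`mean_median_le`).
-/

namespace Tetris

open Finset
open scoped BigOperators Matrix

/-! ### Expected values of programs -/

section Semantics

variable {V : Type} [Fintype V] (G : SimpleGraph V) [DecidableRel G.Adj] {α β : Type}

/-- The possible answers to a random neighbor query at `v`. -/
noncomputable def nbrAnswers (v : V) : Finset V :=
  if (G.neighborFinset v).Nonempty then G.neighborFinset v else {v}

/-- The possible results of a draw below `N`. -/
noncomputable def drawAnswers (N : ℕ) : Finset ℕ :=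
  if (Finset.range N).Nonempty then Finset.range N else {0}

theorem nbrAnswers_nonempty (v : V) : (nbrAnswers G v).Nonempty := by
  unfold nbrAnswers; split_ifs with h
  · exact h
  · simp

theorem drawAnswers_nonempty (N : ℕ) : (drawAnswers N).Nonempty := by
  unfold drawAnswers; split_ifs with h
  · exact h
  · simp

theorem pure_eq_uniformOfFinset_singleton (a : α) :
    PMF.pure a = PMF.uniformOfFinset {a} (Finset.singleton_nonempty a) := by
  ext b
  by_cases h : b = a
  · subst h; simp
  · simp [PMF.pure_apply, h]

theorem uniformNbr_eq (v : V) :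
    uniformNbr G v = PMF.uniformOfFinset (nbrAnswers G v) (nbrAnswers_nonempty G v) := by
  unfold uniformNbr
  split_ifs with h
  · congr 1; simp [nbrAnswers, h]
  · rw [pure_eq_uniformOfFinset_singleton]; congr 1; simp only [nbrAnswers, h, if_false]

theorem uniformBelow_eq (N : ℕ) :
    uniformBelow N = PMF.uniformOfFinset (drawAnswers N) (drawAnswers_nonempty N) := by
  unfold uniformBelow
  split_ifs with h
  · congr 1; simp only [drawAnswers, h, if_true]
  · rw [pure_eq_uniformOfFinset_singleton]; congr 1; simp only [drawAnswers, h, if_false]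

/-- The expected value of `f` at the result of a program. -/
noncomputable def mean : Prog V α → (α → ℝ) → ℝ
  | .ret a, f => f a
  | .nbr v k, f => 𝔼 w ∈ nbrAnswers G v, mean (k w) f
  | .deg v k, f => mean (k (G.degree v)) f
  | .adj u v k, f => mean (k (decide (G.Adj u v))) f
  | .rand N k, f => 𝔼 j ∈ drawAnswers N, mean (k j) f
  | .work _ k, f => mean k f
  | .alloc _ k, f => mean k f

theorem mean_bind (p : Prog V α) (f : α → Prog V β) (g : β → ℝ) :
    mean G (p >>= f) g = mean G p fun a => mean G (f a) g := by
  change mean G (p.bind f) g = _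
  induction p with
  | ret a => rfl
  | nbr v k ih => simp only [Prog.bind, mean, ih]
  | deg v k ih => simp only [Prog.bind, mean, ih]
  | adj u v k ih => simp only [Prog.bind, mean, ih]
  | rand N k ih => simp only [Prog.bind, mean, ih]
  | work t k ih => simp only [Prog.bind, mean, ih]
  | alloc c k ih => simp only [Prog.bind, mean, ih]

@[simp] theorem mean_pure (a : α) (f : α → ℝ) : mean G (pure a) f = f a := rfl
@[simp] theorem mean_spend (t : ℕ) (f : Unit → ℝ) : mean G (spend t) f = f () := rfl
@[simp] theorem mean_reserve (t : ℕ) (f : Unit → ℝ) : mean G (reserve t) f = f () := rfl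
@[simp] theorem mean_askDeg (v : V) (f : ℕ → ℝ) : mean G (askDeg v) f = f (G.degree v) := rfl
@[simp] theorem mean_askAdj (u v : V) (f : Bool → ℝ) :
    mean G (askAdj u v) f = f (decide (G.Adj u v)) := rfl
theorem mean_askNbr (v : V) (f : V → ℝ) :
    mean G (askNbr v) f = 𝔼 w ∈ nbrAnswers G v, f w := rfl
theorem mean_draw (N : ℕ) (f : ℕ → ℝ) :
    mean G (draw N) f = 𝔼 j ∈ drawAnswers N, f j := rfl

theorem mean_const (p : Prog V α) (c : ℝ) : mean G p (fun _ => c) = c := by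
  induction p with
  | ret a => rfl
  | nbr v k ih => simp only [mean, ih]; exact expect_const (nbrAnswers_nonempty G v) c
  | rand N k ih => simp only [mean, ih]; exact expect_const (drawAnswers_nonempty N) c
  | _ => simp only [mean, *]

theorem mean_add (p : Prog V α) (f g : α → ℝ) :
    mean G p (fun a => f a + g a) = mean G p f + mean G p g := by
  induction p with
  | ret a => rfl
  | nbr v k ih => simp only [mean, ih, expect_add_distrib]
  | rand N k ih => simp only [mean, ih, expect_add_distrib]
  | _ => simp only [mean, *]

theorem mean_const_mul (p : Prog V α) (c : ℝ) (f : α → ℝ) :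
    mean G p (fun a => c * f a) = c * mean G p f := by
  induction p with
  | ret a => rfl
  | nbr v k ih => simp only [mean, ih, mul_expect]
  | rand N k ih => simp only [mean, ih, mul_expect]
  | _ => simp only [mean, *]

theorem mem_support_run_nbr {v : V} {k : V → Prog V α} {o : α × Cost} :
    o ∈ (run G (.nbr v k)).support ↔
      ∃ w ∈ nbrAnswers G v, ∃ o' ∈ (run G (k w)).support, charge 1 1 0 o' = o := by
  simp only [run, PMF.mem_support_bind_iff, PMF.mem_support_map_iff, uniformNbr_eq,
    PMF.mem_support_uniformOfFinset_iff]

theorem mem_support_run_rand {N : ℕ} {k : ℕ → Prog V α} {o : α × Cost} :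
    o ∈ (run G (.rand N k)).support ↔
      ∃ j ∈ drawAnswers N, ∃ o' ∈ (run G (k j)).support, charge 0 1 0 o' = o := by
  simp only [run, PMF.mem_support_bind_iff, PMF.mem_support_map_iff, uniformBelow_eq,
    PMF.mem_support_uniformOfFinset_iff]

/-- Every run of `p` ends with a result that satisfies `Q`, and the queries, steps and cells that
it uses add up to at most `n`. -/
def Within (p : Prog V α) (n : ℕ) (Q : α → Prop) : Prop :=
  ∀ o ∈ (run G p).support, Q o.1 ∧ o.2.queries + o.2.steps + o.2.cells ≤ n

theorem within_nbr_iff {v : V} {k : V → Prog V α} {n : ℕ} {Q : α → Prop} :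
    Within G (.nbr v k) (n + 2) Q ↔ ∀ w ∈ nbrAnswers G v, Within G (k w) n Q := by
  simp only [Within, mem_support_run_nbr]
  constructor
  · intro h w hw o ho
    have := h _ ⟨w, hw, o, ho, rfl⟩
    exact ⟨this.1, by simp only [charge] at this; omega⟩
  · rintro h _ ⟨w, hw, o, ho, rfl⟩
    have := h w hw o ho
    exact ⟨this.1, by simp only [charge]; omega⟩

theorem within_rand_iff {N : ℕ} {k : ℕ → Prog V α} {n : ℕ} {Q : α → Prop} :
    Within G (.rand N k) (n + 1) Q ↔ ∀ j ∈ drawAnswers N, Within G (k j) n Q := by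
  simp only [Within, mem_support_run_rand]
  constructor
  · intro h w hw o ho
    have := h _ ⟨w, hw, o, ho, rfl⟩
    exact ⟨this.1, by simp only [charge] at this; omega⟩
  · rintro h _ ⟨w, hw, o, ho, rfl⟩
    have := h w hw o ho
    exact ⟨this.1, by simp only [charge]; omega⟩

theorem run_bind (p : Prog V α) (f : α → Prog V β) :
    run G (p >>= f) = (run G p).bind fun o =>
      (run G (f o.1)).map (charge o.2.queries o.2.steps o.2.cells) := by
  change run G (p.bind f) = _
  have key : ∀ (q t c : ℕ) (x : PMF (α × Cost)),
      (x.bind fun o => (run G (f o.1)).map (charge o.2.queries o.2.steps o.2.cells)).map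
        (charge q t c) = (x.map (charge q t c)).bind fun o =>
        (run G (f o.1)).map (charge o.2.queries o.2.steps o.2.cells) := by
    intro q t c x
    rw [PMF.map_bind, PMF.bind_map]
    congr 1; funext o
    rw [PMF.map_comp]
    congr 1; funext o'
    simp [charge, add_assoc]
  induction p with
  | ret a =>
    simp only [Prog.bind, run, PMF.pure_bind]
    have : (charge 0 0 0 : β × Cost → β × Cost) = id := by funext o; simp [charge]
    rw [this, PMF.map_id]
  | nbr v k ih => simp only [Prog.bind, run, ih, PMF.bind_bind, key]
  | rand N k ih => simp only [Prog.bind, run, ih, PMF.bind_bind, key]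
  | _ => simp only [Prog.bind, run, *]

theorem Within.bind {p : Prog V α} {f : α → Prog V β} {n n' N : ℕ} {Q : α → Prop} {Q' : β → Prop}
    (hp : Within G p n Q) (hf : ∀ a, Q a → Within G (f a) n' Q') (hN : n + n' ≤ N) :
    Within G (p >>= f) N Q' := by
  intro o ho
  rw [run_bind, PMF.mem_support_bind_iff] at ho
  obtain ⟨x, hx, ho⟩ := ho
  rw [PMF.mem_support_map_iff] at ho
  obtain ⟨y, hy, rfl⟩ := ho
  obtain ⟨h1, h2⟩ := hp x hx
  obtain ⟨h3, h4⟩ := hf _ h1 y hy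
  refine ⟨h3, ?_⟩
  simp only [charge]; omega

theorem Within.mono {p : Prog V α} {n n' : ℕ} {Q Q' : α → Prop}
    (hp : Within G p n Q) (hn : n ≤ n') (hQ : ∀ a, Q a → Q' a) : Within G p n' Q' :=
  fun o ho => ⟨hQ _ (hp o ho).1, (hp o ho).2.trans hn⟩

theorem within_pure {a : α} {n : ℕ} {Q : α → Prop} (h : Q a) : Within G (pure a) n Q := by
  intro o ho
  have : o = (a, ⟨0, 0, 0⟩) := by
    simpa [run, PMF.mem_support_pure_iff] using
      (show o ∈ (PMF.pure (a, (⟨0, 0, 0⟩ : Cost))).support from ho)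
  subst this; simp [h]

theorem within_spend (t : ℕ) : Within G (spend t) t (fun _ => True) := by
  intro o ho
  simp only [spend, run, PMF.pure_map, PMF.mem_support_pure_iff] at ho
  subst ho; simp [charge]

theorem within_reserve (t : ℕ) : Within G (reserve t) t (fun _ => True) := by
  intro o ho
  simp only [reserve, run, PMF.pure_map, PMF.mem_support_pure_iff] at ho
  subst ho; simp [charge]

theorem within_askDeg (v : V) : Within G (askDeg v) 2 (fun d => d = G.degree v) := by
  intro o ho
  simp only [askDeg, run, PMF.pure_map, PMF.mem_support_pure_iff] at ho
  subst ho; simp [charge]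

theorem within_askAdj (u v : V) : Within G (askAdj u v) 2 (fun b => b = decide (G.Adj u v)) := by
  intro o ho
  simp only [askAdj, run, PMF.pure_map, PMF.mem_support_pure_iff] at ho
  subst ho; simp [charge]

theorem within_askNbr (v : V) : Within G (askNbr v) 2 (fun w => w ∈ nbrAnswers G v) :=
  (within_nbr_iff G (n := 0)).2 fun _ hw => within_pure G hw

theorem within_draw (N : ℕ) : Within G (draw N) 1 (fun j => j ∈ drawAnswers N) :=
  (within_rand_iff G (n := 0)).2 fun _ hj => within_pure G hj

theorem mean_le_mean {p : Prog V α} {n : ℕ} {Q : α → Prop} (hp : Within G p n Q) {f g : α → ℝ}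
    (h : ∀ a, Q a → f a ≤ g a) : mean G p f ≤ mean G p g := by
  replace hp : ∀ o ∈ (run G p).support, Q o.1 := fun o ho => (hp o ho).1
  induction p with
  | ret a =>
    exact h _ (hp (a, ⟨0, 0, 0⟩) (by simp [run]))
  | nbr v k ih =>
    refine expect_le_expect fun w hw => ih w fun o ho => ?_
    exact hp (charge 1 1 0 o) ((mem_support_run_nbr G).2 ⟨w, hw, o, ho, rfl⟩)
  | rand N k ih =>
    refine expect_le_expect fun w hw => ih w fun o ho => ?_
    exact hp (charge 0 1 0 o) ((mem_support_run_rand G).2 ⟨w, hw, o, ho, rfl⟩)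
  | deg v k ih =>
    refine ih _ fun o ho => hp (charge 1 1 0 o) ?_
    simp only [run, PMF.mem_support_map_iff]
    exact ⟨o, ho, rfl⟩
  | adj u v k ih =>
    refine ih _ fun o ho => hp (charge 1 1 0 o) ?_
    simp only [run, PMF.mem_support_map_iff]
    exact ⟨o, ho, rfl⟩
  | work t k ih =>
    refine ih fun o ho => hp (charge 0 t 0 o) ?_
    simp only [run, PMF.mem_support_map_iff]
    exact ⟨o, ho, rfl⟩
  | alloc c k ih =>
    refine ih fun o ho => hp (charge 0 0 c o) ?_
    simp only [run, PMF.mem_support_map_iff]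
    exact ⟨o, ho, rfl⟩

theorem mean_mono (p : Prog V α) {f g : α → ℝ} (h : ∀ a, f a ≤ g a) :
    mean G p f ≤ mean G p g := by
  induction p with
  | ret a => exact h a
  | nbr v k ih => exact expect_le_expect fun w _ => ih w
  | rand N k ih => exact expect_le_expect fun w _ => ih w
  | _ => simp only [mean]; apply_assumption

theorem mean_congr {p : Prog V α} {n : ℕ} {Q : α → Prop} (hp : Within G p n Q) {f g : α → ℝ}
    (h : ∀ a, Q a → f a = g a) : mean G p f = mean G p g :=
  le_antisymm (mean_le_mean G hp fun a ha => (h a ha).le)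
    (mean_le_mean G hp fun a ha => (h a ha).ge)

theorem mean_nonneg (p : Prog V α) {f : α → ℝ} (h : ∀ a, 0 ≤ f a) : 0 ≤ mean G p f := by
  rw [← mean_const G p 0]
  exact mean_mono G p h

theorem mean_sub (p : Prog V α) (f g : α → ℝ) :
    mean G p (fun a => f a - g a) = mean G p f - mean G p g := by
  have := mean_add G p (fun a => f a - g a) g
  simp only [sub_add_cancel] at this
  linarith

theorem mean_sum {ι : Type} (p : Prog V α) (s : Finset ι) (f : ι → α → ℝ) :
    mean G p (fun a => ∑ i ∈ s, f i a) = ∑ i ∈ s, mean G p (f i) := by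
  classical
  induction s using Finset.induction_on with
  | empty => simpa using mean_const G p 0
  | insert i s hi ih => simp only [Finset.sum_insert hi, mean_add, ih]

theorem toOuterMeasure_uniformOfFinset_bind (s : Finset β) (hs : s.Nonempty) (f : β → PMF α)
    (S : Set α) (x : β → ℝ) (hx : ∀ b, 0 ≤ x b)
    (h : ∀ b, (f b).toOuterMeasure S = ENNReal.ofReal (x b)) :
    ((PMF.uniformOfFinset s hs).bind f).toOuterMeasure S = ENNReal.ofReal (𝔼 b ∈ s, x b) := by
  rw [PMF.toOuterMeasure_bind_apply, tsum_eq_sum (s := s)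
    (fun b hb => by simp [PMF.uniformOfFinset_apply, hb])]
  rw [expect_eq_sum_div_card, div_eq_inv_mul, Finset.mul_sum,
    ENNReal.ofReal_sum_of_nonneg fun b _ => by have := hx b; positivity]
  refine Finset.sum_congr rfl fun b hb => ?_
  rw [PMF.uniformOfFinset_apply_of_mem hs hb, h, ENNReal.ofReal_mul (by positivity),
    ENNReal.ofReal_inv_of_pos (by exact_mod_cast hs.card_pos), ENNReal.ofReal_natCast]

open Classical in
/-- The probability that the result of a program lies in `S` is the expected value of the
indicator of `S`. -/
theorem run_toOuterMeasure (p : Prog V α) (S : Set α) :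
    (run G p).toOuterMeasure {o | o.1 ∈ S} =
      ENNReal.ofReal (mean G p fun a => if a ∈ S then 1 else 0) := by
  have hpre : ∀ q t c : ℕ, (charge q t c : α × Cost → α × Cost) ⁻¹' {o | o.1 ∈ S} = {o | o.1 ∈ S} :=
    fun q t c => rfl
  have hnn : ∀ p : Prog V α, 0 ≤ mean G p fun a => if a ∈ S then (1 : ℝ) else 0 := fun p =>
    mean_nonneg G p fun a => by split_ifs <;> norm_num
  induction p with
  | ret a =>
    simp only [run, PMF.toOuterMeasure_pure_apply, mean, Set.mem_ofPred_eq]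
    split_ifs <;> simp
  | nbr v k ih =>
    simp only [run, mean, uniformNbr_eq]
    refine toOuterMeasure_uniformOfFinset_bind _ _ _ _ _ (fun w => hnn _) fun w => ?_
    rw [PMF.toOuterMeasure_map_apply, hpre, ih]
  | rand N k ih =>
    simp only [run, mean, uniformBelow_eq]
    refine toOuterMeasure_uniformOfFinset_bind _ _ _ _ _ (fun w => hnn _) fun w => ?_
    rw [PMF.toOuterMeasure_map_apply, hpre, ih]
  | _ => simp only [run, mean, PMF.toOuterMeasure_map_apply, *]

end Semantics

/-! ### The subroutines of the estimator -/

section Subroutines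

variable {V : Type} [Fintype V] (G : SimpleGraph V) [DecidableRel G.Adj]

theorem nbrAnswers_of_pos {u : V} (h : 0 < G.degree u) : nbrAnswers G u = G.neighborFinset u := by
  rw [nbrAnswers, if_pos]
  rwa [← Finset.card_pos, SimpleGraph.card_neighborFinset_eq_degree]

theorem drawAnswers_of_pos {N : ℕ} (h : 0 < N) : drawAnswers N = Finset.range N := by
  rw [drawAnswers, if_pos]
  simpa using h.ne'

/-- The record that the algorithm keeps of a step from `u` to `v`. -/
def stepRecord (u v : V) : WalkEdge V := ⟨u, v, G.degree u, G.degree v⟩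

/-- The expected value of `f` at the list of edges of an `r`-step random walk from `u`. -/
noncomputable def walkMean : ℕ → V → (List (WalkEdge V) → ℝ) → ℝ
  | 0, _, f => f []
  | r + 1, u, f => 𝔼 v ∈ nbrAnswers G u, walkMean r v fun R => f (stepRecord G u v :: R)

theorem mean_walk (r : ℕ) (u : V) (f : List (WalkEdge V) → ℝ) :
    mean G (walk r u (G.degree u)) f = walkMean G r u f := by
  induction r generalizing u f with
  | zero => rfl
  | succ r ih =>
    simp only [walk, mean_bind, mean_askNbr, mean_askDeg, mean_spend, mean_reserve, ih, mean_pure]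
    rfl

/-- The list consists of records of steps along edges of `G`. -/
def IsTrace (R : List (WalkEdge V)) : Prop :=
  ∀ e ∈ R, ∃ u v, G.Adj u v ∧ e = stepRecord G u v

theorem within_walk (hG : ∀ v, 0 < G.degree v) (r : ℕ) (u : V) :
    Within G (walk r u (G.degree u)) (12 * r) (fun R => R.length = r ∧ IsTrace G R) := by
  induction r generalizing u with
  | zero => exact within_pure G ⟨rfl, by simp [IsTrace]⟩
  | succ r ih =>
    simp only [walk]
    refine (within_askNbr G u).bind G (n' := 12 * r + 10) (fun v hv => ?_) (by omega)
    refine (within_askDeg G v).bind G (n' := 12 * r + 8) (fun d hd => ?_) (by omega)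
    subst hd
    refine (within_spend G 4).bind G (n' := 12 * r + 4) (fun _ _ => ?_) (by omega)
    refine (within_reserve G 4).bind G (n' := 12 * r) (fun _ _ => ?_) (by omega)
    refine (ih v).bind G (n' := 0) (fun R hR => within_pure G ⟨by simp [hR.1], ?_⟩) (by omega)
    rw [nbrAnswers_of_pos G (hG u), SimpleGraph.mem_neighborFinset] at hv
    intro e he
    rcases List.mem_cons.1 he with rfl | he
    · exact ⟨u, v, hv, rfl⟩
    · exact hR.2 e he

/-- The total weight of a function under the cells of an alias table. -/
def aliasWeight {ι : Type} (S : ℕ) (A : List (AliasCell ι)) (h : ι → ℝ) : ℝ :=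
  (A.map fun c => (c.thr : ℝ) * h c.fst + ((S : ℝ) - c.thr) * h c.snd).sum

/-- The total weight of a function under a list of weighted items. -/
def itemWeight {ι : Type} (L : List (ℕ × ι)) (h : ι → ℝ) : ℝ :=
  (L.map fun x => (x.1 : ℝ) * h x.2).sum

theorem mul_length_le_sum_of_forall_le {ι : Type} (S : ℕ) (L : List (ℕ × ι))
    (h : ∀ x ∈ L, S ≤ x.1) :
    S * L.length ≤ (L.map Prod.fst).sum := by
  induction L with
  | nil => simp
  | cons x L ih =>
    have h1 := h x (by simp)
    have h2 := ih fun y hy => h y (by simp [hy])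
    simp only [List.map_cons, List.sum_cons, List.length_cons]
    nlinarith

theorem sum_lt_mul_length_of_forall_lt {ι : Type} (S : ℕ) (L : List (ℕ × ι)) (h : ∀ x ∈ L, x.1 < S)
    (hL : L ≠ []) : (L.map Prod.fst).sum < S * L.length := by
  induction L with
  | nil => simp at hL
  | cons x L ih =>
    have h1 := h x (by simp)
    simp only [List.map_cons, List.sum_cons, List.length_cons]
    by_cases hL' : L = []
    · subst hL'; simpa using h1
    · have h2 := ih (fun y hy => h y (by simp [hy])) hL'
      nlinarith

/-- The alias table distributes the weights of the items over cells of equal weight. -/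
theorem within_aliasTable {ι : Type} (S : ℕ) (ss gs : List (ℕ × ι))
    (hs : ∀ x ∈ ss, x.1 < S) (hg : ∀ x ∈ gs, S ≤ x.1)
    (hsum : (ss.map Prod.fst).sum + (gs.map Prod.fst).sum = S * (ss.length + gs.length)) :
    Within G (aliasTable S ss gs) (13 * (ss.length + gs.length)) (fun A =>
      A.length = ss.length + gs.length ∧ (∀ c ∈ A, c.thr ≤ S) ∧
        ∀ h : ι → ℝ, aliasWeight S A h = itemWeight ss h + itemWeight gs h) := by
  induction ss, gs using aliasTable.induct S with
  | case1 =>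
    rw [aliasTable]
    exact within_pure G (by simp [aliasWeight, itemWeight])
  | case2 q f gs ih =>
    rw [aliasTable]
    have hq : S ≤ q := hg (q, f) (by simp)
    have h2 := mul_length_le_sum_of_forall_le S gs fun x hx => hg x (by simp [hx])
    simp only [List.map_cons, List.sum_cons, List.length_cons, List.map_nil, List.sum_nil,
      List.length_nil, zero_add] at hsum ⊢
    have hqS : q = S := by nlinarith
    subst hqS
    refine (within_spend G 4).bind G (n' := 13 * gs.length + 3) (fun _ _ => ?_) (by omega)
    refine (within_reserve G 3).bind G (n' := 13 * gs.length) (fun _ _ => ?_) (by omega)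
    refine (ih (by simp) (fun x hx => hg x (by simp [hx])) (by simp; nlinarith)).bind G (n' := 0)
      (fun A hA => within_pure G ⟨?_, ?_, ?_⟩) (by simp)
    · simpa using hA.1
    · simpa using hA.2.1
    · intro h
      have := hA.2.2 h
      simp only [aliasWeight, itemWeight, List.map_cons, List.sum_cons, List.map_nil,
        List.sum_nil] at this ⊢
      linarith
  | case3 p e ss ih =>
    exfalso
    have := sum_lt_mul_length_of_forall_lt S ((p, e) :: ss) hs (by simp)
    simp at this hsum
    omega
  | case4 p e ss q f gs ih1 ih2 =>
    rw [aliasTable]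
    have hp : p < S := hs (p, e) (by simp)
    have hq : S ≤ q := hg (q, f) (by simp)
    have hss : ∀ x ∈ ss, x.1 < S := fun x hx => hs x (by simp [hx])
    have hgs : ∀ x ∈ gs, S ≤ x.1 := fun x hx => hg x (by simp [hx])
    simp only [List.map_cons, List.sum_cons, List.length_cons] at hsum ⊢
    have hpq : ((p + q - S : ℕ) : ℝ) = (p : ℝ) + q - S := by
      rw [Nat.cast_sub (by omega)]; push_cast; ring
    refine (within_spend G 10).bind G (n' := 13 * (ss.length + gs.length + 1) + 3)
      (fun _ _ => ?_) (by omega)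
    refine (within_reserve G 3).bind G (n' := 13 * (ss.length + gs.length + 1))
      (fun _ _ => ?_) (by omega)
    have key : Within G (if p + q - S < S then aliasTable S ((p + q - S, f) :: ss) gs
        else aliasTable S ss ((p + q - S, f) :: gs)) (13 * (ss.length + gs.length + 1)) (fun A =>
        A.length = ss.length + gs.length + 1 ∧ (∀ c ∈ A, c.thr ≤ S) ∧ ∀ h : ι → ℝ,
          aliasWeight S A h = itemWeight ss h + itemWeight gs h + ((p : ℝ) + q - S) * h f) := by
      split_ifs with hlt
      · refine (ih1 (List.forall_mem_cons.2 ⟨hlt, hss⟩) hgs ?_).mono G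
          (by simp; omega) fun A hA => ⟨?_, hA.2.1, fun h => ?_⟩
        · simp only [List.map_cons, List.sum_cons, List.length_cons]
          zify [show S ≤ p + q by omega] at hsum ⊢
          linarith
        · have := hA.1; simp at this; omega
        · rw [hA.2.2 h]
          simp only [itemWeight, List.map_cons, List.sum_cons, hpq]
          ring
      · refine (ih2 hss (List.forall_mem_cons.2 ⟨not_lt.1 hlt, hgs⟩) ?_).mono G
          (by simp; omega) fun A hA => ⟨?_, hA.2.1, fun h => ?_⟩
        · simp only [List.map_cons, List.sum_cons, List.length_cons]
          zify [show S ≤ p + q by omega] at hsum ⊢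
          linarith
        · have := hA.1; simp at this; omega
        · rw [hA.2.2 h]
          simp only [itemWeight, List.map_cons, List.sum_cons, hpq]
          ring
    rw [← apply_ite fun B : Prog V (List (AliasCell ι)) => B >>= fun A =>
      pure (⟨p, e, f⟩ :: A)]
    refine key.bind G (n' := 0) (fun A hA => within_pure G ⟨?_, ?_, ?_⟩) (by omega)
    · simp [hA.1]; omega
    · intro c hc
      rcases List.mem_cons.1 hc with rfl | hc
      · exact hp.le
      · exact hA.2.1 c hc
    · intro h
      have := hA.2.2 h
      simp only [aliasWeight, itemWeight, List.map_cons, List.sum_cons] at this ⊢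
      rw [this]; ring

theorem filter_sum_add {ι : Type} (L : List (ℕ × ι)) (S : ℕ) (h : ℕ × ι → ℝ) :
    ((L.filter fun x => x.1 < S).map h).sum + ((L.filter fun x => S ≤ x.1).map h).sum =
      (L.map h).sum := by
  induction L with
  | nil => simp
  | cons x L ih =>
    by_cases hx : x.1 < S
    · have hx' : ¬ S ≤ x.1 := by omega
      simp only [List.filter_cons, hx, hx', decide_true, decide_false, if_true, List.map_cons,
        List.sum_cons, Bool.false_eq_true, if_false]
      linarith
    · have hx' : S ≤ x.1 := by omega
      simp only [List.filter_cons, hx, hx', decide_true, decide_false, if_true, List.map_cons,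
        List.sum_cons, Bool.false_eq_true, if_false]
      linarith

/-- The sampling table gives the record `e` a share of the `R.length * d_R` pairs of draws that is
proportional to `d_e`. -/
theorem within_samplingTable (R : List (WalkEdge V)) :
    Within G (samplingTable R (R.map WalkEdge.edgeDeg).sum) (19 * R.length) (fun A =>
      A.length = R.length ∧ (∀ c ∈ A, c.thr ≤ (R.map WalkEdge.edgeDeg).sum) ∧
        ∀ h : WalkEdge V → ℝ, aliasWeight (R.map WalkEdge.edgeDeg).sum A h =
          R.length * (R.map fun e => (e.edgeDeg : ℝ) * h e).sum) := by
  set S := (R.map WalkEdge.edgeDeg).sum with hS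
  set W := R.map fun e => (R.length * e.edgeDeg, e) with hW
  have hw : ∀ h : WalkEdge V → ℝ, itemWeight (W.filter fun x => x.1 < S) h +
      itemWeight (W.filter fun x => S ≤ x.1) h =
      R.length * (R.map fun e => (e.edgeDeg : ℝ) * h e).sum := by
    intro h
    have := filter_sum_add W S fun x => (x.1 : ℝ) * h x.2
    rw [itemWeight, itemWeight, this, hW, List.map_map, ← List.sum_map_mul_left]
    congr 1
    refine List.map_congr_left fun e _ => ?_
    simp; ring
  have hl : (W.filter fun x => x.1 < S).length + (W.filter fun x => S ≤ x.1).length = R.length := by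
    have := filter_sum_add W S fun _ => 1
    simp only [List.map_const', List.sum_replicate, nsmul_eq_mul, mul_one] at this
    have hWl : W.length = R.length := by simp [hW]
    rw [hWl] at this
    exact_mod_cast this
  have hs : ((W.filter fun x => x.1 < S).map Prod.fst).sum +
      ((W.filter fun x => S ≤ x.1).map Prod.fst).sum =
      S * ((W.filter fun x => x.1 < S).length + (W.filter fun x => S ≤ x.1).length) := by
    have := hw fun _ => 1
    rw [hl]
    have h2 : (((W.filter fun x => x.1 < S).map Prod.fst).sum +
      ((W.filter fun x => S ≤ x.1).map Prod.fst).sum : ℝ) = S * R.length := by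
      simp only [itemWeight, mul_one] at this
      rw [Nat.cast_list_sum, Nat.cast_list_sum, List.map_map, List.map_map, hS,
        Nat.cast_list_sum, List.map_map, mul_comm]
      exact this
    exact_mod_cast h2
  simp only [samplingTable]
  refine (within_spend G _).bind G (n' := 15 * R.length) (fun _ _ => ?_) (by omega)
  refine (within_reserve G _).bind G (n' := 13 * R.length) (fun _ _ => ?_) (by omega)
  refine (within_aliasTable G S _ _ (by simp) (by simp) hs).mono G (by rw [hl]) fun A hA =>
    ⟨hA.1.trans hl, hA.2.1, fun h => (hA.2.2 h).trans (hw h)⟩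

theorem expect_range_ite_lt {S t : ℕ} (ht : t ≤ S) (a b : ℝ) :
    𝔼 x ∈ Finset.range S, (if x < t then a else b) = (t * a + (S - t) * b) / S := by
  rw [expect_eq_sum_div_card, Finset.card_range, Finset.sum_ite]
  have h1 : (Finset.range S).filter (fun x => x < t) = Finset.range t := by
    ext x; simp; omega
  have h2 : ((Finset.range S).filter (fun x => ¬ x < t)).card = S - t := by
    have := Finset.card_filter_add_card_filter_not (s := Finset.range S) (fun x => x < t)
    rw [h1] at this
    simp at this ⊢; omega
  rw [Finset.sum_const, Finset.sum_const, h1, h2, Finset.card_range, nsmul_eq_mul, nsmul_eq_mul,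
    Nat.cast_sub ht]

theorem expect_range_getElem {β : Type} (A : List β) (f : β → ℝ) (d : ℝ) :
    𝔼 j ∈ Finset.range A.length, (A[j]?.elim d f) = (A.map f).sum / A.length := by
  rw [expect_eq_sum_div_card, Finset.card_range]
  congr 1
  induction A with
  | nil => simp
  | cons a A ih =>
    rw [List.length_cons, Finset.sum_range_succ']
    simp [ih, add_comm]

end Subroutines

/-! ### The trials -/

section Trials

variable {V : Type} [Fintype V] (G : SimpleGraph V) [DecidableRel G.Adj]

variable {G} in
theorem IsTrace.edgeDeg_pos {R : List (WalkEdge V)} (hR : IsTrace G R)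
    (hG : ∀ v, 0 < G.degree v) {e : WalkEdge V} (he : e ∈ R) : 0 < e.edgeDeg := by
  obtain ⟨u, v, -, rfl⟩ := hR e he
  exact lt_min (hG u) (hG v)

variable {G} in
theorem IsTrace.sum_edgeDeg_pos {R : List (WalkEdge V)} (hR : IsTrace G R)
    (hG : ∀ v, 0 < G.degree v) (hne : R ≠ []) : 0 < (R.map WalkEdge.edgeDeg).sum := by
  obtain ⟨e, R, rfl⟩ := List.exists_cons_of_ne_nil hne
  have := hR.edgeDeg_pos hG (e := e) (by simp)
  simp; omega

variable [LinearOrder V]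

/-- The part of a trial that follows the choice of the edge record `e`. -/
def triangleTest (e : WalkEdge V) : Prog V ℕ := do
  let w ← askNbr e.low
  let isTriangle ← askAdj e.high w
  if isTriangle then do
    let du ← askDeg e.u
    let dv ← askDeg e.v
    let dw ← askDeg w
    spend 6
    if (du < dw ∨ (du = dw ∧ e.u < w)) ∧ (dv < dw ∨ (dv = dw ∧ e.v < w)) then pure 1
    else pure 0
  else pure 0

theorem trial_eq {V : Type} [LinearOrder V] (dR : ℕ) (A : List (AliasCell (WalkEdge V))) :
    trial dR A = (do
      let j ← draw A.length
      let x ← draw dR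
      spend 6
      match A[j]? with
      | none => pure 0
      | some c => triangleTest (if x < c.thr then c.fst else c.snd)) := rfl

/-- Choosing an edge with weight `d_e` and then one of its `d_e` candidates `w` amounts to a uniform
choice of the pair, so the weighted success probability counts the assigned triangles. -/
theorem mean_triangleTest (u v : V) (hG : ∀ v, 0 < G.degree v) :
    ((stepRecord G u v).edgeDeg : ℝ) * mean G (triangleTest (stepRecord G u v)) (fun y => (y : ℝ)) =
      assignedTriangles G u v := by
  have hlow : (stepRecord G u v).low = u ∧ (stepRecord G u v).high = v ∧
        (stepRecord G u v).edgeDeg = G.degree u ∨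
      (stepRecord G u v).low = v ∧ (stepRecord G u v).high = u ∧
        (stepRecord G u v).edgeDeg = G.degree v := by
    by_cases hlt : G.degree u < G.degree v
    · exact Or.inl ⟨if_pos hlt, if_pos hlt, min_eq_left hlt.le⟩
    · exact Or.inr ⟨if_neg hlt, if_neg hlt, min_eq_right (not_lt.1 hlt)⟩
  have hval : mean G (triangleTest (stepRecord G u v)) (fun y => (y : ℝ)) =
      𝔼 w ∈ nbrAnswers G (stepRecord G u v).low, if G.Adj (stepRecord G u v).high w ∧
        DegPrec G u w ∧ DegPrec G v w then 1 else 0 := by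
    simp only [triangleTest, mean_bind, mean_askNbr, mean_askAdj]
    refine expect_congr rfl fun w _ => ?_
    by_cases hw : G.Adj (stepRecord G u v).high w
    · by_cases hp : DegPrec G u w ∧ DegPrec G v w
      · rw [decide_eq_true hw, if_pos rfl, if_pos ⟨hw, hp⟩]
        simp only [mean_bind, mean_askDeg, mean_spend]
        exact (congrArg (fun x : Prog V ℕ => mean G x (fun y => (y : ℝ))) (if_pos hp)).trans
          (by simp)
      · rw [decide_eq_true hw, if_pos rfl, if_neg fun h => hp h.2]
        simp only [mean_bind, mean_askDeg, mean_spend]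
        exact (congrArg (fun x : Prog V ℕ => mean G x (fun y => (y : ℝ))) (if_neg hp)).trans
          (by simp)
    · simp [hw]
  have key : ∀ a b : V, (∀ w, G.Adj a w ∧ G.Adj b w ∧ DegPrec G u w ∧ DegPrec G v w ↔
      G.Adj u w ∧ G.Adj v w ∧ DegPrec G u w ∧ DegPrec G v w) →
      (G.degree a : ℝ) * (𝔼 w ∈ nbrAnswers G a, if G.Adj b w ∧
        DegPrec G u w ∧ DegPrec G v w then 1 else 0) = assignedTriangles G u v := by
    intro a b hab
    rw [nbrAnswers_of_pos G (hG _), expect_eq_sum_div_card,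
      SimpleGraph.card_neighborFinset_eq_degree, mul_div_cancel₀ _ (by exact_mod_cast (hG _).ne'),
      Finset.sum_boole, assignedTriangles]
    congr 2
    ext w
    simp only [Finset.mem_filter, SimpleGraph.mem_neighborFinset, Finset.mem_univ, true_and]
    exact hab w
  rw [hval]
  rcases hlow with ⟨h1, h2, h3⟩ | ⟨h1, h2, h3⟩
  · rw [h1, h2, h3]; exact key u v fun w => Iff.rfl
  · rw [h1, h2, h3]; exact key v u fun w => by tauto

/-- The number of triangles assigned to the edge of a record. -/
def recordTriangles (e : WalkEdge V) : ℕ := assignedTriangles G e.u e.v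

theorem within_trial (dR : ℕ) (A : List (AliasCell (WalkEdge V))) :
    Within G (trial dR A) 24 (fun y => y = 0 ∨ y = 1) := by
  simp only [trial]
  refine (within_draw G _).bind G (n' := 23) (fun j _ => ?_) (by omega)
  refine (within_draw G _).bind G (n' := 22) (fun x _ => ?_) (by omega)
  refine (within_spend G _).bind G (n' := 16) (fun _ _ => ?_) (by omega)
  rcases A[j]? with _ | c
  · exact within_pure G (by simp)
  refine (within_askNbr G _).bind G (n' := 14) (fun w _ => ?_) (by omega)
  refine (within_askAdj G _ _).bind G (n' := 12) (fun b _ => ?_) (by omega)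
  cases b
  · exact within_pure G (by simp)
  simp only [if_true]
  refine (within_askDeg G _).bind G (n' := 10) (fun _ _ => ?_) (by omega)
  refine (within_askDeg G _).bind G (n' := 8) (fun _ _ => ?_) (by omega)
  refine (within_askDeg G _).bind G (n' := 6) (fun _ _ => ?_) (by omega)
  refine (within_spend G _).bind G (n' := 0) (fun _ _ => ?_) (by omega)
  split_ifs <;> exact within_pure G (by simp)

/-- The success probability of one trial is `t_R / d_R`. -/
theorem mean_trial (hG : ∀ v, 0 < G.degree v) {R : List (WalkEdge V)} (hR : IsTrace G R)
    (hne : R ≠ []) {A : List (AliasCell (WalkEdge V))} (hlen : A.length = R.length)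
    (hthr : ∀ c ∈ A, c.thr ≤ (R.map WalkEdge.edgeDeg).sum)
    (hA : ∀ h : WalkEdge V → ℝ, aliasWeight (R.map WalkEdge.edgeDeg).sum A h =
          R.length * (R.map fun e => (e.edgeDeg : ℝ) * h e).sum) :
    mean G (trial (R.map WalkEdge.edgeDeg).sum A) (fun y => (y : ℝ)) =
      ((R.map (recordTriangles G)).sum : ℕ) / ((R.map WalkEdge.edgeDeg).sum : ℕ) := by
  have hd := hR.sum_edgeDeg_pos hG hne
  set dR := (R.map WalkEdge.edgeDeg).sum
  set H : WalkEdge V → ℝ := fun e => mean G (triangleTest e) (fun y => (y : ℝ)) with hH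
  have hAl : 0 < A.length := by rw [hlen]; exact List.length_pos_iff.2 hne
  have hRl : (R.length : ℝ) ≠ 0 := by rw [← hlen]; exact_mod_cast hAl.ne'
  have hdR : (dR : ℝ) ≠ 0 := by exact_mod_cast hd.ne'
  have h1 : mean G (trial dR A) (fun y => (y : ℝ)) = 𝔼 j ∈ Finset.range A.length,
      A[j]?.elim 0 fun c => (c.thr * H c.fst + (dR - c.thr) * H c.snd) / dR := by
    simp only [trial_eq, mean_bind, mean_draw, mean_spend, drawAnswers_of_pos hAl,
      drawAnswers_of_pos hd]
    refine expect_congr rfl fun j _ => ?_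
    rcases hj : A[j]? with _ | c
    · simp
    · simp only [Option.elim_some]
      rw [← expect_range_ite_lt (hthr c (List.mem_of_getElem? hj))]
      refine expect_congr rfl fun x _ => ?_
      simp only [hH]
      split_ifs <;> rfl
  have h2 : (A.map fun c => ((c.thr : ℝ) * H c.fst + (dR - c.thr) * H c.snd) / dR).sum =
      aliasWeight dR A H / dR := by
    simp only [aliasWeight, div_eq_mul_inv, List.sum_map_mul_right]
  have h3 : (R.map fun e => (e.edgeDeg : ℝ) * H e).sum = ((R.map (recordTriangles G)).sum : ℕ) := by
    rw [Nat.cast_list_sum, List.map_map]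
    congr 1
    refine List.map_congr_left fun e he => ?_
    obtain ⟨u, v, -, rfl⟩ := hR e he
    exact mean_triangleTest G u v hG
  rw [h1, expect_range_getElem, h2, hA, h3, hlen]
  field_simp

theorem within_trials (dR : ℕ) (A : List (AliasCell (WalkEdge V))) (ℓ : ℕ) :
    Within G (trials dR A ℓ) (26 * ℓ) (fun _ => True) := by
  induction ℓ with
  | zero => exact within_pure G trivial
  | succ ℓ ih =>
    simp only [trials]
    refine (within_trial G dR A).bind G (n' := 26 * ℓ + 2) (fun y _ => ?_) (by omega)
    refine (within_spend G _).bind G (n' := 26 * ℓ) (fun _ _ => ?_) (by omega)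
    exact ih.bind G (n' := 0) (fun z _ => within_pure G trivial) (by omega)

/-- The number of successes in `ℓ` independent trials has mean `ℓ p` and variance at most `ℓ p`. -/
theorem mean_trials (dR : ℕ) (A : List (AliasCell (WalkEdge V))) (ℓ : ℕ) {p : ℝ}
    (hp : mean G (trial dR A) (fun y => (y : ℝ)) = p) :
    mean G (trials dR A ℓ) (fun y => (y : ℝ) - ℓ * p) = 0 ∧
      mean G (trials dR A ℓ) (fun y => ((y : ℝ) - ℓ * p) ^ 2) ≤ ℓ * p := by
  induction ℓ with
  | zero => simp [trials]
  | succ ℓ ih =>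
    have hvar : mean G (trial dR A) (fun y => ((y : ℝ) - p) ^ 2) ≤ p := by
      have h1 : ∀ y : ℕ, y = 0 ∨ y = 1 → ((y : ℝ) - p) ^ 2 = (1 - 2 * p) * y + p ^ 2 := by
        rintro y (rfl | rfl) <;> push_cast <;> ring
      rw [mean_congr G (within_trial G dR A) h1, mean_add, mean_const_mul, mean_const, hp]
      nlinarith [sq_nonneg p]
    have hzero : mean G (trial dR A) (fun y => (y : ℝ) - p) = 0 := by
      rw [mean_sub, mean_const, hp, sub_self]
    simp only [trials, mean_bind, mean_spend, mean_pure]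
    constructor
    · have : ∀ y z : ℕ, (((y + z : ℕ) : ℝ) - (ℓ + 1 : ℕ) * p) = (z - ℓ * p) + (y - p) := by
        intro y z; push_cast; ring
      simp only [this, mean_add, ih.1, mean_const, hzero, zero_add]
    · have : ∀ y z : ℕ, (((y + z : ℕ) : ℝ) - (ℓ + 1 : ℕ) * p) ^ 2 =
          (z - ℓ * p) ^ 2 + (2 * (y - p) * (z - ℓ * p) + (y - p) ^ 2) := by
        intro y z; push_cast; ring
      simp only [this, mean_add, mean_const_mul, ih.1, mean_const, mul_zero, zero_add]
      push_cast
      linarith [ih.2]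

end Trials

/-! ### The edge count estimator -/

section Collisions

variable {V : Type} [Fintype V] (G : SimpleGraph V) [DecidableRel G.Adj] [DecidableEq V]

/-- The entries of a list at the positions `i, i + τ, i + 2τ, …`. -/
def everyNth {β : Type} (τ : ℕ) : ℕ → List β → List β
  | _, [] => []
  | 0, x :: R => x :: everyNth τ (τ - 1) R
  | i + 1, _ :: R => everyNth τ i R

/-- The number of pairs of positions of a list with equal entries. -/
def equalPairs {β : Type} [DecidableEq β] : List β → ℕ
  | [] => 0
  | x :: L => L.count x + equalPairs L

theorem everyNth_nil {β : Type} (τ i : ℕ) : everyNth τ i ([] : List β) = [] := by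
  cases i <;> rfl

theorem everyNth_eq_drop {β : Type} (τ i : ℕ) (R : List β) :
    everyNth τ i R = everyNth τ 0 (R.drop i) := by
  induction R generalizing i with
  | nil => simp [everyNth_nil]
  | cons x R ih =>
    cases i with
    | zero => rfl
    | succ i => simpa [everyNth] using ih i

theorem length_everyNth {β : Type} {τ : ℕ} (hτ : 0 < τ) (R : List β) (i : ℕ) (hi : i < τ) :
    (everyNth τ i R).length = (R.length + (τ - 1 - i)) / τ := by
  induction R generalizing i with
  | nil => simp [everyNth_nil, Nat.div_eq_of_lt (show τ - 1 - i < τ by omega)]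
  | cons x R ih =>
    cases i with
    | zero =>
      rw [everyNth, List.length_cons, ih _ (by omega), List.length_cons,
        show R.length + 1 + (τ - 1 - 0) = R.length + (τ - 1 - (τ - 1)) + τ by omega,
        Nat.add_div_right _ hτ]
    | succ i =>
      rw [everyNth, ih _ (by omega), List.length_cons]
      congr 1; omega

/-- The undirected edge of a record. -/
def recordEdge (e : WalkEdge V) : Sym2 V := s(e.u, e.v)

/-- The dictionary `D` holds the edges that were seen before; the loop adds the pairs that the new
edges form with them and with each other. -/
theorem within_collisions (R : List (WalkEdge V)) {τ : ℕ} (hτ : 0 < τ) (fuel i : ℕ)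
    (D : Sym2 V → ℕ) (k c : ℕ) (hf : (R.drop i).length ≤ fuel) :
    Within G (collisions R τ fuel i D k c) (10 * (everyNth τ i R).length) (fun kc =>
      kc = (k + (everyNth τ i R).length, c + (((everyNth τ i R).map recordEdge).map D).sum +
        equalPairs ((everyNth τ i R).map recordEdge))) := by
  induction fuel generalizing i D k c with
  | zero =>
    have : R.drop i = [] := List.length_eq_zero_iff.1 (by omega)
    rw [everyNth_eq_drop, this]
    exact within_pure G (by simp [everyNth, equalPairs])
  | succ fuel ih =>
    rw [collisions]
    rcases hi : R[i]? with _ | e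
    · have : R.drop i = [] := by
        rw [List.drop_eq_nil_iff]; exact List.getElem?_eq_none_iff.1 hi
      rw [everyNth_eq_drop, this]
      exact within_pure G (by simp [everyNth, equalPairs])
    · have hdrop : R.drop i = e :: R.drop (i + 1) := by
        obtain ⟨hlt, rfl⟩ := List.getElem?_eq_some_iff.1 hi
        exact List.drop_eq_getElem_cons hlt
      have hev : everyNth τ i R = e :: everyNth τ (i + τ) R := by
        rw [everyNth_eq_drop, hdrop, everyNth, everyNth_eq_drop, List.drop_drop,
          show i + 1 + (τ - 1) = i + τ by omega, ← everyNth_eq_drop]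
      have hlen : (R.drop (i + τ)).length ≤ fuel := by
        simp only [List.length_drop] at hf ⊢; omega
      rw [hev]
      set L := everyNth τ (i + τ) R with hL
      refine (within_spend G _).bind G (n' := 10 * L.length + 2) (fun _ _ => ?_)
        (by simp only [List.length_cons]; omega)
      refine (within_reserve G _).bind G (n' := 10 * L.length) (fun _ _ => ?_) (by omega)
      refine (ih (i + τ) _ (k + 1) (c + D s(e.u, e.v)) hlen).mono G le_rfl fun kc hkc => ?_
      rw [hkc, ← hL]
      have hD : ∀ M : List (Sym2 V),
          (M.map (Function.update D s(e.u, e.v) (D s(e.u, e.v) + 1))).sum =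
          (M.map D).sum + M.count s(e.u, e.v) := by
        intro M
        induction M with
        | nil => simp
        | cons x M ihM =>
          rw [List.map_cons, List.sum_cons, ihM, List.map_cons, List.sum_cons, List.count_cons]
          by_cases hx : x = s(e.u, e.v)
          · subst hx; simp; ring
          · simp [hx]; ring
      rw [hD]
      ext
      · simp; ring
      · simp only [List.map_cons, List.sum_cons, equalPairs, recordEdge]
        ring

/-- The value of the edge count estimator on a trace. -/
def edgeEstimate (τ : ℕ) (R : List (WalkEdge V)) : ℚ :=
  (∑ i ∈ Finset.range τ, ((everyNth τ i R).length.choose 2 : ℚ) /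
    (equalPairs ((everyNth τ i R).map recordEdge) : ℚ)) / τ

theorem within_edgeCountSum (R : List (WalkEdge V)) {τ q : ℕ} (hτ : 0 < τ)
    (hR : R.length = q * τ) (j : ℕ) (hj : j ≤ τ) :
    Within G (edgeCountSum R τ j) ((10 * q + 8) * j) (fun y =>
      y = ∑ i ∈ Finset.range j, ((everyNth τ i R).length.choose 2 : ℚ) /
        (equalPairs ((everyNth τ i R).map recordEdge) : ℚ)) := by
  induction j with
  | zero => exact within_pure G (by simp)
  | succ j ih =>
    have hq : (everyNth τ j R).length = q := by
      rw [length_everyNth hτ R j hj, hR, mul_comm, Nat.mul_add_div hτ,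
        Nat.div_eq_of_lt (by omega), add_zero]
    simp only [edgeCountSum]
    refine (within_collisions G R hτ R.length j _ 0 0 (by simp)).bind G
      (n' := (10 * q + 8) * j + 8) (fun kc hkc => ?_) (by rw [hq]; ring_nf; omega)
    refine (within_spend G _).bind G (n' := (10 * q + 8) * j) (fun _ _ => ?_) (by omega)
    refine (ih (by omega)).bind G (n' := 0) (fun y hy => within_pure G ?_) (by omega)
    rw [Finset.sum_range_succ, hy, hkc]
    simp [add_comm, Function.comp_def]

theorem within_edgeCountEstimator (R : List (WalkEdge V)) {τ q : ℕ} (hτ : 0 < τ)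
    (hR : R.length = q * τ) :
    Within G (edgeCountEstimator R τ) ((10 * q + 8) * τ + 1) (fun y => y = edgeEstimate τ R) := by
  simp only [edgeCountEstimator]
  refine (within_edgeCountSum G R hτ hR τ le_rfl).bind G (n' := 1) (fun y hy => ?_) le_rfl
  refine (within_spend G _).bind G (n' := 0) (fun _ _ => within_pure G ?_) le_rfl
  rw [hy, edgeEstimate]

end Collisions

/-! ### Convergence of the random walk -/

section Mixing

variable {V : Type} [Fintype V] (G : SimpleGraph V) [DecidableRel G.Adj]

theorem walkMatrix_mulVec (hG : ∀ v, 0 < G.degree v) (f : V → ℝ) (u : V) :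
    (walkMatrix G *ᵥ f) u = 𝔼 v ∈ nbrAnswers G u, f v := by
  rw [nbrAnswers_of_pos G (hG u), expect_eq_sum_div_card,
    SimpleGraph.card_neighborFinset_eq_degree, Matrix.mulVec, dotProduct, div_eq_inv_mul,
    Finset.mul_sum, SimpleGraph.neighborFinset_eq_filter, Finset.sum_filter]
  refine Finset.sum_congr rfl fun v _ => ?_
  simp only [walkMatrix, Matrix.of_apply]
  split_ifs <;> simp

theorem walkMatrix_nonneg (u v : V) : 0 ≤ walkMatrix G u v := by
  simp only [walkMatrix, Matrix.of_apply]
  split_ifs <;> positivity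

theorem card_edgeFinset_pos [Nonempty V] (hG : ∀ v, 0 < G.degree v) : 0 < G.edgeFinset.card := by
  have h1 := G.sum_degrees_eq_twice_card_edges
  have h2 : 0 < ∑ v, G.degree v := Finset.sum_pos (fun v _ => hG v) Finset.univ_nonempty
  omega

theorem stationary_nonneg (v : V) : 0 ≤ stationary G v := by unfold stationary; positivity

theorem sum_stationary [Nonempty V] (hG : ∀ v, 0 < G.degree v) : ∑ v, stationary G v = 1 := by
  have h1 := G.sum_degrees_eq_twice_card_edges
  have h2 := card_edgeFinset_pos G hG
  simp only [stationary]
  rw [← Finset.sum_div, ← Nat.cast_sum, h1]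
  push_cast
  exact div_self (by positivity)

/-- A matrix whose rows are all close to one vector contracts the vectors of sum zero. -/
theorem sum_abs_vecMul_le {Q : Matrix V V ℝ} {p : V → ℝ} {ρ : ℝ}
    (h : ∀ u, ∑ v, |Q u v - p v| ≤ ρ) {x : V → ℝ} (hx : ∑ u, x u = 0) :
    ∑ v, |(x ᵥ* Q) v| ≤ ρ * ∑ u, |x u| := by
  have h1 : ∀ v, (x ᵥ* Q) v = ∑ u, x u * (Q u v - p v) := by
    intro v
    simp only [Matrix.vecMul, dotProduct, mul_sub, Finset.sum_sub_distrib, ← Finset.sum_mul, hx,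
      zero_mul, sub_zero]
  calc ∑ v, |(x ᵥ* Q) v| ≤ ∑ v, ∑ u, |x u| * |Q u v - p v| := by
        refine Finset.sum_le_sum fun v _ => ?_
        rw [h1]
        refine (Finset.abs_sum_le_sum_abs _ _).trans (le_of_eq ?_)
        exact Finset.sum_congr rfl fun u _ => abs_mul _ _
    _ = ∑ u, |x u| * ∑ v, |Q u v - p v| := by
        rw [Finset.sum_comm]; simp only [Finset.mul_sum]
    _ ≤ ∑ u, |x u| * ρ :=
        Finset.sum_le_sum fun u _ => mul_le_mul_of_nonneg_left (h u) (abs_nonneg _)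
    _ = ρ * ∑ u, |x u| := by rw [← Finset.sum_mul, mul_comm]

variable [LinearOrder V]

theorem walkMatrix_pow_mulVec_one (hG : ∀ v, 0 < G.degree v) (t : ℕ) :
    walkMatrix G ^ t *ᵥ (fun _ => 1) = fun _ => 1 := by
  have h1 : walkMatrix G *ᵥ (fun _ => 1) = fun _ => 1 := by
    funext u
    rw [walkMatrix_mulVec G hG, expect_const (nbrAnswers_nonempty G u)]
  induction t with
  | zero => simp
  | succ t ih => rw [pow_succ, ← Matrix.mulVec_mulVec, h1, ih]

theorem sum_walkMatrix_pow (hG : ∀ v, 0 < G.degree v) (t : ℕ) (u : V) :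
    ∑ v, (walkMatrix G ^ t) u v = 1 := by
  have := congrFun (walkMatrix_pow_mulVec_one G hG t) u
  simpa [Matrix.mulVec, dotProduct] using this

theorem walkMatrix_pow_nonneg (t : ℕ) (u v : V) : 0 ≤ (walkMatrix G ^ t) u v := by
  induction t generalizing v with
  | zero => rw [pow_zero, Matrix.one_apply]; split_ifs <;> norm_num
  | succ t ih =>
    rw [pow_succ, Matrix.mul_apply]
    exact Finset.sum_nonneg fun w _ => mul_nonneg (ih w) (walkMatrix_nonneg G w v)

theorem walkMatrix_pow_add_pos {k l : ℕ} {u w v : V} (h1 : 0 < (walkMatrix G ^ k) u w)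
    (h2 : 0 < (walkMatrix G ^ l) w v) : 0 < (walkMatrix G ^ (k + l)) u v := by
  rw [pow_add, Matrix.mul_apply]
  exact Finset.sum_pos' (fun x _ => mul_nonneg (walkMatrix_pow_nonneg G _ _ _)
    (walkMatrix_pow_nonneg G _ _ _)) ⟨w, Finset.mem_univ _, mul_pos h1 h2⟩

theorem walkMatrix_pos (hG : ∀ v, 0 < G.degree v) {u v : V} (h : G.Adj u v) :
    0 < (walkMatrix G ^ 1) u v := by
  have := hG u
  simp only [pow_one, walkMatrix, Matrix.of_apply, h, if_true]
  positivity

/-- A closed walk through a triangle makes some power of the transition matrix positive. -/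
theorem exists_walkMatrix_pow_pos (hG : ∀ v, 0 < G.degree v) (hc : G.Connected) {a b c : V}
    (hab : G.Adj a b) (hbc : G.Adj b c) (hca : G.Adj c a) :
    ∃ N, ∀ u v, 0 < (walkMatrix G ^ N) u v := by
  have hreach : ∀ u v, ∃ k, 0 < (walkMatrix G ^ k) u v := by
    intro u v
    obtain ⟨p⟩ := hc.preconnected u v
    induction p with
    | nil => exact ⟨0, by simp⟩
    | cons h p ih =>
      obtain ⟨k, hk⟩ := ih
      exact ⟨1 + k, walkMatrix_pow_add_pos G (walkMatrix_pos G hG h) hk⟩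
  choose k hk using hreach
  have hloop2 : 0 < (walkMatrix G ^ 2) a a :=
    walkMatrix_pow_add_pos G (k := 1) (l := 1) (walkMatrix_pos G hG hab)
      (walkMatrix_pos G hG hab.symm)
  have hloop3 : 0 < (walkMatrix G ^ 3) a a :=
    walkMatrix_pow_add_pos G (k := 1) (l := 2) (walkMatrix_pos G hG hab)
      (walkMatrix_pow_add_pos G (k := 1) (l := 1) (walkMatrix_pos G hG hbc)
      (walkMatrix_pos G hG hca))
  have hloop : ∀ j, 0 < (walkMatrix G ^ (2 + j)) a a ∧ 0 < (walkMatrix G ^ (2 + (j + 1))) a a := by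
    intro j
    induction j with
    | zero => exact ⟨hloop2, hloop3⟩
    | succ j ih =>
      refine ⟨ih.2, ?_⟩
      rw [show 2 + (j + 1 + 1) = 2 + j + 2 by ring]
      exact walkMatrix_pow_add_pos G ih.1 hloop2
  refine ⟨(∑ u, k u a) + (2 + ∑ v, k a v), fun u v => ?_⟩
  have h1 : k u a ≤ ∑ u, k u a :=
    Finset.single_le_sum (f := fun u => k u a) (fun _ _ => Nat.zero_le _) (Finset.mem_univ u)
  have h2 : k a v ≤ ∑ v, k a v :=
    Finset.single_le_sum (f := fun v => k a v) (fun _ _ => Nat.zero_le _) (Finset.mem_univ v)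
  obtain ⟨x, hx⟩ := Nat.exists_eq_add_of_le h1
  obtain ⟨y, hy⟩ := Nat.exists_eq_add_of_le h2
  rw [hx, hy, show k u a + x + (2 + (k a v + y)) = k u a + (2 + (x + y) + k a v) by ring]
  exact walkMatrix_pow_add_pos G (hk u a) (walkMatrix_pow_add_pos G (hloop _).1 (hk a v))

theorem stationary_vecMul (hG : ∀ v, 0 < G.degree v) (t : ℕ) :
    stationary G ᵥ* walkMatrix G ^ t = stationary G := by
  have h1 : stationary G ᵥ* walkMatrix G = stationary G := by
    funext v
    simp only [Matrix.vecMul, dotProduct, stationary, walkMatrix, Matrix.of_apply]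
    have h : ∀ u, (G.degree u : ℝ) / (2 * G.edgeFinset.card) *
        (if G.Adj u v then (G.degree u : ℝ)⁻¹ else 0) =
        if G.Adj v u then (2 * (G.edgeFinset.card : ℝ))⁻¹ else 0 := by
      intro u
      have := hG u
      by_cases huv : G.Adj u v
      · rw [if_pos huv, if_pos huv.symm]; field_simp
      · rw [if_neg huv, if_neg fun h => huv h.symm, mul_zero]
    rw [Finset.sum_congr rfl fun u _ => h u, ← Finset.sum_filter, Finset.sum_const,
      ← SimpleGraph.neighborFinset_eq_filter, SimpleGraph.card_neighborFinset_eq_degree,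
      nsmul_eq_mul, div_eq_mul_inv]
  induction t with
  | zero => simp
  | succ t ih => rw [pow_succ, ← Matrix.vecMul_vecMul, ih, h1]

/-- The `ℓ₁` distance from the stationary distribution after `t` steps from `u`. -/
noncomputable def l1Dist (t : ℕ) (u : V) : ℝ := ∑ v, |(walkMatrix G ^ t) u v - stationary G v|

theorem l1Dist_le_two [Nonempty V] (hG : ∀ v, 0 < G.degree v) (t : ℕ) (u : V) :
    l1Dist G t u ≤ 2 := by
  calc l1Dist G t u ≤ ∑ v, ((walkMatrix G ^ t) u v + stationary G v) := by
        refine Finset.sum_le_sum fun v _ => ?_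
        have h1 := walkMatrix_pow_nonneg G t u v
        have h2 := stationary_nonneg G v
        rw [abs_le]; constructor <;> linarith
    _ = 2 := by
        rw [Finset.sum_add_distrib, sum_walkMatrix_pow G hG, sum_stationary G hG]; norm_num

theorem l1Dist_add_le [Nonempty V] (hG : ∀ v, 0 < G.degree v) (t s : ℕ) {p : V → ℝ} {ρ : ℝ}
    (h : ∀ u, ∑ v, |(walkMatrix G ^ s) u v - p v| ≤ ρ) (u : V) :
    l1Dist G (t + s) u ≤ ρ * l1Dist G t u := by
  have h0 : ∑ v, ((walkMatrix G ^ t) u v - stationary G v) = 0 := by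
    rw [Finset.sum_sub_distrib, sum_walkMatrix_pow G hG, sum_stationary G hG, sub_self]
  refine le_of_eq_of_le ?_ (sum_abs_vecMul_le h h0)
  refine Finset.sum_congr rfl fun v _ => ?_
  have h1 : (fun v => (walkMatrix G ^ t) u v - stationary G v) =
      (walkMatrix G ^ t) u - stationary G := rfl
  rw [h1, Matrix.sub_vecMul, stationary_vecMul G hG, pow_add, Pi.sub_apply]
  rfl

/-- If all entries of a power of the transition matrix are at least `d > 0`, the Doeblin argument
applies: subtracting `d` from each entry leaves rows of sum `1 - n d < 1`. -/
theorem exists_l1Dist_le (hG : ∀ v, 0 < G.degree v) (hc : G.Connected) {a b c : V}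
    (hab : G.Adj a b) (hbc : G.Adj b c) (hca : G.Adj c a) :
    ∃ t, ∀ u, l1Dist G t u ≤ 1 / 2 := by
  have : Nonempty V := ⟨a⟩
  obtain ⟨N, hN⟩ := exists_walkMatrix_pow_pos G hG hc hab hbc hca
  obtain ⟨x, hx⟩ := Finite.exists_min fun p : V × V => (walkMatrix G ^ N) p.1 p.2
  set d := (walkMatrix G ^ N) x.1 x.2
  have hd : 0 < d := hN _ _
  have hrow : ∀ u, ∑ v, |(walkMatrix G ^ N) u v - d| ≤ 1 - Fintype.card V * d := by
    intro u
    rw [Finset.sum_congr rfl fun v _ => abs_of_nonneg (sub_nonneg.2 (hx (u, v))),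
      Finset.sum_sub_distrib, sum_walkMatrix_pow G hG]
    simp
  set ρ := 1 - Fintype.card V * d
  have hρ0 : 0 ≤ ρ := (Finset.sum_nonneg fun _ _ => abs_nonneg _).trans (hrow a)
  have hρ1 : ρ < 1 := by
    have : 0 < (Fintype.card V : ℝ) := by exact_mod_cast Fintype.card_pos
    have := mul_pos this hd
    simp only [ρ]; linarith
  have hpow : ∀ j u, l1Dist G (N * j) u ≤ ρ ^ j * 2 := by
    intro j
    induction j with
    | zero => intro u; simpa using l1Dist_le_two G hG 0 u
    | succ j ih =>
      intro u
      rw [mul_add, mul_one, pow_succ]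
      calc l1Dist G (N * j + N) u ≤ ρ * l1Dist G (N * j) u := l1Dist_add_le G hG _ _ hrow u
        _ ≤ ρ * (ρ ^ j * 2) := mul_le_mul_of_nonneg_left (ih u) hρ0
        _ = ρ ^ j * ρ * 2 := by ring
  obtain ⟨j, hj⟩ := exists_pow_lt_of_lt_one (show (0 : ℝ) < 1 / 4 by norm_num) hρ1
  exact ⟨N * j, fun u => (hpow j u).trans (by linarith)⟩

theorem l1Dist_mixingTime_le (hG : ∀ v, 0 < G.degree v) (hc : G.Connected) {a b c : V}
    (hab : G.Adj a b) (hbc : G.Adj b c) (hca : G.Adj c a) (u : V) :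
    l1Dist G (mixingTime G) u ≤ 1 / 2 := by
  obtain ⟨t, ht⟩ := exists_l1Dist_le G hG hc hab hbc hca
  have hne : {t : ℕ | ∀ s : V, tvDist G t s ≤ 1 / 4}.Nonempty :=
    ⟨t, fun s => by have := ht s; unfold l1Dist at this; unfold tvDist; linarith⟩
  have := Nat.sInf_mem hne u
  change tvDist G (mixingTime G) u ≤ 1 / 4 at this
  unfold tvDist at this
  unfold l1Dist
  linarith

theorem degree_le_card_edgeFinset (v : V) : G.degree v ≤ G.edgeFinset.card := by
  rw [← SimpleGraph.card_incidenceFinset_eq_degree]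
  exact Finset.card_le_card (SimpleGraph.incidenceFinset_subset G v)

theorem mixingTime_pos (hG : ∀ v, 0 < G.degree v) (hc : G.Connected) {a b c : V}
    (hab : G.Adj a b) (hbc : G.Adj b c) (hca : G.Adj c a) : 0 < mixingTime G := by
  have : Nonempty V := ⟨a⟩
  by_contra h0
  have h := l1Dist_mixingTime_le G hG hc hab hbc hca a
  rw [Nat.eq_zero_of_not_pos h0] at h
  have h1 : |(walkMatrix G ^ 0) a a - stationary G a| ≤ l1Dist G 0 a :=
    Finset.single_le_sum (f := fun v => |(walkMatrix G ^ 0) a v - stationary G v|)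
      (fun _ _ => abs_nonneg _) (Finset.mem_univ a)
  have h2 : |(walkMatrix G ^ 0) a b - stationary G b| + |(walkMatrix G ^ 0) a a - stationary G a|
      ≤ l1Dist G 0 a := by
    rw [← Finset.sum_pair (f := fun v => |(walkMatrix G ^ 0) a v - stationary G v|) hab.ne']
    exact Finset.sum_le_sum_of_subset_of_nonneg (Finset.subset_univ _) fun _ _ _ => abs_nonneg _
  have h3 : stationary G a ≤ 1 / 2 := by
    have hm := card_edgeFinset_pos G hG
    have := degree_le_card_edgeFinset G a
    rw [stationary, div_le_div_iff₀ (by positivity) (by norm_num)]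
    have : (G.degree a : ℝ) ≤ G.edgeFinset.card := by exact_mod_cast this
    linarith
  have h4 : 0 < stationary G b := by
    have hm := card_edgeFinset_pos G hG
    have := hG b
    unfold stationary; positivity
  simp only [pow_zero, Matrix.one_apply_eq, Matrix.one_apply_ne hab.ne, zero_sub, abs_neg] at h2
  rw [abs_of_pos h4] at h2
  have := le_abs_self (1 - stationary G a)
  linarith

/-- A graph on which the random walk has no isolated vertex, has mixed to `ℓ₁` distance `1/2`
after `mixingTime` steps, and does not mix at time zero. -/
structure IsMixing : Prop where
  /-- there is a vertex -/
  nonempty : Nonempty V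
  /-- there is no isolated vertex -/
  degree_pos : ∀ v, 0 < G.degree v
  /-- the mixing time is positive -/
  mixingTime_pos : 0 < mixingTime G
  /-- the walk has mixed at the mixing time -/
  l1Dist_le : ∀ u, l1Dist G (mixingTime G) u ≤ 1 / 2

theorem IsMixing.of_connected (hc : G.Connected) {a b c : V}
    (hab : G.Adj a b) (hbc : G.Adj b c) (hca : G.Adj c a) : IsMixing G := by
  have : Nontrivial V := ⟨a, b, hab.ne⟩
  have hG : ∀ v, 0 < G.degree v := fun v => hc.preconnected.degree_pos_of_nontrivial v
  exact ⟨⟨a⟩, hG, Tetris.mixingTime_pos G hG hc hab hbc hca,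
    l1Dist_mixingTime_le G hG hc hab hbc hca⟩

variable {G}

/-- The distance from stationarity is halved in every period of `mixingTime` steps. -/
theorem IsMixing.l1Dist_decay (h : IsMixing G) (t : ℕ) (u : V) :
    l1Dist G t u ≤ 2 * (1 / 2) ^ (t / mixingTime G) := by
  have := h.nonempty
  have key : ∀ j s, l1Dist G (s + mixingTime G * j) u ≤ 2 * (1 / 2) ^ j := by
    intro j s
    induction j with
    | zero => simpa using l1Dist_le_two G h.degree_pos s u
    | succ j ih =>
      have := l1Dist_add_le G h.degree_pos (s + mixingTime G * j) (mixingTime G) h.l1Dist_le u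
      rw [show s + mixingTime G * (j + 1) = s + mixingTime G * j + mixingTime G by ring, pow_succ]
      linarith
  have := key (t / mixingTime G) (t % mixingTime G)
  rwa [Nat.mod_add_div] at this

theorem IsMixing.abs_mulVec_sub_le (h : IsMixing G) (t : ℕ) (u : V) {f : V → ℝ} {M : ℝ}
    (hf : ∀ v, |f v| ≤ M) :
    |(walkMatrix G ^ t *ᵥ f) u - ∑ v, stationary G v * f v| ≤
      2 * (1 / 2) ^ (t / mixingTime G) * M := by
  have hM : 0 ≤ M := (abs_nonneg _).trans (hf u)
  have h1 : (walkMatrix G ^ t *ᵥ f) u - ∑ v, stationary G v * f v =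
      ∑ v, ((walkMatrix G ^ t) u v - stationary G v) * f v := by
    simp only [Matrix.mulVec, dotProduct, sub_mul, Finset.sum_sub_distrib]
  rw [h1]
  calc |∑ v, ((walkMatrix G ^ t) u v - stationary G v) * f v|
      ≤ ∑ v, |(walkMatrix G ^ t) u v - stationary G v| * M := by
        refine (Finset.abs_sum_le_sum_abs _ _).trans (Finset.sum_le_sum fun v _ => ?_)
        rw [abs_mul]
        exact mul_le_mul_of_nonneg_left (hf v) (abs_nonneg _)
    _ = l1Dist G t u * M := by rw [← Finset.sum_mul]; rfl
    _ ≤ _ := mul_le_mul_of_nonneg_right (h.l1Dist_decay t u) hM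

theorem sum_half_pow_div_le {τ : ℕ} (hτ : 0 < τ) (r : ℕ) :
    ∑ j ∈ Finset.range r, (1 / 2 : ℝ) ^ (j / τ) ≤ 2 * τ := by
  have key : ∀ k, ∑ j ∈ Finset.range (τ * k), (1 / 2 : ℝ) ^ (j / τ) =
      2 * τ - 2 * τ * (1 / 2) ^ k := by
    intro k
    induction k with
    | zero => simp
    | succ k ih =>
      rw [mul_add, mul_one, Finset.sum_range_add, ih]
      have : ∀ x ∈ Finset.range τ, (1 / 2 : ℝ) ^ ((τ * k + x) / τ) = (1 / 2) ^ k := by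
        intro x hx
        rw [Nat.mul_add_div hτ, Nat.div_eq_of_lt (Finset.mem_range.1 hx), add_zero]
      rw [Finset.sum_congr rfl this, Finset.sum_const, Finset.card_range, nsmul_eq_mul, pow_succ]
      ring
  calc ∑ j ∈ Finset.range r, (1 / 2 : ℝ) ^ (j / τ)
      ≤ ∑ j ∈ Finset.range (τ * r), (1 / 2 : ℝ) ^ (j / τ) :=
        Finset.sum_le_sum_of_subset_of_nonneg
          (Finset.range_subset_range.2 (Nat.le_mul_of_pos_left r hτ)) fun _ _ _ => by positivity
    _ ≤ 2 * τ := by rw [key]; have : (0 : ℝ) ≤ 2 * τ * (1 / 2) ^ r := by positivity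
                    linarith

/-- The total deviation of the expected values of `f` along the walk from the stationary mean. -/
theorem IsMixing.abs_sum_mulVec_sub_le (h : IsMixing G) (r : ℕ) (u : V) {f : V → ℝ} {M : ℝ}
    (hf : ∀ v, |f v| ≤ M) :
    |∑ j ∈ Finset.range r, (walkMatrix G ^ j *ᵥ f) u - r * ∑ v, stationary G v * f v| ≤
      4 * mixingTime G * M := by
  have hM : 0 ≤ M := (abs_nonneg _).trans (hf u)
  have h1 : ∑ j ∈ Finset.range r, (walkMatrix G ^ j *ᵥ f) u - r * ∑ v, stationary G v * f v =
      ∑ j ∈ Finset.range r, ((walkMatrix G ^ j *ᵥ f) u - ∑ v, stationary G v * f v) := by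
    rw [Finset.sum_sub_distrib]; simp
  rw [h1]
  calc _ ≤ ∑ j ∈ Finset.range r, 2 * (1 / 2) ^ (j / mixingTime G) * M :=
        (Finset.abs_sum_le_sum_abs _ _).trans
          (Finset.sum_le_sum fun j _ => h.abs_mulVec_sub_le j u hf)
    _ = 2 * M * ∑ j ∈ Finset.range r, (1 / 2 : ℝ) ^ (j / mixingTime G) := by
        rw [Finset.mul_sum]; exact Finset.sum_congr rfl fun _ _ => by ring
    _ ≤ 2 * M * (2 * mixingTime G) :=
        mul_le_mul_of_nonneg_left (sum_half_pow_div_le h.mixingTime_pos r) (by positivity)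
    _ = _ := by ring

end Mixing

/-! ### Degrees, degeneracy and triangles -/

section Counting

variable {V : Type} [Fintype V] (G : SimpleGraph V) [DecidableRel G.Adj]

/-- The stationary mean of a function of the next edge of the walk. -/
theorem sum_stationary_mul_expect (hG : ∀ v, 0 < G.degree v) (φ : V → V → ℝ) :
    ∑ u, stationary G u * 𝔼 v ∈ nbrAnswers G u, φ u v =
      (∑ u, ∑ v ∈ G.neighborFinset u, φ u v) / (2 * G.edgeFinset.card) := by
  rw [Finset.sum_div]
  refine Finset.sum_congr rfl fun u _ => ?_
  have := hG u
  rw [nbrAnswers_of_pos G (hG u), expect_eq_sum_div_card,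
    SimpleGraph.card_neighborFinset_eq_degree, stationary]
  field_simp

theorem exists_degree_le_degeneracy (S : Finset V) (hS : S.Nonempty) :
    ∃ v ∈ S, (S.filter fun w => G.Adj v w).card ≤ degeneracy G := by
  have hne : {k : ℕ | ∀ H : G.Subgraph, H.verts.Nonempty →
      ∃ v ∈ H.verts, (H.neighborSet v).ncard ≤ k}.Nonempty := by
    refine ⟨Fintype.card V, fun H ⟨v, hv⟩ => ⟨v, hv, ?_⟩⟩
    rw [← Nat.card_eq_fintype_card, ← Set.ncard_univ]
    exact Set.ncard_le_ncard (Set.subset_univ _)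
  obtain ⟨v, hv, hk⟩ := Nat.sInf_mem hne ((⊤ : G.Subgraph).induce S) (by simpa using hS)
  have hv' : v ∈ S := by simpa using hv
  refine ⟨v, hv', le_trans (le_of_eq ?_) hk⟩
  rw [← Set.ncard_coe_finset]
  congr 1
  ext w
  simp [hv']

/-- From every vertex, the expected smaller endpoint degree of the next edge is at most `√(2m)`. -/
theorem expect_min_degree_le (hG : ∀ v, 0 < G.degree v) (u : V) :
    𝔼 v ∈ nbrAnswers G u, (min (G.degree u) (G.degree v) : ℝ) ≤ √(2 * G.edgeFinset.card) := by
  have hd := hG u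
  have hd' : (0 : ℝ) < G.degree u := by exact_mod_cast hd
  set x := 𝔼 v ∈ nbrAnswers G u, (min (G.degree u) (G.degree v) : ℝ) with hx
  have hx0 : 0 ≤ x := expect_nonneg fun v _ => by positivity
  have h1 : x ≤ G.degree u := expect_le (nbrAnswers_nonempty G u) fun v _ => min_le_left _ _
  have h2 : G.degree u * x ≤ 2 * G.edgeFinset.card := by
    rw [hx, nbrAnswers_of_pos G hd, expect_eq_sum_div_card,
      SimpleGraph.card_neighborFinset_eq_degree, mul_div_cancel₀ _ hd'.ne']
    calc ∑ v ∈ G.neighborFinset u, (min (G.degree u) (G.degree v) : ℝ)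
        ≤ ∑ v ∈ G.neighborFinset u, (G.degree v : ℝ) :=
          Finset.sum_le_sum fun v _ => min_le_right _ _
      _ ≤ ∑ v, (G.degree v : ℝ) :=
          Finset.sum_le_sum_of_subset_of_nonneg (Finset.subset_univ _) fun _ _ _ => by positivity
      _ = 2 * G.edgeFinset.card := by
          rw [← Nat.cast_sum, G.sum_degrees_eq_twice_card_edges]; push_cast; ring
  refine Real.le_sqrt_of_sq_le ?_
  nlinarith

theorem card_edgeFinset_le_sq : G.edgeFinset.card ≤ Fintype.card V ^ 2 := by
  have h1 := G.sum_degrees_eq_twice_card_edges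
  have h2 : ∑ v, G.degree v ≤ ∑ _v : V, Fintype.card V :=
    Finset.sum_le_sum fun v _ => (G.degree_lt_card_verts v).le
  rw [Finset.sum_const, Finset.card_univ, smul_eq_mul] at h2
  nlinarith

variable [LinearOrder V]

theorem sum_sum_neighborFinset (φ : Sym2 V → ℝ) :
    ∑ u, ∑ v ∈ G.neighborFinset u, φ s(u, v) = 2 * ∑ e ∈ G.edgeFinset, φ e := by
  have h1 : ∑ u, ∑ v ∈ G.neighborFinset u, φ s(u, v) =
      ∑ p ∈ (Finset.univ : Finset (V × V)).filter (fun p => G.Adj p.1 p.2), φ s(p.1, p.2) := by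
    rw [Finset.sum_filter, Fintype.sum_prod_type]
    refine Finset.sum_congr rfl fun u _ => ?_
    rw [SimpleGraph.neighborFinset_eq_filter, Finset.sum_filter]
  rw [h1, Finset.mul_sum, ← Finset.sum_fiberwise_of_maps_to (t := G.edgeFinset)
    (g := fun p : V × V => s(p.1, p.2)) (fun p hp => by simpa using hp)]
  refine Finset.sum_congr rfl fun e he => ?_
  induction e using Sym2.ind with
  | h a b =>
    have hab : G.Adj a b := by simpa using he
    have : ((Finset.univ : Finset (V × V)).filter (fun p => G.Adj p.1 p.2)).filter
        (fun p => s(p.1, p.2) = s(a, b)) = {(a, b), (b, a)} := by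
      ext ⟨x, y⟩
      simp only [Finset.mem_filter, Finset.mem_univ, true_and, Sym2.eq_iff, Finset.mem_insert,
        Finset.mem_singleton, Prod.mk.injEq]
      constructor
      · exact fun h => h.2
      · rintro (⟨rfl, rfl⟩ | ⟨rfl, rfl⟩)
        · exact ⟨hab, Or.inl ⟨rfl, rfl⟩⟩
        · exact ⟨hab.symm, Or.inr ⟨rfl, rfl⟩⟩
    rw [this, Finset.sum_pair (by simp [hab.ne]), Sym2.eq_swap (a := b)]
    ring

theorem degPrec_iff (u v : V) :
    DegPrec G u v ↔ toLex (G.degree u, u) < toLex (G.degree v, v) := by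
  rw [Prod.Lex.toLex_lt_toLex, DegPrec]

/-- Every triangle is assigned to exactly one edge, which has two orientations. -/
theorem sum_assignedTriangles :
    ∑ u, ∑ v ∈ G.neighborFinset u, assignedTriangles G u v = 2 * triangleCount G := by
  set S : Finset (V × V × V) := Finset.univ.filter fun p => G.Adj p.1 p.2.1 ∧ G.Adj p.1 p.2.2 ∧
    G.Adj p.2.1 p.2.2 ∧ DegPrec G p.1 p.2.2 ∧ DegPrec G p.2.1 p.2.2 with hS
  have h1 : ∑ u, ∑ v ∈ G.neighborFinset u, assignedTriangles G u v = S.card := by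
    rw [hS, Finset.card_filter, Fintype.sum_prod_type]
    refine Finset.sum_congr rfl fun u _ => ?_
    rw [SimpleGraph.neighborFinset_eq_filter, Finset.sum_filter, Fintype.sum_prod_type]
    refine Finset.sum_congr rfl fun v _ => ?_
    split_ifs with huv
    · rw [assignedTriangles, Finset.card_filter]
      simp [huv]
    · simp [huv]
  rw [h1, triangleCount, mul_comm]
  have hmaps : ∀ p ∈ S, ({p.1, p.2.1, p.2.2} : Finset V) ∈ G.cliqueFinset 3 := by
    rintro ⟨x, y, z⟩ hp
    simp only [hS, Finset.mem_filter, Finset.mem_univ, true_and] at hp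
    rw [SimpleGraph.mem_cliqueFinset_iff, SimpleGraph.is3Clique_triple_iff]
    exact ⟨hp.1, hp.2.1, hp.2.2.1⟩
  rw [Finset.card_eq_sum_card_fiberwise (f := fun p : V × V × V => ({p.1, p.2.1, p.2.2} : Finset V))
    (t := G.cliqueFinset 3) hmaps, ← smul_eq_mul]
  refine Finset.sum_eq_card_nsmul fun s hs => ?_
  rw [SimpleGraph.mem_cliqueFinset_iff] at hs
  have hsne : s.Nonempty := Finset.card_pos.1 (by rw [hs.card_eq]; norm_num)
  obtain ⟨w, hw, hmax⟩ := Finset.exists_max_image s (fun v => toLex (G.degree v, v)) hsne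
  obtain ⟨a, b, hab, he⟩ := Finset.card_eq_two.1
    (show (s.erase w).card = 2 by rw [Finset.card_erase_of_mem hw, hs.card_eq])
  have hse : s = {a, b, w} := by
    rw [← Finset.insert_erase hw, he]; ext x; simp; tauto
  have hmem : ∀ x, x ∈ s ↔ x = a ∨ x = b ∨ x = w := fun x => by rw [hse]; simp
  have ha : a ∈ s.erase w := by rw [he]; simp
  have hb : b ∈ s.erase w := by rw [he]; simp
  rw [Finset.mem_erase] at ha hb
  have hlt : ∀ x ∈ s, x ≠ w → DegPrec G x w := by
    intro x hx hxw
    rw [degPrec_iff]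
    refine lt_of_le_of_ne (hmax x hx) fun h => hxw ?_
    exact (Prod.ext_iff.1 (toLex_inj.1 h)).2
  have hadj : ∀ x ∈ s, ∀ y ∈ s, x ≠ y → G.Adj x y := fun x hx y hy hxy => hs.isClique hx hy hxy
  have hfib : S.filter (fun p => ({p.1, p.2.1, p.2.2} : Finset V) = s) =
      {(a, b, w), (b, a, w)} := by
    ext ⟨x, y, z⟩
    simp only [hS, Finset.mem_filter, Finset.mem_univ, true_and, Finset.mem_insert,
      Finset.mem_singleton, Prod.mk.injEq]
    constructor
    · rintro ⟨⟨hxy, hxz, hyz, h1, h2⟩, hs'⟩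
      have hx : x ∈ s := by rw [← hs']; simp
      have hy : y ∈ s := by rw [← hs']; simp
      have hz : z ∈ s := by rw [← hs']; simp
      have hxw : x ≠ w := by
        rintro rfl
        exact absurd ((degPrec_iff G _ _).1 h1) (not_lt.2 (hmax z hz))
      have hyw : y ≠ w := by
        rintro rfl
        exact absurd ((degPrec_iff G _ _).1 h2) (not_lt.2 (hmax z hz))
      have hzw : z = w := by
        have : w ∈ ({x, y, z} : Finset V) := by rw [hs']; exact hw
        simp only [Finset.mem_insert, Finset.mem_singleton] at this
        rcases this with h | h | h
        · exact absurd h.symm hxw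
        · exact absurd h.symm hyw
        · exact h.symm
      have hne := hxy.ne
      rcases (hmem x).1 hx with rfl | rfl | h
      · rcases (hmem y).1 hy with rfl | rfl | h
        · exact absurd rfl hne
        · exact Or.inl ⟨rfl, rfl, hzw⟩
        · exact absurd h hyw
      · rcases (hmem y).1 hy with rfl | rfl | h
        · exact Or.inr ⟨rfl, rfl, hzw⟩
        · exact absurd rfl hne
        · exact absurd h hyw
      · exact absurd h hxw
    · rintro (⟨rfl, rfl, rfl⟩ | ⟨rfl, rfl, rfl⟩)
      · exact ⟨⟨hadj _ ha.2 _ hb.2 hab, hadj _ ha.2 _ hw ha.1, hadj _ hb.2 _ hw hb.1,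
          hlt _ ha.2 ha.1, hlt _ hb.2 hb.1⟩, hse.symm⟩
      · refine ⟨⟨hadj _ hb.2 _ ha.2 hab.symm, hadj _ hb.2 _ hw hb.1, hadj _ ha.2 _ hw ha.1,
          hlt _ hb.2 hb.1, hlt _ ha.2 ha.1⟩, ?_⟩
        rw [hse, Finset.insert_comm]
  rw [hfib, Finset.card_pair (by simp [hab])]

theorem assignedTriangles_le_maxAssigned {u v : V} (h : G.Adj u v) :
    assignedTriangles G u v ≤ maxAssigned G :=
  Finset.le_sup (f := fun p : V × V => assignedTriangles G p.1 p.2) (b := (u, v)) (by simpa using h)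

theorem maxAssigned_le_card : maxAssigned G ≤ Fintype.card V :=
  Finset.sup_le fun _ _ => Finset.card_le_univ _

/-- `T ≤ m t_max`. -/
theorem triangleCount_le : triangleCount G ≤ G.edgeFinset.card * maxAssigned G := by
  have h1 := sum_assignedTriangles G
  have h2 : ∑ u, ∑ v ∈ G.neighborFinset u, assignedTriangles G u v ≤
      ∑ u, G.degree u * maxAssigned G := by
    refine Finset.sum_le_sum fun u _ => ?_
    rw [← SimpleGraph.card_neighborFinset_eq_degree, ← smul_eq_mul]
    refine Finset.sum_le_card_nsmul _ _ _ fun v hv => ?_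
    exact assignedTriangles_le_maxAssigned G (by simpa using hv)
  rw [← Finset.sum_mul, G.sum_degrees_eq_twice_card_edges] at h2
  nlinarith

/-- Removing a vertex of least degree again and again charges every vertex `degeneracy` times. -/
theorem sum_min_degree_le_aux (S : Finset V) :
    ∑ u ∈ S, ∑ v ∈ S.filter (fun v => G.Adj u v), min (G.degree u) (G.degree v) ≤
      2 * degeneracy G * ∑ u ∈ S, G.degree u := by
  induction S using Finset.strongInduction with
  | H S ih =>
    rcases S.eq_empty_or_nonempty with rfl | hS
    · simp
    obtain ⟨x, hx, hdeg⟩ := exists_degree_le_degeneracy G S hS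
    have ih' := ih (S.erase x) (Finset.erase_ssubset hx)
    set f : V → V → ℕ := fun u v => if G.Adj u v then min (G.degree u) (G.degree v) else 0 with hf
    have hconv : ∀ T : Finset V, ∑ u ∈ T, ∑ v ∈ T.filter (fun v => G.Adj u v),
        min (G.degree u) (G.degree v) = ∑ u ∈ T, ∑ v ∈ T, f u v := by
      intro T
      refine Finset.sum_congr rfl fun u _ => ?_
      rw [Finset.sum_filter]
    have hsymm : ∀ u v, f u v = f v u := by
      intro u v; simp only [hf, G.adj_comm u v, min_comm]
    have hself : f x x = 0 := by simp [hf]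
    have hrow : ∑ v ∈ S.erase x, f x v ≤ degeneracy G * G.degree x := by
      calc ∑ v ∈ S.erase x, f x v ≤ ∑ v ∈ S, f x v :=
            Finset.sum_le_sum_of_subset (Finset.erase_subset _ _)
        _ = ∑ v ∈ S.filter (fun v => G.Adj x v), min (G.degree x) (G.degree v) := by
            rw [Finset.sum_filter]
        _ ≤ (S.filter fun w => G.Adj x w).card • G.degree x :=
            Finset.sum_le_card_nsmul _ _ _ fun v _ => min_le_left _ _
        _ ≤ _ := by rw [smul_eq_mul]; exact Nat.mul_le_mul_right _ hdeg
    have hsplit : ∑ u ∈ S, ∑ v ∈ S, f u v =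
        ∑ u ∈ S.erase x, ∑ v ∈ S.erase x, f u v + 2 * ∑ v ∈ S.erase x, f x v := by
      have h2 : ∀ u, ∑ v ∈ S, f u v = ∑ v ∈ S.erase x, f u v + f u x := fun u =>
        (Finset.sum_erase_add S (f u) hx).symm
      rw [← Finset.sum_erase_add S _ hx, h2 x, hself]
      simp only [h2]
      rw [Finset.sum_add_distrib, Finset.sum_congr rfl fun u _ => hsymm u x]
      ring
    rw [hconv] at ih' ⊢
    rw [hsplit, ← Finset.sum_erase_add S _ hx]
    nlinarith

/-- The bound of Chiba and Nishizeki, with each edge counted in both directions. -/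
theorem sum_min_degree_le :
    ∑ u, ∑ v ∈ G.neighborFinset u, min (G.degree u) (G.degree v) ≤
      4 * G.edgeFinset.card * degeneracy G := by
  have h := sum_min_degree_le_aux G Finset.univ
  rw [G.sum_degrees_eq_twice_card_edges] at h
  simp only [SimpleGraph.neighborFinset_eq_filter]
  linarith

theorem degeneracy_pos [Nonempty V] (hG : ∀ v, 0 < G.degree v) : 0 < degeneracy G := by
  by_contra h0
  have h := sum_min_degree_le G
  rw [Nat.eq_zero_of_not_pos h0, mul_zero, Nat.le_zero, Finset.sum_eq_zero_iff] at h
  obtain ⟨u⟩ := ‹Nonempty V›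
  have h1 := h u (Finset.mem_univ u)
  rw [Finset.sum_eq_zero_iff] at h1
  obtain ⟨v, hv⟩ := Finset.card_pos.1 ((SimpleGraph.card_neighborFinset_eq_degree G u).symm ▸ hG u)
  have := h1 v hv
  have h2 := hG u
  have h3 := hG v
  omega

theorem exists_triangle (hT : 0 < triangleCount G) :
    ∃ a b c, G.Adj a b ∧ G.Adj b c ∧ G.Adj c a := by
  obtain ⟨s, hs⟩ := Finset.card_pos.1 hT
  rw [SimpleGraph.mem_cliqueFinset_iff, SimpleGraph.is3Clique_iff] at hs
  obtain ⟨a, b, c, hab, hac, hbc, -⟩ := hs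
  exact ⟨a, b, c, hab, hbc, hac.symm⟩

end Counting

/-! ### Collisions among independent uniform samples -/

section Independent

variable {β : Type} (E : Finset β)

/-- The expected value of `f` at a list of `q` independent uniform elements of `E`. -/
noncomputable def iidMean : ℕ → (List β → ℝ) → ℝ
  | 0, f => f []
  | q + 1, f => 𝔼 e ∈ E, iidMean q fun L => f (e :: L)

theorem iidMean_add (q : ℕ) (f g : List β → ℝ) :
    iidMean E q (fun L => f L + g L) = iidMean E q f + iidMean E q g := by
  induction q generalizing f g with
  | zero => rfl
  | succ q ih => simp only [iidMean, ih, expect_add_distrib]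

theorem iidMean_const_mul (q : ℕ) (c : ℝ) (f : List β → ℝ) :
    iidMean E q (fun L => c * f L) = c * iidMean E q f := by
  induction q generalizing f with
  | zero => rfl
  | succ q ih => simp only [iidMean, ih, mul_expect]

theorem iidMean_const (hE : E.Nonempty) (q : ℕ) (c : ℝ) : iidMean E q (fun _ => c) = c := by
  induction q with
  | zero => rfl
  | succ q ih => simp only [iidMean, ih]; exact expect_const hE c

theorem iidMean_mono (q : ℕ) {f g : List β → ℝ} (h : ∀ L, f L ≤ g L) :
    iidMean E q f ≤ iidMean E q g := by
  induction q generalizing f g with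
  | zero => exact h []
  | succ q ih => exact expect_le_expect fun e _ => ih fun L => h _

theorem iidMean_nonneg (hE : E.Nonempty) (q : ℕ) {f : List β → ℝ} (h : ∀ L, 0 ≤ f L) :
    0 ≤ iidMean E q f :=
  (iidMean_const E hE q 0).ge.trans (iidMean_mono E q h)

theorem abs_iidMean_le (hE : E.Nonempty) (q : ℕ) {f : List β → ℝ} {M : ℝ} (h : ∀ L, |f L| ≤ M) :
    |iidMean E q f| ≤ M := by
  rw [abs_le]
  constructor
  · rw [← iidMean_const E hE q (-M)]; exact iidMean_mono E q fun L => (abs_le.1 (h L)).1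
  · rw [← iidMean_const E hE q M]; exact iidMean_mono E q fun L => (abs_le.1 (h L)).2

theorem iidMean_append (a b : ℕ) (f : List β → ℝ) :
    iidMean E (a + b) f = iidMean E a fun A => iidMean E b fun B => f (A ++ B) := by
  induction a generalizing f with
  | zero => simp [iidMean]
  | succ a ih => rw [Nat.succ_add]; simp only [iidMean, ih, List.cons_append]

variable [DecidableEq β]

theorem equalPairs_append (A B : List β) : equalPairs A + equalPairs B ≤ equalPairs (A ++ B) := by
  induction A with
  | nil => simp [equalPairs]
  | cons x A ih =>
    simp only [equalPairs, List.cons_append, List.count_append]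
    omega

variable {E}

theorem expect_indicator_sub {x : β} (hx : x ∈ E) :
    𝔼 e ∈ E, ((if e = x then (1 : ℝ) else 0) - 1 / E.card) = 0 := by
  rw [expect_sub_distrib, expect_const ⟨x, hx⟩, expect_eq_sum_div_card, Finset.sum_ite_eq' E x,
    if_pos hx, sub_self]

theorem cast_count_cons (x e : β) (L : List β) :
    ((e :: L).count x : ℝ) = L.count x + if e = x then 1 else 0 := by
  rw [List.count_cons]
  by_cases h : e = x <;> simp [h]

/-- The number of occurrences of `x` has mean `q / |E|`. -/
theorem iidMean_count (q : ℕ) {x : β} (hx : x ∈ E) :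
    iidMean E q (fun L => (L.count x : ℝ) - q / E.card) = 0 := by
  induction q with
  | zero => simp [iidMean]
  | succ q ih =>
    have h : ∀ e : β, ∀ L : List β, ((e :: L).count x : ℝ) - (q + 1 : ℕ) / E.card =
        ((L.count x : ℝ) - q / E.card) + ((if e = x then 1 else 0) - 1 / E.card) := by
      intro e L; rw [cast_count_cons]; push_cast; ring
    simp only [iidMean, h, iidMean_add, ih, iidMean_const E ⟨x, hx⟩, zero_add]
    exact expect_indicator_sub hx

/-- The covariance of the numbers of occurrences of two elements. -/
theorem iidMean_count_mul_count (q : ℕ) {x y : β} (hx : x ∈ E) (hy : y ∈ E) :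
    iidMean E q (fun L => ((L.count x : ℝ) - q / E.card) * ((L.count y : ℝ) - q / E.card)) =
      q * ((if x = y then 1 else 0) / E.card - 1 / E.card ^ 2) := by
  induction q with
  | zero => simp [iidMean]
  | succ q ih =>
    have h : ∀ e : β, ∀ L : List β, (((e :: L).count x : ℝ) - (q + 1 : ℕ) / E.card) *
        (((e :: L).count y : ℝ) - (q + 1 : ℕ) / E.card) =
        ((L.count x : ℝ) - q / E.card) * ((L.count y : ℝ) - q / E.card) +
        (((if e = x then 1 else 0) - 1 / E.card) * ((L.count y : ℝ) - q / E.card) +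
        (((if e = y then 1 else 0) - 1 / E.card) * ((L.count x : ℝ) - q / E.card) +
        ((if e = x then 1 else 0) - 1 / E.card) * ((if e = y then 1 else 0) - 1 / E.card))) := by
      intro e L; rw [cast_count_cons, cast_count_cons]; push_cast; ring
    have hcov : 𝔼 e ∈ E, ((if e = x then (1 : ℝ) else 0) - 1 / E.card) *
        ((if e = y then 1 else 0) - 1 / E.card) =
        (if x = y then 1 else 0) / E.card - 1 / E.card ^ 2 := by
      have h2 : ∀ e, ((if e = x then (1 : ℝ) else 0) - 1 / E.card) *
          ((if e = y then 1 else 0) - 1 / E.card) =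
          (if e = x then (if x = y then 1 else 0) else 0) -
          1 / E.card * ((if e = x then 1 else 0) - 1 / E.card) -
          1 / E.card * (if e = y then 1 else 0) := by
        intro e
        by_cases he : e = x
        · subst he; split_ifs <;> ring
        · simp only [he, if_false]; ring
      rw [expect_congr rfl fun e _ => h2 e, expect_sub_distrib, expect_sub_distrib, ← mul_expect,
        expect_indicator_sub hx, expect_eq_sum_div_card, Finset.sum_ite_eq' E x, if_pos hx,
        expect_eq_sum_div_card, ← Finset.mul_sum,
        Finset.sum_ite_eq' E y, if_pos hy]
      ring
    simp only [iidMean, h, iidMean_add, iidMean_const_mul, ih, iidMean_const E ⟨x, hx⟩,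
      iidMean_count q hx, iidMean_count q hy, mul_zero, zero_add]
    rw [expect_add_distrib, hcov, expect_const ⟨x, hx⟩]
    push_cast; ring

/-- The number of equal pairs minus its expected value. -/
noncomputable def pairExcess (E : Finset β) (q : ℕ) (L : List β) : ℝ :=
  equalPairs L - (q.choose 2 : ℝ) / E.card

theorem pairExcess_cons (q : ℕ) (e : β) (L : List β) :
    pairExcess E (q + 1) (e :: L) = ((L.count e : ℝ) - q / E.card) + pairExcess E q L := by
  simp only [pairExcess, equalPairs]
  rw [Nat.choose_succ_succ' q 1, Nat.choose_one_right]
  push_cast; ring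

theorem iidMean_pairExcess (q : ℕ) : iidMean E q (pairExcess E q) = 0 := by
  induction q with
  | zero => simp [iidMean, pairExcess, equalPairs]
  | succ q ih =>
    simp only [iidMean, pairExcess_cons, iidMean_add]
    refine expect_eq_zero fun e he => ?_
    rw [iidMean_count q he, zero_add]
    exact ih

/-- The number of occurrences of a fixed element and the number of equal pairs are uncorrelated,
because given one of two positions, the other one hits any element equally likely. -/
theorem iidMean_count_mul_pairExcess (q : ℕ) {x : β} (hx : x ∈ E) :
    iidMean E q (fun L => ((L.count x : ℝ) - q / E.card) * pairExcess E q L) = 0 := by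
  have hm : (E.card : ℝ) ≠ 0 := by exact_mod_cast (Finset.card_pos.2 ⟨x, hx⟩).ne'
  induction q with
  | zero => simp [iidMean, pairExcess, equalPairs]
  | succ q ih =>
    have h : ∀ e : β, ∀ L : List β, (((e :: L).count x : ℝ) - (q + 1 : ℕ) / E.card) *
        pairExcess E (q + 1) (e :: L) =
        ((L.count x : ℝ) - q / E.card) * pairExcess E q L +
        (((L.count x : ℝ) - q / E.card) * ((L.count e : ℝ) - q / E.card) +
        (((if e = x then 1 else 0) - 1 / E.card) * ((L.count e : ℝ) - q / E.card) +
        ((if e = x then 1 else 0) - 1 / E.card) * pairExcess E q L)) := by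
      intro e L; rw [cast_count_cons, pairExcess_cons]; push_cast; ring
    have h2 : ∀ e ∈ E, iidMean E q (fun L => ((e :: L).count x - (q + 1 : ℕ) / E.card) *
        pairExcess E (q + 1) (e :: L)) =
        q * ((if x = e then 1 else 0) / E.card - 1 / E.card ^ 2) := by
      intro e he
      simp only [h, iidMean_add, iidMean_const_mul, ih, iidMean_count q he,
        iidMean_count_mul_count q hx he, mul_zero, zero_add]
      rw [show iidMean E q (fun L => pairExcess E q L) = 0 from iidMean_pairExcess q]
      ring
    rw [iidMean, expect_congr rfl h2, ← mul_expect, expect_sub_distrib, expect_const ⟨x, hx⟩,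
      ← expect_div, expect_eq_sum_div_card, Finset.sum_ite_eq E x, if_pos hx]
    field_simp
    ring

theorem iidMean_pairExcess_cons_sq (q : ℕ) {x : β} (hx : x ∈ E) :
    iidMean E q (fun L => pairExcess E (q + 1) (x :: L) ^ 2) =
      q * (1 / E.card - 1 / E.card ^ 2) + iidMean E q (fun L => pairExcess E q L ^ 2) := by
  have h : ∀ L : List β, pairExcess E (q + 1) (x :: L) ^ 2 =
      ((L.count x : ℝ) - q / E.card) * ((L.count x : ℝ) - q / E.card) +
      (2 * (((L.count x : ℝ) - q / E.card) * pairExcess E q L) + pairExcess E q L ^ 2) := by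
    intro L; rw [pairExcess_cons]; ring
  simp only [h, iidMean_add, iidMean_const_mul, iidMean_count_mul_count q hx hx,
    iidMean_count_mul_pairExcess q hx, if_true, mul_zero, zero_add]

/-- Distinct pairs of positions are uncorrelated, so the variance is at most the mean. -/
theorem iidMean_pairExcess_sq_le (hE : E.Nonempty) (q : ℕ) :
    iidMean E q (fun L => pairExcess E q L ^ 2) ≤ (q.choose 2 : ℝ) / E.card := by
  induction q with
  | zero => simp [iidMean, pairExcess, equalPairs]
  | succ q ih =>
    rw [iidMean, expect_congr rfl fun e he => iidMean_pairExcess_cons_sq q he, expect_const hE,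
      Nat.choose_succ_succ' q 1, Nat.choose_one_right]
    push_cast
    have : (0 : ℝ) ≤ q * (1 / E.card ^ 2) := by positivity
    rw [add_div]
    have e1 : (q : ℝ) * (1 / E.card - 1 / E.card ^ 2) = q / E.card - q * (1 / E.card ^ 2) := by ring
    linarith

/-- The variance bound remains true when the first element is prescribed. -/
theorem iidMean_pairExcess_cons_sq_le (q : ℕ) {x : β} (hx : x ∈ E) :
    iidMean E q (fun L => pairExcess E (q + 1) (x :: L) ^ 2) ≤ ((q + 1).choose 2 : ℝ) / E.card := by
  rw [iidMean_pairExcess_cons_sq q hx, Nat.choose_succ_succ' q 1, Nat.choose_one_right]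
  have := iidMean_pairExcess_sq_le ⟨x, hx⟩ q (E := E)
  have h0 : (0 : ℝ) ≤ q * (1 / E.card ^ 2) := by positivity
  push_cast
  rw [add_div]
  have e1 : (q : ℝ) * (1 / E.card - 1 / E.card ^ 2) = q / E.card - q * (1 / E.card ^ 2) := by ring
  linarith

/-- Chebyshev's inequality for the lower tail of the number of equal pairs. -/
theorem iidMean_equalPairs_lt_le (hE : E.Nonempty) (h : ℕ) {μ : ℝ}
    (hμ : μ = (h.choose 2 : ℝ) / E.card) (hpos : 0 < μ) :
    iidMean E h (fun L => if (equalPairs L : ℝ) < μ / 2 then 1 else 0) ≤ 4 / μ := by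
  calc _ ≤ iidMean E h (fun L => 4 / μ ^ 2 * pairExcess E h L ^ 2) := by
        refine iidMean_mono E h fun L => ?_
        split_ifs with hL
        · rw [pairExcess, ← hμ, div_mul_eq_mul_div, le_div_iff₀ (by positivity)]
          nlinarith
        · positivity
    _ ≤ 4 / μ ^ 2 * μ := by
        rw [iidMean_const_mul]
        exact mul_le_mul_of_nonneg_left ((iidMean_pairExcess_sq_le hE h).trans hμ.ge)
          (by positivity)
    _ = 4 / μ := by field_simp

/-- Two independent halves must both have few equal pairs, which squares the tail bound. -/
theorem iidMean_equalPairs_lt_le_sq (hE : E.Nonempty) (h : ℕ) {μ : ℝ}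
    (hμ : μ = (h.choose 2 : ℝ) / E.card) (hpos : 0 < μ) :
    iidMean E (h + h) (fun L => if (equalPairs L : ℝ) < μ / 2 then 1 else 0) ≤ (4 / μ) ^ 2 := by
  have h1 := iidMean_equalPairs_lt_le hE h hμ hpos
  have h0 : 0 ≤ iidMean E h (fun L => if (equalPairs L : ℝ) < μ / 2 then 1 else 0) := by
    exact iidMean_nonneg E hE h fun L => by split_ifs <;> norm_num
  rw [iidMean_append]
  calc _ ≤ iidMean E h (fun A => iidMean E h fun B =>
        (if (equalPairs A : ℝ) < μ / 2 then 1 else 0) *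
          (if (equalPairs B : ℝ) < μ / 2 then 1 else 0)) := by
        refine iidMean_mono E h fun A => iidMean_mono E h fun B => ?_
        have h2 : (equalPairs A : ℝ) + equalPairs B ≤ equalPairs (A ++ B) := by
          exact_mod_cast equalPairs_append A B
        have hA : (0 : ℝ) ≤ equalPairs A := by positivity
        have hB : (0 : ℝ) ≤ equalPairs B := by positivity
        split_ifs <;> first | (exfalso; linarith) | norm_num
    _ = iidMean E h (fun L => if (equalPairs L : ℝ) < μ / 2 then 1 else 0) *
        iidMean E h (fun L => if (equalPairs L : ℝ) < μ / 2 then 1 else 0) := by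
        simp only [iidMean_const_mul]
        rw [← iidMean_const_mul]
        congr 1; funext L; ring
    _ ≤ (4 / μ) ^ 2 := by nlinarith

/-- The relative error of the collision based estimate of `|E|` is small on average. -/
theorem iidMean_abs_estimate_sub_one_le {x : β} (hx : x ∈ E) {h : ℕ} (hh : 2 ≤ h) {μ : ℝ}
    (hμ : μ = ((h + h + 1).choose 2 : ℝ) / E.card) (hμ1 : 1 ≤ μ) :
    iidMean E (h + h) (fun L => |μ / equalPairs (x :: L) - 1|) ≤ 20 / √μ + 3200 / μ := by
  have hm : (0 : ℝ) < E.card := by exact_mod_cast Finset.card_pos.2 ⟨x, hx⟩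
  have hμ0 : 0 < μ := by linarith
  set ν : ℝ := (h.choose 2 : ℝ) / E.card with hν
  have hνμ : μ ≤ 10 * ν := by
    rw [hμ, hν, ← mul_div_assoc]
    refine div_le_div_of_nonneg_right ?_ hm.le
    rw [Nat.cast_choose_two, Nat.cast_choose_two]
    push_cast
    have : (2 : ℝ) ≤ h := by exact_mod_cast hh
    nlinarith
  have hν0 : 0 < ν := by linarith
  have hs : 0 < √μ := Real.sqrt_pos.2 hμ0
  have hss : √μ * √μ = μ := Real.mul_self_sqrt hμ0.le
  have hpt : ∀ L : List β, |μ / equalPairs (x :: L) - 1| ≤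
      (1 / ν / √μ * pairExcess E (h + h + 1) (x :: L) ^ 2 + √μ / ν) +
        (μ + 1) * (if (equalPairs L : ℝ) < ν / 2 then 1 else 0) := by
    intro L
    have hpe : pairExcess E (h + h + 1) (x :: L) = equalPairs (x :: L) - μ := by
      rw [pairExcess, hμ]
    rw [hpe]
    set c : ℝ := (equalPairs (x :: L) : ℝ) with hc
    have hc0 : 0 ≤ c := by positivity
    have hnn : 0 ≤ 1 / ν / √μ * (c - μ) ^ 2 + √μ / ν := by positivity
    split_ifs with hL
    -- With few equal pairs among the tail, or none at all and the quotient equal to `0`, the crude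
    -- bound `μ + 1` is paid for by the small probability of this event.
    · have : |μ / c - 1| ≤ μ + 1 := by
        have h1 : μ / c ≤ μ := by
          by_cases h0 : equalPairs (x :: L) = 0
          · rw [hc, h0]; simp [hμ0.le]
          · have : 1 ≤ c := by rw [hc]; exact_mod_cast Nat.one_le_iff_ne_zero.2 h0
            exact div_le_self hμ0.le this
        have h2 : 0 ≤ μ / c := by positivity
        rw [abs_le]; constructor <;> linarith
      linarith
    · have hcL : ν / 2 ≤ c := by
        have : (equalPairs L : ℝ) ≤ c := by
          rw [hc]; exact_mod_cast Nat.le_add_left _ _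
        linarith
      have hcpos : 0 < c := by linarith
      have h1 : |μ / c - 1| = |c - μ| / c := by
        rw [div_sub_one hcpos.ne', abs_div, abs_of_pos hcpos, abs_sub_comm]
      have h2 : |c - μ| / c ≤ |c - μ| * (2 / ν) := by
        rw [div_eq_mul_inv]
        refine mul_le_mul_of_nonneg_left ?_ (abs_nonneg _)
        rw [← inv_div]
        exact inv_anti₀ (by positivity) hcL
      have h3 : |c - μ| * 2 ≤ (c - μ) ^ 2 / √μ + √μ := by
        rw [div_add' _ _ _ hs.ne', le_div_iff₀ hs, ← sq_abs (c - μ)]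
        nlinarith [sq_nonneg (|c - μ| - √μ)]
      rw [h1]
      calc |c - μ| / c ≤ |c - μ| * 2 / ν := by rw [mul_div_assoc]; exact h2
        _ ≤ ((c - μ) ^ 2 / √μ + √μ) / ν := div_le_div_of_nonneg_right h3 hν0.le
        _ = _ := by field_simp; ring
  refine (iidMean_mono E _ hpt).trans ?_
  rw [iidMean_add, iidMean_add, iidMean_const_mul, iidMean_const_mul, iidMean_const E ⟨x, hx⟩]
  have hA := (iidMean_pairExcess_cons_sq_le (h + h) hx).trans hμ.ge
  have hB := iidMean_equalPairs_lt_le_sq ⟨x, hx⟩ h hν hν0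
  have h1 : 1 / ν / √μ * iidMean E (h + h) (fun L => pairExcess E (h + h + 1) (x :: L) ^ 2) +
      √μ / ν ≤ 20 / √μ := by
    calc _ ≤ 1 / ν / √μ * μ + √μ / ν := by gcongr
      _ = 2 * √μ / ν := by
          have : 1 / ν / √μ * μ = √μ / ν := by
            rw [div_div, one_div_mul_eq_div, div_eq_div_iff (by positivity) hν0.ne']
            nlinarith
          rw [this]; ring
      _ ≤ 20 / √μ := by
          rw [div_le_div_iff₀ hν0 hs]; nlinarith
  have h2 : (μ + 1) * iidMean E (h + h) (fun L => if (equalPairs L : ℝ) < ν / 2 then 1 else 0) ≤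
      3200 / μ := by
    calc _ ≤ (2 * μ) * (40 / μ) ^ 2 := by
          refine mul_le_mul (by linarith) (hB.trans ?_) ?_ (by positivity)
          · refine pow_le_pow_left₀ (by positivity) ?_ 2
            rw [div_le_div_iff₀ hν0 hμ0]; linarith
          · exact iidMean_nonneg E ⟨x, hx⟩ _ fun L => by split_ifs <;> norm_num
      _ = 3200 / μ := by field_simp; norm_num
  linarith

end Independent

/-! ### Sums along the random walk -/

section WalkSums

variable {V : Type} [Fintype V] {G : SimpleGraph V} [DecidableRel G.Adj]

variable (G) in
theorem walkMean_add (r : ℕ) (u : V) (f g : List (WalkEdge V) → ℝ) :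
    walkMean G r u (fun R => f R + g R) = walkMean G r u f + walkMean G r u g := by
  simp only [← mean_walk, mean_add]

variable (G) in
theorem walkMean_const (r : ℕ) (u : V) (c : ℝ) : walkMean G r u (fun _ => c) = c := by
  simp only [← mean_walk, mean_const]

variable (G) in
theorem walkMean_const_mul (r : ℕ) (u : V) (c : ℝ) (f : List (WalkEdge V) → ℝ) :
    walkMean G r u (fun R => c * f R) = c * walkMean G r u f := by
  simp only [← mean_walk, mean_const_mul]

theorem walkMean_le_walkMean (hG : ∀ v, 0 < G.degree v) {r : ℕ} {u : V}
    {f g : List (WalkEdge V) → ℝ} (h : ∀ R, R.length = r → IsTrace G R → f R ≤ g R) :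
    walkMean G r u f ≤ walkMean G r u g := by
  simp only [← mean_walk]
  exact mean_le_mean G (within_walk G hG r u) fun R hR => h R hR.1 hR.2

theorem walkMean_congr (hG : ∀ v, 0 < G.degree v) {r : ℕ} {u : V}
    {f g : List (WalkEdge V) → ℝ} (h : ∀ R, R.length = r → IsTrace G R → f R = g R) :
    walkMean G r u f = walkMean G r u g :=
  le_antisymm (walkMean_le_walkMean hG fun R h1 h2 => (h R h1 h2).le)
    (walkMean_le_walkMean hG fun R h1 h2 => (h R h1 h2).ge)

variable [LinearOrder V]

/-- The expected value of a function of the record of the next step from `x`. -/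
noncomputable def stepMean (G : SimpleGraph V) [DecidableRel G.Adj] (ψ : WalkEdge V → ℝ) (x : V) :
    ℝ := 𝔼 v ∈ nbrAnswers G x, ψ (stepRecord G x v)

theorem walkMatrix_pow_succ_mulVec (hG : ∀ v, 0 < G.degree v) (j : ℕ) (f : V → ℝ) (u : V) :
    (walkMatrix G ^ (j + 1) *ᵥ f) u = 𝔼 v ∈ nbrAnswers G u, (walkMatrix G ^ j *ᵥ f) v := by
  rw [← walkMatrix_mulVec G hG, Matrix.mulVec_mulVec, pow_succ']

theorem walkMean_sum (hG : ∀ v, 0 < G.degree v) (ψ : WalkEdge V → ℝ) (r : ℕ) (u : V) :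
    walkMean G r u (fun R => (R.map ψ).sum) =
      ∑ j ∈ Finset.range r, (walkMatrix G ^ j *ᵥ stepMean G ψ) u := by
  induction r generalizing u with
  | zero => simp [walkMean]
  | succ r ih =>
    simp only [walkMean, List.map_cons, List.sum_cons, walkMean_add, walkMean_const, ih]
    rw [expect_add_distrib, Finset.sum_range_succ', expect_sum_comm]
    simp only [walkMatrix_pow_succ_mulVec hG, pow_zero, Matrix.one_mulVec]
    rw [add_comm]; rfl

/-- The mean of a sum along the walk is the stationary mean up to an error that is independent of
the length of the walk. -/
theorem IsMixing.abs_walkMean_sum_sub_le (h : IsMixing G) {ψ : WalkEdge V → ℝ} {M : ℝ}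
    (hψ : ∀ u, |stepMean G ψ u| ≤ M) (r : ℕ) (u : V) :
    |walkMean G r u (fun R => (R.map ψ).sum) -
      r * ((∑ u, ∑ v ∈ G.neighborFinset u, ψ (stepRecord G u v)) / (2 * G.edgeFinset.card))| ≤
      4 * mixingTime G * M := by
  rw [walkMean_sum h.degree_pos, ← sum_stationary_mul_expect G h.degree_pos
    (fun u v => ψ (stepRecord G u v))]
  exact h.abs_sum_mulVec_sub_le r u hψ

theorem IsMixing.card_edgeFinset_pos (h : IsMixing G) : 0 < G.edgeFinset.card :=
  have := h.nonempty
  Tetris.card_edgeFinset_pos G h.degree_pos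

/-- In the stationary walk every edge is equally likely, so the mean of `d_e` is an average over
the edges, which the degeneracy bounds; a step from any vertex, however unusual, costs
at most `√(2m)`. -/
theorem IsMixing.walkMean_edgeDeg_le (h : IsMixing G) (r : ℕ) (u : V) :
    walkMean G r u (fun R => ((R.map WalkEdge.edgeDeg).sum : ℕ)) ≤
      2 * r * degeneracy G + 4 * mixingTime G * √(2 * G.edgeFinset.card) := by
  have hm : (0 : ℝ) < G.edgeFinset.card := by exact_mod_cast h.card_edgeFinset_pos
  have hb : ∀ x, |stepMean G (fun e => (e.edgeDeg : ℝ)) x| ≤ √(2 * G.edgeFinset.card) := by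
    intro x
    rw [abs_of_nonneg (expect_nonneg fun v _ => by positivity)]
    refine le_of_eq_of_le ?_ (expect_min_degree_le G h.degree_pos x)
    simp [stepMean, WalkEdge.edgeDeg, stepRecord]
  have h1 := (abs_le.1 (h.abs_walkMean_sum_sub_le hb r u)).2
  have h2 : (∑ u, ∑ v ∈ G.neighborFinset u, ((stepRecord G u v).edgeDeg : ℝ)) /
      (2 * G.edgeFinset.card) ≤ 2 * degeneracy G := by
    rw [div_le_iff₀ (by positivity)]
    have : ((∑ u, ∑ v ∈ G.neighborFinset u, min (G.degree u) (G.degree v) : ℕ) : ℝ) ≤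
        ((4 * G.edgeFinset.card * degeneracy G : ℕ) : ℝ) := by exact_mod_cast sum_min_degree_le G
    push_cast at this
    simp only [stepRecord, WalkEdge.edgeDeg, Nat.cast_min]
    linarith
  have h3 : walkMean G r u (fun R => ((R.map WalkEdge.edgeDeg).sum : ℕ)) =
      walkMean G r u (fun R => (R.map fun e => (e.edgeDeg : ℝ)).sum) := by
    congr 1; funext R; rw [Nat.cast_list_sum, List.map_map]; rfl
  rw [h3]
  have h4 := mul_le_mul_of_nonneg_left h2 (Nat.cast_nonneg (α := ℝ) r)
  linarith

theorem IsMixing.abs_walkMean_recordTriangles_sub_le (h : IsMixing G) (r : ℕ) (u : V) :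
    |walkMean G r u (fun R => (R.map fun e => (recordTriangles G e : ℝ)).sum) -
      r * (triangleCount G / G.edgeFinset.card)| ≤ 4 * mixingTime G * maxAssigned G := by
  have hm : (0 : ℝ) < G.edgeFinset.card := by exact_mod_cast h.card_edgeFinset_pos
  have hb : ∀ x, |stepMean G (fun e => (recordTriangles G e : ℝ)) x| ≤ maxAssigned G := by
    intro x
    rw [abs_of_nonneg (expect_nonneg fun v _ => by positivity)]
    refine expect_le (nbrAnswers_nonempty G x) fun v hv => ?_
    rw [nbrAnswers_of_pos G (h.degree_pos x)] at hv
    exact Nat.cast_le.2 (assignedTriangles_le_maxAssigned G (show G.Adj x v by simpa using hv))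
  have h1 := h.abs_walkMean_sum_sub_le hb r u
  have h2 : ∑ u, ∑ v ∈ G.neighborFinset u, (recordTriangles G (stepRecord G u v) : ℝ) =
      2 * triangleCount G := by
    exact_mod_cast sum_assignedTriangles G
  rw [h2, mul_div_mul_left _ _ two_ne_zero] at h1
  exact h1

/-- The variance of the number of triangles assigned to the edges of the walk: after each step,
the mean of the remaining sum is known up to `4 τ t_max`, so that only nearby steps are
correlated. -/
theorem IsMixing.walkMean_recordTriangles_sq_le (h : IsMixing G) (r : ℕ) (u : V) :
    walkMean G r u (fun R => ((R.map fun e => (recordTriangles G e : ℝ)).sum -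
      r * (triangleCount G / G.edgeFinset.card)) ^ 2) ≤
      12 * mixingTime G * maxAssigned G *
        (walkMean G r u (fun R => (R.map fun e => (recordTriangles G e : ℝ)).sum) +
          r * (triangleCount G / G.edgeFinset.card)) := by
  set a : ℝ := triangleCount G / G.edgeFinset.card with ha
  set F : List (WalkEdge V) → ℝ := fun R => (R.map fun e => (recordTriangles G e : ℝ)).sum with hF
  have hm : (0 : ℝ) < G.edgeFinset.card := by exact_mod_cast h.card_edgeFinset_pos
  have ha0 : 0 ≤ a := by positivity
  have hτ : (1 : ℝ) ≤ mixingTime G := by exact_mod_cast h.mixingTime_pos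
  have hat : a ≤ maxAssigned G := by
    rw [ha, div_le_iff₀ hm, mul_comm]
    exact_mod_cast triangleCount_le G
  set t : ℝ := (maxAssigned G : ℝ) with ht
  have ht0 : 0 ≤ t := by positivity
  have htB : t ≤ mixingTime G * t := le_mul_of_one_le_left ht0 hτ
  change walkMean G r u (fun R => (F R - r * a) ^ 2) ≤ _ * (walkMean G r u F + r * a)
  induction r generalizing u with
  | zero => simp [walkMean, hF]
  | succ r ih =>
    have hM : ∀ v, |walkMean G r v F - r * a| ≤ 4 * mixingTime G * t := fun v =>
      h.abs_walkMean_recordTriangles_sub_le r v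
    have hcons : ∀ e R, F (e :: R) = recordTriangles G e + F R := fun e R => by simp [hF]
    have h1 : ∀ v, walkMean G r v (fun R => (F (stepRecord G u v :: R) - (r + 1 : ℕ) * a) ^ 2) =
        (recordTriangles G (stepRecord G u v) - a) ^ 2 +
        2 * (recordTriangles G (stepRecord G u v) - a) * (walkMean G r v F - r * a) +
        walkMean G r v (fun R => (F R - r * a) ^ 2) := by
      intro v
      have : ∀ R, (F (stepRecord G u v :: R) - (r + 1 : ℕ) * a) ^ 2 =
          ((recordTriangles G (stepRecord G u v) - a) ^ 2 +
          2 * (recordTriangles G (stepRecord G u v) - a) * (-(r * a))) +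
          (2 * (recordTriangles G (stepRecord G u v) - a) * F R + (F R - r * a) ^ 2) := by
        intro R; rw [hcons]; push_cast; ring
      simp only [this, walkMean_add, walkMean_const, walkMean_const_mul]
      ring
    have h2 : walkMean G (r + 1) u F = 𝔼 v ∈ nbrAnswers G u,
        ((recordTriangles G (stepRecord G u v) : ℝ) + walkMean G r v F) := by
      simp only [walkMean, hcons, walkMean_add, walkMean_const]
    rw [h2, ← expect_const (nbrAnswers_nonempty G u) (((r + 1 : ℕ) : ℝ) * a),
      ← expect_add_distrib, mul_expect, walkMean]
    rw [expect_const (nbrAnswers_nonempty G u) (((r + 1 : ℕ) : ℝ) * a)]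
    refine expect_le_expect fun v hv => ?_
    rw [h1 v]
    rw [nbrAnswers_of_pos G (h.degree_pos u)] at hv
    have hx : (recordTriangles G (stepRecord G u v) : ℝ) ≤ t := by
      exact Nat.cast_le.2 (assignedTriangles_le_maxAssigned G (show G.Adj u v by simpa using hv))
    have hx0 : (0 : ℝ) ≤ recordTriangles G (stepRecord G u v) := by positivity
    set x : ℝ := (recordTriangles G (stepRecord G u v) : ℝ)
    have hsq : (x - a) ^ 2 ≤ 4 * mixingTime G * t * (x + a) := by
      have : (x - a) ^ 2 ≤ t * (x + a) := by nlinarith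
      nlinarith
    have hcross : 2 * (x - a) * (walkMean G r v F - r * a) ≤
        2 * (x + a) * (4 * mixingTime G * t) := by
      have h3 : |x - a| ≤ x + a := by rw [abs_le]; constructor <;> linarith
      calc 2 * (x - a) * (walkMean G r v F - r * a)
          ≤ |2 * (x - a) * (walkMean G r v F - r * a)| := le_abs_self _
        _ = 2 * (|x - a| * |walkMean G r v F - r * a|) := by
            rw [abs_mul, abs_mul, abs_two, mul_assoc]
        _ ≤ 2 * ((x + a) * (4 * mixingTime G * t)) := by
            have := mul_le_mul h3 (hM v) (abs_nonneg _) (by positivity)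
            linarith
        _ = _ := by ring
    have := ih v
    push_cast
    linarith

end WalkSums

/-! ### The spaced edges of the walk -/

section SpacedEdges

variable {V : Type} [Fintype V] [LinearOrder V] {G : SimpleGraph V} [DecidableRel G.Adj]

/-- Waiting `i` steps before the first recorded edge applies the `i`-th power of the transition
matrix to the starting vertex. -/
theorem walkMean_everyNth_delay (hG : ∀ v, 0 < G.degree v) (f : List (WalkEdge V) → ℝ)
    (τ r i : ℕ) (u : V) :
    walkMean G (r + i) u (fun R => f (everyNth τ i R)) =
      (walkMatrix G ^ i *ᵥ fun x => walkMean G r x fun R => f (everyNth τ 0 R)) u := by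
  induction i generalizing u with
  | zero => simp
  | succ i ih =>
    rw [walkMatrix_pow_succ_mulVec hG, ← add_assoc, walkMean]
    exact expect_congr rfl fun v _ => ih v

theorem abs_walkMatrix_pow_mulVec_sub_le (hG : ∀ v, 0 < G.degree v) (t : ℕ) {f : V → ℝ} {c M : ℝ}
    (h : ∀ v, |f v - c| ≤ M) (u : V) : |(walkMatrix G ^ t *ᵥ f) u - c| ≤ M := by
  induction t generalizing u with
  | zero => simpa using h u
  | succ t ih =>
    have hne := nbrAnswers_nonempty G u
    rw [walkMatrix_pow_succ_mulVec hG, ← expect_const hne c, ← expect_sub_distrib]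
    exact (abs_expect_le _ _).trans (expect_le hne fun v _ => ih v)

theorem walkMatrix_pow_mulVec_le (hG : ∀ v, 0 < G.degree v) (t : ℕ) {f : V → ℝ} {M : ℝ}
    (h : ∀ v, f v ≤ M) (u : V) : (walkMatrix G ^ t *ᵥ f) u ≤ M := by
  induction t generalizing u with
  | zero => simpa using h u
  | succ t ih =>
    rw [walkMatrix_pow_succ_mulVec hG]
    exact expect_le (nbrAnswers_nonempty G u) fun v _ => ih v

/-- Edges of the walk that are `τ` steps apart are nearly independent and uniform. -/
theorem IsMixing.abs_walkMean_everyNth_sub_le (h : IsMixing G) {τ : ℕ} (hτ : 0 < τ) (q : ℕ)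
    {ρ : ℕ} (hρ : ρ < τ) (u : V) {f : List (Sym2 V) → ℝ} {M : ℝ} (hf : ∀ L, |f L| ≤ M) :
    |walkMean G (q * τ + ρ) u (fun R => f ((everyNth τ (τ - 1) R).map recordEdge)) -
      iidMean G.edgeFinset q f| ≤ q * (2 * (1 / 2) ^ ((τ - 1) / mixingTime G)) * M := by
  have hE : G.edgeFinset.Nonempty := Finset.card_pos.1 h.card_edgeFinset_pos
  have hm : (G.edgeFinset.card : ℝ) ≠ 0 := by exact_mod_cast h.card_edgeFinset_pos.ne'
  induction q generalizing u f with
  | zero =>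
    have : walkMean G (0 * τ + ρ) u (fun R => f ((everyNth τ (τ - 1) R).map recordEdge)) =
        walkMean G (0 * τ + ρ) u (fun _ => f []) := by
      refine walkMean_congr h.degree_pos fun R hR _ => ?_
      have h0 : (everyNth τ (τ - 1) R).length = 0 := by
        rw [length_everyNth hτ R _ (by omega), hR, Nat.div_eq_of_lt (by omega)]
      rw [List.length_eq_zero_iff.1 h0]; rfl
    rw [this, walkMean_const]
    simp [iidMean]
  | succ q ih =>
    set δ : ℝ := 2 * (1 / 2) ^ ((τ - 1) / mixingTime G)
    set φ : Sym2 V → ℝ := fun e => iidMean G.edgeFinset q fun L => f (e :: L) with hφ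
    set B : V → ℝ := fun x => 𝔼 v ∈ nbrAnswers G x, φ s(x, v) with hB
    have hφM : ∀ e, |φ e| ≤ M := fun e => abs_iidMean_le _ hE q fun L => hf _
    have hBM : ∀ x, |B x| ≤ M := fun x => (abs_expect_le _ _).trans
      (expect_le (nbrAnswers_nonempty G x) fun v _ => hφM _)
    have hπ : ∑ x, stationary G x * B x = iidMean G.edgeFinset (q + 1) f := by
      rw [hB, sum_stationary_mul_expect G h.degree_pos (fun x v => φ s(x, v)),
        sum_sum_neighborFinset, mul_div_mul_left _ _ two_ne_zero, ← expect_eq_sum_div_card]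
      rfl
    have h1 := h.abs_mulVec_sub_le (τ - 1) u hBM
    rw [hπ] at h1
    rw [show (q + 1) * τ + ρ = (q * τ + ρ + 1) + (τ - 1) by rw [add_mul]; omega,
      walkMean_everyNth_delay h.degree_pos fun L => f (L.map recordEdge)]
    set A : V → ℝ := fun x => walkMean G (q * τ + ρ + 1) x fun R =>
      f ((everyNth τ 0 R).map recordEdge) with hA
    have hAB : ∀ x, |(A - B) x - 0| ≤ q * δ * M := by
      intro x
      rw [sub_zero, Pi.sub_apply, hA, hB]
      simp only [walkMean]
      rw [← expect_sub_distrib]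
      refine (abs_expect_le _ _).trans (expect_le (nbrAnswers_nonempty G x) fun v _ => ?_)
      exact ih v fun L => hf (s(x, v) :: L)
    have h2 := abs_walkMatrix_pow_mulVec_sub_le h.degree_pos (τ - 1) hAB u
    rw [Matrix.mulVec_sub, Pi.sub_apply, sub_zero] at h2
    calc _ ≤ |(walkMatrix G ^ (τ - 1) *ᵥ A) u - (walkMatrix G ^ (τ - 1) *ᵥ B) u| +
          |(walkMatrix G ^ (τ - 1) *ᵥ B) u - iidMean G.edgeFinset (q + 1) f| := abs_sub_le _ _ _
      _ ≤ q * δ * M + δ * M := add_le_add h2 h1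
      _ = _ := by push_cast; ring

/-- The mean relative error of the estimate of `m` from one residue class of positions. -/
theorem IsMixing.walkMean_residue_error_le (h : IsMixing G) {τ n i : ℕ} (hi : i < τ)
    (hn : 2 ≤ n) {μ : ℝ} (hμ : μ = ((n + n + 1).choose 2 : ℝ) / G.edgeFinset.card) (hμ1 : 1 ≤ μ)
    (s : V) :
    walkMean G ((n + n + 1) * τ) s (fun R =>
      |μ / equalPairs ((everyNth τ i R).map recordEdge) - 1|) ≤
      20 / √μ + 3200 / μ +
        (n + n : ℕ) * (2 * (1 / 2) ^ ((τ - 1) / mixingTime G)) * (μ + 1) := by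
  have hbound : ∀ L : List (Sym2 V), |(|μ / equalPairs L - 1|)| ≤ μ + 1 := by
    intro L
    rw [abs_abs]
    have h1 : μ / equalPairs L ≤ μ := by
      by_cases h0 : equalPairs L = 0
      · rw [h0]; simp; linarith
      · have : (1 : ℝ) ≤ equalPairs L := by exact_mod_cast Nat.one_le_iff_ne_zero.2 h0
        exact div_le_self (by linarith) this
    have h2 : 0 ≤ μ / equalPairs L := by positivity
    rw [abs_le]; constructor <;> linarith
  rw [show (n + n + 1) * τ = ((n + n) * τ + (τ - 1 - i) + 1) + i by rw [add_mul _ 1]; omega,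
    walkMean_everyNth_delay h.degree_pos fun L => |μ / equalPairs (L.map recordEdge) - 1|]
  refine walkMatrix_pow_mulVec_le h.degree_pos i (fun x => ?_) s
  rw [walkMean]
  refine expect_le (nbrAnswers_nonempty G x) fun v hv => ?_
  rw [nbrAnswers_of_pos G (h.degree_pos x)] at hv
  have hx : s(x, v) ∈ G.edgeFinset := by simpa using hv
  have h1 := (abs_le.1 (h.abs_walkMean_everyNth_sub_le (by omega) (n + n)
    (show τ - 1 - i < τ by omega) v (f := fun L => |μ / equalPairs (s(x, v) :: L) - 1|)
    (fun L => hbound _))).2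
  have h2 := iidMean_abs_estimate_sub_one_le hx hn hμ hμ1
  have h3 := sub_le_iff_le_add.1 h1
  refine le_trans (le_of_eq ?_) (h3.trans (by linarith))
  rfl

/-- The mean relative error of the edge count estimator. -/
theorem IsMixing.walkMean_edgeEstimate_error_le (h : IsMixing G) {τ n : ℕ} (hτ : 0 < τ)
    (hn : 2 ≤ n) {μ : ℝ} (hμ : μ = ((n + n + 1).choose 2 : ℝ) / G.edgeFinset.card) (hμ1 : 1 ≤ μ)
    (s : V) :
    walkMean G ((n + n + 1) * τ) s (fun R =>
      |(edgeEstimate τ R : ℝ) / G.edgeFinset.card - 1|) ≤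
      20 / √μ + 3200 / μ +
        (n + n : ℕ) * (2 * (1 / 2) ^ ((τ - 1) / mixingTime G)) * (μ + 1) := by
  have hm : (G.edgeFinset.card : ℝ) ≠ 0 := by exact_mod_cast h.card_edgeFinset_pos.ne'
  have hτ' : (τ : ℝ) ≠ 0 := by exact_mod_cast hτ.ne'
  set b := 20 / √μ + 3200 / μ + (n + n : ℕ) * (2 * (1 / 2) ^ ((τ - 1) / mixingTime G)) * (μ + 1)
  calc _ ≤ walkMean G ((n + n + 1) * τ) s (fun R => (τ : ℝ)⁻¹ * ∑ i ∈ Finset.range τ,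
        |μ / equalPairs ((everyNth τ i R).map recordEdge) - 1|) := by
        refine walkMean_le_walkMean h.degree_pos fun R hR _ => ?_
        have hlen : ∀ i ∈ Finset.range τ, (everyNth τ i R).length = n + n + 1 := by
          intro i hi
          have hi := Finset.mem_range.1 hi
          rw [length_everyNth hτ R i hi, hR, mul_comm, Nat.mul_add_div hτ,
            Nat.div_eq_of_lt (by omega), add_zero]
        have h1 : (edgeEstimate τ R : ℝ) / G.edgeFinset.card - 1 = (τ : ℝ)⁻¹ *
            ∑ i ∈ Finset.range τ, (μ / equalPairs ((everyNth τ i R).map recordEdge) - 1) := by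
          rw [Finset.sum_sub_distrib, Finset.sum_const, Finset.card_range, nsmul_eq_mul, mul_one,
            mul_sub, inv_mul_cancel₀ hτ', edgeEstimate]
          push_cast
          rw [div_div, div_eq_inv_mul, mul_inv, mul_assoc, Finset.mul_sum]
          congr 2
          refine Finset.sum_congr rfl fun i hi => ?_
          rw [hlen i hi, hμ]
          field_simp
        rw [h1, abs_mul, abs_of_nonneg (by positivity)]
        exact mul_le_mul_of_nonneg_left (Finset.abs_sum_le_sum_abs _ _) (by positivity)
    _ = (τ : ℝ)⁻¹ * ∑ i ∈ Finset.range τ, walkMean G ((n + n + 1) * τ) s (fun R =>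
        |μ / equalPairs ((everyNth τ i R).map recordEdge) - 1|) := by
        rw [walkMean_const_mul]
        simp only [← mean_walk, mean_sum]
    _ ≤ (τ : ℝ)⁻¹ * ∑ i ∈ Finset.range τ, b := by
        refine mul_le_mul_of_nonneg_left (Finset.sum_le_sum fun i hi => ?_) (by positivity)
        exact h.walkMean_residue_error_le (Finset.mem_range.1 hi) hn hμ hμ1 s
    _ = b := by
        rw [Finset.sum_const, Finset.card_range, nsmul_eq_mul, ← mul_assoc, inv_mul_cancel₀ hτ',
          one_mul]

end SpacedEdges

/-! ### Medians of independent runs -/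

section Median

/-- A condition that holds on an interval holds at the median if fewer than half of the entries
violate it. -/
theorem median_of_two_mul_countP_lt {l : List ℚ} {P : ℚ → Prop} [DecidablePred P]
    (hconn : ∀ x y z, x ≤ y → y ≤ z → P x → P z → P y)
    (hl : 2 * l.countP (fun x => ¬ P x) < l.length) : P (median l) := by
  set L := l.insertionSort (· ≤ ·) with hL
  have hperm : L.Perm l := List.perm_insertionSort _ _
  have hlen : L.length = l.length := hperm.length_eq
  have hcount : L.countP (fun x => ¬ P x) = l.countP (fun x => ¬ P x) := hperm.countP_eq _
  have hsorted : L.SortedLE := List.sortedLE_insertionSort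
  set j := l.length / 2 with hj
  have hjlt : j < L.length := by omega
  have hmed : median l = L[j] := by
    rw [median, List.getD_eq_getElem _ _ hjlt]
  rw [hmed]
  by_contra hbad
  -- Either all entries up to the median or all entries from it on violate the condition.
  have htake : ∃ x ∈ L.take (j + 1), P x := by
    by_contra hno
    push Not at hno
    have h1 : (L.take (j + 1)).countP (fun x => ¬ P x) = (L.take (j + 1)).length :=
      List.countP_eq_length.2 fun x hx => by simpa using hno x hx
    have h2 := (List.take_sublist (j + 1) L).countP_le (p := fun x => ¬ P x)
    rw [h1, List.length_take] at h2
    omega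
  have hdrop : ∃ x ∈ L.drop j, P x := by
    by_contra hno
    push Not at hno
    have h1 : (L.drop j).countP (fun x => ¬ P x) = (L.drop j).length :=
      List.countP_eq_length.2 fun x hx => by simpa using hno x hx
    have h2 := (List.drop_sublist j L).countP_le (p := fun x => ¬ P x)
    rw [h1, List.length_drop] at h2
    omega
  obtain ⟨x, hx, hPx⟩ := htake
  obtain ⟨z, hz, hPz⟩ := hdrop
  obtain ⟨a, ha, rfl⟩ := List.mem_take_iff_getElem.1 hx
  obtain ⟨b, hb, rfl⟩ := List.mem_drop_iff_getElem.1 hz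
  refine hbad (hconn _ _ _ (hsorted.getElem_le_getElem_of_le ?_)
    (hsorted.getElem_le_getElem_of_le ?_) hPx hPz) <;> omega

variable {V : Type} [Fintype V] (G : SimpleGraph V) [DecidableRel G.Adj]

theorem within_repeatRuns {α : Type} {p : Prog V α} {n : ℕ} (hp : Within G p n fun _ => True)
    (k : ℕ) : Within G (repeatRuns p k) ((n + 2) * k) (fun xs => xs.length = k) := by
  induction k with
  | zero => exact within_pure G rfl
  | succ k ih =>
    simp only [repeatRuns]
    refine hp.bind G (n' := (n + 2) * k + 2) (fun x _ => ?_) (by ring_nf; omega)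
    refine (within_spend G _).bind G (n' := (n + 2) * k + 1) (fun _ _ => ?_) (by omega)
    refine (within_reserve G _).bind G (n' := (n + 2) * k) (fun _ _ => ?_) (by omega)
    exact ih.bind G (n' := 0) (fun xs hxs => within_pure G (by simp [hxs])) le_rfl

theorem mean_repeatRuns_prod {α : Type} (p : Prog V α) (f : α → ℝ) (k : ℕ) :
    mean G (repeatRuns p k) (fun xs => (xs.map f).prod) = mean G p f ^ k := by
  induction k with
  | zero => simp [repeatRuns]
  | succ k ih =>
    simp only [repeatRuns, mean_bind, mean_spend, mean_reserve, mean_pure, List.map_cons,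
      List.prod_cons, mean_const_mul, ih]
    rw [pow_succ, ← mean_const_mul]
    congr 1; funext x; ring

open Classical in
/-- The median of `k` runs fails only if half of the runs fail. When a run fails with probability
at most `1/16`, the expected value of `16` to the number of failures is at most `2 ^ k`. -/
theorem mean_median_le {p : Prog V ℚ} {n : ℕ} (hp : Within G p n fun _ => True) {P : ℚ → Prop}
    (hconn : ∀ x y z, x ≤ y → y ≤ z → P x → P z → P y)
    (hfail : mean G p (fun x => if P x then 0 else 1) ≤ 1 / 16) (k : ℕ) :
    mean G (repeatRuns p k) (fun xs => if P (median xs) then 0 else 1) ≤ (1 / 2) ^ k := by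
  have h1 : mean G p (fun x => 1 + 15 * if P x then 0 else 1) ≤ 2 := by
    rw [mean_add, mean_const, mean_const_mul]; linarith
  have h0 : 0 ≤ mean G p (fun x => 1 + 15 * if P x then 0 else 1) :=
    mean_nonneg G p fun x => by split_ifs <;> norm_num
  calc _ ≤ mean G (repeatRuns p k) (fun xs =>
        (1 / 4 ^ k) * (xs.map fun x => 1 + 15 * if P x then (0 : ℝ) else 1).prod) := by
        refine mean_le_mean G (within_repeatRuns G hp k) fun xs hxs => ?_
        have hprod : (xs.map fun x => 1 + 15 * if P x then (0 : ℝ) else 1).prod =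
            16 ^ xs.countP (fun x => ¬ P x) := by
          clear hxs
          induction xs with
          | nil => simp
          | cons x xs ih =>
            rw [List.map_cons, List.prod_cons, ih, List.countP_cons]
            by_cases hx : P x
            · simp [hx]
            · simp [hx, pow_succ]; ring
        rw [hprod]
        split_ifs with hmed
        · positivity
        · have hc : xs.length ≤ 2 * xs.countP (fun x => ¬ P x) := by
            by_contra hlt
            exact hmed (median_of_two_mul_countP_lt hconn (not_le.1 hlt))
          rw [div_mul_eq_mul_div, one_mul, one_le_div (by positivity),
            show (16 : ℝ) = 4 ^ 2 by norm_num, ← pow_mul]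
          exact pow_le_pow_right₀ (by norm_num) (by omega)
    _ = (1 / 4 ^ k) * mean G p (fun x => 1 + 15 * if P x then 0 else 1) ^ k := by
        rw [mean_const_mul, mean_repeatRuns_prod]
    _ ≤ (1 / 4 ^ k) * 2 ^ k := by gcongr
    _ = (1 / 2) ^ k := by
        rw [show (4 : ℝ) = 2 * 2 by norm_num, mul_pow]
        field_simp
        rw [← mul_pow]; norm_num

end Median

/-! ### A single run -/

section SingleRun

variable {V : Type} [Fintype V] [LinearOrder V] {G : SimpleGraph V} [DecidableRel G.Adj]

theorem within_tetris (hG : ∀ v, 0 < G.degree v) {q τ : ℕ} (hτ : 0 < τ) (ℓ : ℕ) (s : V) :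
    Within G (tetris (q * τ) ℓ τ s) (44 * (q * τ) + 8 * τ + 26 * ℓ + 23) (fun _ => True) := by
  set r := q * τ with hr
  simp only [tetris]
  refine (within_askDeg G s).bind G (n' := 44 * r + 8 * τ + 26 * ℓ + 21) (fun d hd => ?_) (by omega)
  subst hd
  refine (within_reserve G _).bind G (n' := 44 * r + 8 * τ + 26 * ℓ + 5) (fun _ _ => ?_) (by omega)
  refine (within_walk G hG r s).bind G (n' := 32 * r + 8 * τ + 26 * ℓ + 5)
    (fun R hR => ?_) (by omega)
  refine (within_spend G _).bind G (n' := 29 * r + 8 * τ + 26 * ℓ + 5) (fun _ _ => ?_)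
    (by rw [hR.1]; omega)
  refine (within_samplingTable G R).bind G (n' := 10 * r + 8 * τ + 26 * ℓ + 5) (fun A _ => ?_)
    (by rw [hR.1]; omega)
  refine (within_trials G _ A ℓ).bind G (n' := 10 * r + 8 * τ + 5) (fun y _ => ?_) (by omega)
  refine (within_edgeCountEstimator G R hτ (hR.1.trans hr)).bind G (n' := 4) (fun m _ => ?_)
    (by rw [hr]; ring_nf; omega)
  exact (within_spend G _).bind G (n' := 0) (fun _ _ => within_pure G trivial) (by omega)

/-- The expected value of a function of the output, with the deterministic edge count estimate in
place of the subroutine that computes it. -/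
theorem mean_tetris (hG : ∀ v, 0 < G.degree v) {q τ : ℕ} (hτ : 0 < τ) (ℓ : ℕ) (s : V)
    (g : ℚ → ℝ) :
    mean G (tetris (q * τ) ℓ τ s) g = walkMean G (q * τ) s (fun R =>
      mean G (samplingTable R (R.map WalkEdge.edgeDeg).sum) fun A =>
        mean G (trials (R.map WalkEdge.edgeDeg).sum A ℓ) fun y =>
          g (edgeEstimate τ R / ((q * τ : ℕ) : ℚ) * ((R.map WalkEdge.edgeDeg).sum : ℕ) *
            ((y : ℚ) / (ℓ : ℚ)))) := by
  simp only [tetris, mean_bind, mean_askDeg, mean_reserve, mean_walk, mean_spend, mean_pure]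
  refine walkMean_congr hG fun R hR _ => ?_
  congr 1; funext A
  congr 1; funext y
  rw [mean_congr G (within_edgeCountEstimator G R hτ hR) (g := fun _ =>
    g (edgeEstimate τ R / ((q * τ : ℕ) : ℚ) * ((R.map WalkEdge.edgeDeg).sum : ℕ) *
      ((y : ℚ) / (ℓ : ℚ)))) fun m hm => by rw [hm], mean_const]

/-- The output of the algorithm is accurate to a factor `1 ± ε`. -/
def Accurate (G : SimpleGraph V) [DecidableRel G.Adj] (ε : ℝ) (x : ℚ) : Prop :=
  (1 - ε) * (triangleCount G : ℝ) ≤ (x : ℝ) ∧ (x : ℝ) ≤ (1 + ε) * (triangleCount G : ℝ)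

theorem abs_mul_mul_sub_one_le {ε x y z : ℝ} (hε0 : 0 < ε) (hε : ε ≤ 1) (hx : |x - 1| ≤ ε / 10)
    (hy : |y - 1| ≤ ε / 10) (hz : |z - 1| ≤ ε / 10) :
    1 - ε ≤ x * y * z ∧ x * y * z ≤ 1 + ε := by
  rw [abs_le] at hx hy hz
  have hx0 : 0 ≤ x := by linarith
  have hy0 : 0 ≤ y := by linarith
  have hz0 : 0 ≤ z := by linarith
  have h1 : x * y ≤ 1 + 3 / 10 * ε := by nlinarith
  have h2 : 1 - 2 / 10 * ε ≤ x * y := by nlinarith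
  have h3 : 0 ≤ x * y := by positivity
  constructor <;> nlinarith

open Classical in
/-- Given a walk on which the edge count estimate, the number of assigned triangles and the sum of
the degrees are close to what is expected, the trials estimate the number of triangles. -/
theorem mean_trials_inaccurate_le (h : IsMixing G) (hT : 0 < triangleCount G) {ε : ℝ}
    (hε0 : 0 < ε) (hε : ε ≤ 1) {q τ ℓ : ℕ} (hq : 0 < q) (hτ : 0 < τ)
    (hℓ : 4000000 * (G.edgeFinset.card * degeneracy G / triangleCount G / ε ^ 2) ≤ (ℓ : ℝ))
    {R : List (WalkEdge V)} (hlen : R.length = q * τ) (hR : IsTrace G R)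
    (h1 : |(edgeEstimate τ R : ℝ) / G.edgeFinset.card - 1| ≤ ε / 10)
    (h2 : |(R.map fun e => (recordTriangles G e : ℝ)).sum -
      (q * τ : ℕ) * (triangleCount G / G.edgeFinset.card)| ≤
        ε / 10 * ((q * τ : ℕ) * (triangleCount G / G.edgeFinset.card)))
    (h3 : (((R.map WalkEdge.edgeDeg).sum : ℕ) : ℝ) ≤ 512 * degeneracy G * (q * τ : ℕ))
    {A : List (AliasCell (WalkEdge V))} (hA1 : A.length = R.length)
    (hA2 : ∀ c ∈ A, c.thr ≤ (R.map WalkEdge.edgeDeg).sum)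
    (hA3 : ∀ h : WalkEdge V → ℝ, aliasWeight (R.map WalkEdge.edgeDeg).sum A h =
      R.length * (R.map fun e => (e.edgeDeg : ℝ) * h e).sum) :
    mean G (trials (R.map WalkEdge.edgeDeg).sum A ℓ) (fun y =>
      if Accurate G ε (edgeEstimate τ R / ((q * τ : ℕ) : ℚ) * ((R.map WalkEdge.edgeDeg).sum : ℕ) *
        ((y : ℚ) / (ℓ : ℚ))) then 0 else 1) ≤ 1 / 64 := by
  have hne : R ≠ [] := by
    rintro rfl
    have := Nat.mul_pos hq hτ
    simp at hlen; omega
  have hp := mean_trial G h.degree_pos hR hne hA1 hA2 hA3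
  have hd := hR.sum_edgeDeg_pos h.degree_pos hne
  have hr : 0 < q * τ := Nat.mul_pos hq hτ
  have hα : 0 < degeneracy G := have := h.nonempty; degeneracy_pos G h.degree_pos
  set r := q * τ
  set d := (R.map WalkEdge.edgeDeg).sum
  rw [Nat.cast_list_sum, List.map_map] at hp
  change _ = (R.map fun e => (recordTriangles G e : ℝ)).sum / (d : ℝ) at hp
  set F := (R.map fun e => (recordTriangles G e : ℝ)).sum
  set M : ℚ := edgeEstimate τ R
  have hm' : (0 : ℝ) < G.edgeFinset.card := by exact_mod_cast h.card_edgeFinset_pos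
  have hT' : (0 : ℝ) < triangleCount G := by exact_mod_cast hT
  have hr' : (0 : ℝ) < (r : ℝ) := by exact_mod_cast hr
  have hd' : (0 : ℝ) < (d : ℝ) := by exact_mod_cast hd
  have hα' : (0 : ℝ) < degeneracy G := by exact_mod_cast hα
  set m : ℝ := (G.edgeFinset.card : ℝ)
  set T : ℝ := (triangleCount G : ℝ) with hTdef
  set α : ℝ := (degeneracy G : ℝ)
  have hra : 0 < r * (T / m) := by positivity
  have hF : 9 / 10 * (r * (T / m)) ≤ F := by
    have := (abs_le.1 h2).1
    nlinarith
  have hF0 : 0 < F := by nlinarith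
  set p := F / d with hpdef
  have hp0 : 0 < p := by positivity
  have hp1 : 9 / 5120 * (T / (m * α)) ≤ p := by
    rw [hpdef, le_div_iff₀ hd']
    calc 9 / 5120 * (T / (m * α)) * d ≤ 9 / 5120 * (T / (m * α)) * (512 * α * r) := by gcongr
      _ = 9 / 10 * (r * (T / m)) := by field_simp; norm_num
      _ ≤ F := hF
  have hℓp : 6400 / ε ^ 2 ≤ ℓ * p := by
    calc 6400 / ε ^ 2 ≤ 4000000 * (m * α / T / ε ^ 2) * (9 / 5120 * (T / (m * α))) := by
          have : 4000000 * (m * α / T / ε ^ 2) * (9 / 5120 * (T / (m * α))) =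
            (4000000 * 9 / 5120) / ε ^ 2 := by field_simp
          rw [this]
          gcongr
          norm_num
      _ ≤ ℓ * p := by gcongr
  have hℓp0 : 0 < ℓ * p := lt_of_lt_of_le (by positivity) hℓp
  have hℓ0 : (0 : ℝ) < ℓ := by
    by_contra hn
    have : (ℓ : ℝ) = 0 := le_antisymm (not_lt.1 hn) (by positivity)
    rw [this, zero_mul] at hℓp0
    exact lt_irrefl _ hℓp0
  have hvar := (mean_trials G d A ℓ hp).2
  calc _ ≤ mean G (trials d A ℓ) (fun y => 100 / (ε * (ℓ * p)) ^ 2 * ((y : ℝ) - ℓ * p) ^ 2) := by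
        refine mean_mono G _ fun y => ?_
        split_ifs with hacc
        · positivity
        · by_contra hlt
          apply hacc
          have hy : |(y : ℝ) / (ℓ * p) - 1| ≤ ε / 10 := by
            rw [not_le, div_mul_eq_mul_div, div_lt_one (by positivity)] at hlt
            rw [div_sub_one hℓp0.ne', abs_div, abs_of_pos hℓp0, div_le_iff₀ hℓp0]
            exact abs_le_of_sq_le_sq (by nlinarith) (by positivity)
          have hFF : |F / (r * (T / m)) - 1| ≤ ε / 10 := by
            rw [div_sub_one hra.ne', abs_div, abs_of_pos hra, div_le_iff₀ hra]
            exact h2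
          obtain ⟨hlo, hhi⟩ := abs_mul_mul_sub_one_le hε0 hε h1 hFF hy
          have hval : ((M / ((r : ℕ) : ℚ) * (d : ℕ) * ((y : ℚ) / (ℓ : ℚ)) : ℚ) : ℝ) =
              (M / m) * (F / (r * (T / m))) * (y / (ℓ * p)) * T := by
            push_cast
            rw [hpdef]
            field_simp
          rw [Accurate, hval, ← hTdef]
          constructor <;> exact mul_le_mul_of_nonneg_right (by assumption) hT'.le
    _ ≤ 100 / (ε * (ℓ * p)) ^ 2 * (ℓ * p) := by
        rw [mean_const_mul]
        exact mul_le_mul_of_nonneg_left hvar (by positivity)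
    _ = 100 / (ε ^ 2 * (ℓ * p)) := by field_simp
    _ ≤ 1 / 64 := by
        rw [div_le_div_iff₀ (by positivity) (by norm_num)]
        rw [div_le_iff₀ (by positivity)] at hℓp
        linarith

open Classical in
/-- A single run is inaccurate with probability at most `1/16`, provided that the walk satisfies
the three moment bounds. -/
theorem mean_tetris_inaccurate_le (h : IsMixing G) (hT : 0 < triangleCount G) {ε : ℝ}
    (hε0 : 0 < ε) (hε : ε ≤ 1) {q τ ℓ : ℕ} (hq : 0 < q) (hτ : 0 < τ) (s : V)
    (hℓ : 4000000 * (G.edgeFinset.card * degeneracy G / triangleCount G / ε ^ 2) ≤ (ℓ : ℝ))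
    (h1 : walkMean G (q * τ) s (fun R => |(edgeEstimate τ R : ℝ) / G.edgeFinset.card - 1|) ≤
      ε / 640)
    (h2 : walkMean G (q * τ) s (fun R => ((R.map fun e => (recordTriangles G e : ℝ)).sum -
      (q * τ : ℕ) * (triangleCount G / G.edgeFinset.card)) ^ 2) ≤
        (ε * ((q * τ : ℕ) * (triangleCount G / G.edgeFinset.card))) ^ 2 / 6400)
    (h3 : walkMean G (q * τ) s (fun R => ((R.map WalkEdge.edgeDeg).sum : ℕ)) ≤
      8 * degeneracy G * (q * τ : ℕ)) :
    mean G (tetris (q * τ) ℓ τ s) (fun x => if Accurate G ε x then 0 else 1) ≤ 1 / 16 := by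
  have hα : 0 < degeneracy G := have := h.nonempty; degeneracy_pos G h.degree_pos
  have hr : 0 < q * τ := Nat.mul_pos hq hτ
  have hm' : (0 : ℝ) < G.edgeFinset.card := by exact_mod_cast h.card_edgeFinset_pos
  have hT' : (0 : ℝ) < triangleCount G := by exact_mod_cast hT
  have hr' : (0 : ℝ) < (q * τ : ℕ) := by exact_mod_cast hr
  have hα' : (0 : ℝ) < degeneracy G := by exact_mod_cast hα
  set a : ℝ := (q * τ : ℕ) * (triangleCount G / G.edgeFinset.card) with ha
  have ha0 : 0 < a := by positivity
  rw [mean_tetris h.degree_pos hτ]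
  calc _ ≤ walkMean G (q * τ) s (fun R =>
        ((10 / ε) * |(edgeEstimate τ R : ℝ) / G.edgeFinset.card - 1| +
        (100 / (ε * a) ^ 2) * ((R.map fun e => (recordTriangles G e : ℝ)).sum - a) ^ 2) +
        ((1 / (512 * degeneracy G * (q * τ : ℕ))) * ((R.map WalkEdge.edgeDeg).sum : ℕ) +
          1 / 64)) := by
        refine walkMean_le_walkMean h.degree_pos fun R hlen hR => ?_
        have hnn1 : 0 ≤ (10 / ε) * |(edgeEstimate τ R : ℝ) / G.edgeFinset.card - 1| := by positivity
        have hnn2 : 0 ≤ (100 / (ε * a) ^ 2) *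
          ((R.map fun e => (recordTriangles G e : ℝ)).sum - a) ^ 2 := by positivity
        have hnn3 : 0 ≤ (1 / (512 * degeneracy G * (q * τ : ℕ))) *
          (((R.map WalkEdge.edgeDeg).sum : ℕ) : ℝ) := by positivity
        by_cases hgood : |(edgeEstimate τ R : ℝ) / G.edgeFinset.card - 1| ≤ ε / 10 ∧
            |(R.map fun e => (recordTriangles G e : ℝ)).sum - a| ≤ ε / 10 * a ∧
            (((R.map WalkEdge.edgeDeg).sum : ℕ) : ℝ) ≤ 512 * degeneracy G * (q * τ : ℕ)
        · obtain ⟨g1, g2, g3⟩ := hgood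
          refine le_trans (b := 1 / 64) ?_ (by linarith)
          rw [← mean_const G (samplingTable R (R.map WalkEdge.edgeDeg).sum) (1 / 64)]
          refine mean_le_mean G (within_samplingTable G R) fun A hA => ?_
          exact mean_trials_inaccurate_le h hT hε0 hε hq hτ hℓ hlen hR g1 g2 g3 hA.1 hA.2.1 hA.2.2
        · refine le_trans (b := 1) ?_ ?_
          · refine (mean_mono G _ fun A => ?_).trans (mean_const G _ 1).le
            refine (mean_mono G _ fun y => ?_).trans (mean_const G _ 1).le
            split_ifs <;> norm_num
          · simp only [not_and_or, not_le] at hgood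
            rcases hgood with hg | hg | hg
            · have : 1 ≤ (10 / ε) * |(edgeEstimate τ R : ℝ) / G.edgeFinset.card - 1| := by
                rw [div_mul_eq_mul_div, one_le_div hε0]; linarith
              linarith
            · have : 1 ≤ (100 / (ε * a) ^ 2) *
                  ((R.map fun e => (recordTriangles G e : ℝ)).sum - a) ^ 2 := by
                rw [div_mul_eq_mul_div, one_le_div (by positivity), ← sq_abs (_ - a)]
                have := pow_le_pow_left₀ (by positivity) hg.le 2
                nlinarith
              linarith
            · have : 1 ≤ (1 / (512 * degeneracy G * (q * τ : ℕ))) *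
                  (((R.map WalkEdge.edgeDeg).sum : ℕ) : ℝ) := by
                rw [div_mul_eq_mul_div, one_mul, one_le_div (by positivity)]; exact hg.le
              linarith
    _ ≤ ((10 / ε) * (ε / 640) + (100 / (ε * a) ^ 2) * ((ε * a) ^ 2 / 6400)) +
        ((1 / (512 * degeneracy G * (q * τ : ℕ))) * (8 * degeneracy G * (q * τ : ℕ)) + 1 / 64) := by
        simp only [walkMean_add, walkMean_const_mul, walkMean_const]
        gcongr
    _ = 1 / 16 := by field_simp; norm_num

end SingleRun

/-! ### Choice of the parameters -/

section Parameters

/-- Half of the number of spaced edges that are compared in each residue class. -/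
noncomputable def halfSample (g : GraphStats) (ε : ℝ) : ℕ :=
  ⌈1000000 * (√(g.m : ℝ) + g.m * g.tmax / g.T) / ε⌉₊

/-- The number of mixing times between spaced edges. The factor `1/ε` makes the distance from
independence small compared with every power of `ε`. -/
noncomputable def spacingFactor (g : GraphStats) (ε : ℝ) : ℕ := ⌈140 * Real.logb 2 g.n / ε⌉₊

/-- The estimate of the mixing time that is handed to the algorithm. -/
noncomputable def spacing (g : GraphStats) (ε : ℝ) : ℕ := g.mix * spacingFactor g ε

/-- The number of steps of the walk. -/
noncomputable def walkLength (g : GraphStats) (ε : ℝ) : ℕ :=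
  (halfSample g ε + halfSample g ε + 1) * spacing g ε

/-- The number of trials. -/
noncomputable def trialCount (g : GraphStats) (ε : ℝ) : ℕ :=
  ⌈4000000 * ((g.m : ℝ) * g.degen / g.T / ε ^ 2)⌉₊

open Classical in
/-- The number of runs of which the median is taken. -/
noncomputable def runCount (δ : ℝ) : ℕ := if 1 / 3 ≤ δ then 1 else ⌈Real.logb 2 (1 / δ)⌉₊

/-- The relations between the data of a graph that the analysis of the parameters uses. -/
structure GraphStats.Admissible (g : GraphStats) : Prop where
  /-- there are at least three vertices -/
  three_le_n : 3 ≤ g.n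
  /-- there is an edge -/
  m_pos : 0 < g.m
  /-- the number of edges is at most `n²` -/
  m_le : g.m ≤ g.n ^ 2
  /-- there is a triangle -/
  T_pos : 0 < g.T
  /-- the mixing time is positive -/
  mix_pos : 0 < g.mix
  /-- an edge has at most `n` triangles -/
  tmax_le : g.tmax ≤ g.n

variable {g : GraphStats} {ε : ℝ}

theorem GraphStats.Admissible.one_le_logb (h : g.Admissible) : 1 ≤ Real.logb 2 g.n := by
  rw [Real.le_logb_iff_rpow_le (by norm_num) (by have := h.three_le_n; positivity), Real.rpow_one]
  exact_mod_cast (by have := h.three_le_n; omega : 2 ≤ g.n)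

theorem GraphStats.Admissible.one_le_sqrt (h : g.Admissible) : 1 ≤ √(g.m : ℝ) := by
  rw [Real.one_le_sqrt]; exact_mod_cast h.m_pos

theorem ceil_le_add_one_mul {c x : ℝ} (hc : 0 ≤ c) (hx : 1 ≤ x) : (⌈c * x⌉₊ : ℝ) ≤ (c + 1) * x := by
  have := (Nat.ceil_lt_add_one (show 0 ≤ c * x by positivity)).le
  linarith

theorem GraphStats.Admissible.sample_one_le (h : g.Admissible) (hε0 : 0 < ε) (hε : ε ≤ 1) :
    1 ≤ (√(g.m : ℝ) + g.m * g.tmax / g.T) / ε := by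
  rw [one_le_div hε0]
  have := h.one_le_sqrt
  have h2 : (0 : ℝ) ≤ g.m * g.tmax / g.T := by positivity
  linarith

theorem GraphStats.Admissible.le_halfSample (_h : g.Admissible) :
    1000000 * ((√(g.m : ℝ) + g.m * g.tmax / g.T) / ε) ≤ halfSample g ε := by
  rw [← mul_div_assoc]; exact Nat.le_ceil _

theorem GraphStats.Admissible.halfSample_le (h : g.Admissible) (hε0 : 0 < ε) (hε : ε ≤ 1) :
    (halfSample g ε : ℝ) ≤ 1000001 * ((√(g.m : ℝ) + g.m * g.tmax / g.T) / ε) := by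
  have := ceil_le_add_one_mul (c := 1000000) (by norm_num) (h.sample_one_le hε0 hε)
  rw [← mul_div_assoc] at this
  refine this.trans (le_of_eq ?_)
  norm_num

theorem GraphStats.Admissible.one_le_log_div (h : g.Admissible) (hε0 : 0 < ε) (hε : ε ≤ 1) :
    1 ≤ Real.logb 2 g.n / ε := by
  rw [one_le_div hε0]; linarith [h.one_le_logb]

theorem GraphStats.Admissible.le_spacingFactor (_h : g.Admissible) :
    140 * (Real.logb 2 g.n / ε) ≤ spacingFactor g ε := by
  rw [← mul_div_assoc]; exact Nat.le_ceil _

theorem GraphStats.Admissible.spacingFactor_le (h : g.Admissible) (hε0 : 0 < ε) (hε : ε ≤ 1) :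
    (spacingFactor g ε : ℝ) ≤ 141 * (Real.logb 2 g.n / ε) := by
  have := ceil_le_add_one_mul (c := 140) (by norm_num) (h.one_le_log_div hε0 hε)
  rw [← mul_div_assoc] at this
  refine this.trans (le_of_eq ?_)
  norm_num

theorem GraphStats.Admissible.one_div_le_spacingFactor (h : g.Admissible) (hε0 : 0 < ε) :
    1 / ε ≤ spacingFactor g ε := by
  have h1 := h.le_spacingFactor (ε := ε)
  have h2 : 1 / ε ≤ Real.logb 2 g.n / ε := div_le_div_of_nonneg_right h.one_le_logb hε0.le
  have h3 : 0 < 1 / ε := by positivity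
  linarith

theorem GraphStats.Admissible.spacingFactor_pos (h : g.Admissible) (hε0 : 0 < ε) :
    0 < spacingFactor g ε := by
  have := h.one_div_le_spacingFactor hε0
  have h3 : 0 < 1 / ε := by positivity
  exact_mod_cast h3.trans_le this

theorem GraphStats.Admissible.two_le_halfSample (h : g.Admissible) (hε0 : 0 < ε) (hε : ε ≤ 1) :
    2 ≤ halfSample g ε := by
  have h1 := h.le_halfSample (ε := ε)
  have h2 := h.sample_one_le hε0 hε
  have : (2 : ℝ) ≤ halfSample g ε := by linarith
  exact_mod_cast this

/-- The distance from independence beats any polynomial in `n` and `1/ε` that is needed. -/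
theorem GraphStats.Admissible.pow_le_two_pow_spacingFactor (h : g.Admissible) (hε0 : 0 < ε)
    (hε : ε ≤ 1) : (g.n : ℝ) ^ 70 * (1 / ε) ^ 70 ≤ 2 ^ spacingFactor g ε := by
  have hn : (0 : ℝ) < g.n := by have := h.three_le_n; positivity
  set x := Real.logb 2 g.n with hx
  have hx1 : 1 ≤ x := h.one_le_logb
  have hy1 : 1 ≤ 1 / ε := by rw [one_le_div hε0]; exact hε
  have h1 : 70 * x + 70 * (1 / ε) ≤ spacingFactor g ε := by
    refine le_trans ?_ h.le_spacingFactor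
    rw [← hx, show x / ε = x * (1 / ε) by ring]
    nlinarith
  have h2 : (2 : ℝ) ^ x = g.n := Real.rpow_logb (by norm_num) (by norm_num) hn
  have h3 : 1 / ε ≤ (2 : ℝ) ^ (1 / ε) := by
    have := one_add_mul_self_le_rpow_one_add (s := 1) (by norm_num) hy1
    norm_num at this ⊢
    linarith
  calc (g.n : ℝ) ^ 70 * (1 / ε) ^ 70 ≤ ((2 : ℝ) ^ x) ^ 70 * ((2 : ℝ) ^ (1 / ε)) ^ 70 := by
        rw [h2]; gcongr
    _ = (2 : ℝ) ^ (70 * x + 70 * (1 / ε)) := by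
        rw [Real.rpow_add (by norm_num), mul_comm 70 x, mul_comm 70 (1 / ε),
          Real.rpow_mul (by norm_num), Real.rpow_mul (by norm_num)]
        norm_cast
    _ ≤ (2 : ℝ) ^ (spacingFactor g ε : ℝ) := Real.rpow_le_rpow_of_exponent_le (by norm_num) h1
    _ = 2 ^ spacingFactor g ε := Real.rpow_natCast _ _

theorem GraphStats.Admissible.halfSample_le_pow (h : g.Admissible) (hε0 : 0 < ε) (hε : ε ≤ 1) :
    (halfSample g ε : ℝ) ≤ 2000002 * ((g.n : ℝ) ^ 3 * (1 / ε)) := by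
  have hn : (1 : ℝ) ≤ g.n := by exact_mod_cast (by have := h.three_le_n; omega : 1 ≤ g.n)
  have hm : (g.m : ℝ) ≤ (g.n : ℝ) ^ 2 := by exact_mod_cast h.m_le
  have hT : (1 : ℝ) ≤ g.T := by exact_mod_cast h.T_pos
  have ht : (g.tmax : ℝ) ≤ g.n := by exact_mod_cast h.tmax_le
  have h1 : √(g.m : ℝ) ≤ (g.n : ℝ) ^ 3 := by
    calc √(g.m : ℝ) ≤ g.n := Real.sqrt_le_iff.2 ⟨by positivity, hm⟩
      _ ≤ (g.n : ℝ) ^ 3 := le_self_pow₀ hn (by norm_num)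
  have h2 : (g.m : ℝ) * g.tmax / g.T ≤ (g.n : ℝ) ^ 3 := by
    calc (g.m : ℝ) * g.tmax / g.T ≤ g.m * g.tmax := div_le_self (by positivity) hT
      _ ≤ (g.n : ℝ) ^ 2 * g.n := by gcongr
      _ = (g.n : ℝ) ^ 3 := by ring
  refine (h.halfSample_le hε0 hε).trans ?_
  rw [div_eq_mul_one_div]
  have : 0 < 1 / ε := by positivity
  nlinarith

/-- The bound for the mean relative error of the edge count estimator at the chosen parameters. -/
theorem GraphStats.Admissible.edge_error_le (h : g.Admissible) (hε0 : 0 < ε) (hε : ε ≤ 1) {μ : ℝ}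
    (hμ : μ = ((halfSample g ε + halfSample g ε + 1).choose 2 : ℝ) / g.m) :
    1 ≤ μ ∧ 20 / √μ + 3200 / μ + (halfSample g ε + halfSample g ε : ℕ) *
      (2 * (1 / 2) ^ ((spacing g ε - 1) / g.mix)) * (μ + 1) ≤ ε / 640 := by
  have hm : (0 : ℝ) < g.m := by exact_mod_cast h.m_pos
  have hm1 : (1 : ℝ) ≤ g.m := by exact_mod_cast h.m_pos
  set y : ℝ := 1 / ε with hy
  have hy1 : 1 ≤ y := by rw [hy, one_le_div hε0]; exact hε
  have hεy : ε = 1 / y := by rw [hy, one_div_one_div]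
  set x : ℝ := (halfSample g ε : ℝ) with hx
  have hx1 : 1000000 * (√(g.m : ℝ) * y) ≤ x := by
    have h1 := h.le_halfSample (ε := ε)
    have h2 : (0 : ℝ) ≤ g.m * g.tmax / g.T := by positivity
    rw [div_eq_mul_one_div, ← hy] at h1
    nlinarith
  have hx0 : 0 ≤ x := by positivity
  have hxx : 2 ≤ x := by rw [hx]; exact_mod_cast h.two_le_halfSample hε0 hε
  have hμx : μ = x * (2 * x + 1) / g.m := by
    rw [hμ, Nat.cast_choose_two]; push_cast; rw [← hx]; ring
  have hμlow : (1000000 * y) ^ 2 ≤ μ := by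
    rw [hμx, le_div_iff₀ hm]
    have h1 := pow_le_pow_left₀ (by positivity) hx1 2
    have h2 : (1000000 * (√(g.m : ℝ) * y)) ^ 2 = (1000000 * y) ^ 2 * g.m := by
      rw [mul_pow, mul_pow, Real.sq_sqrt hm.le]; ring
    rw [h2] at h1
    nlinarith
  have hμhigh : μ ≤ 3 * x ^ 2 := by
    rw [hμx, div_le_iff₀ hm]
    have h3 : x * (2 * x + 1) ≤ 3 * x ^ 2 := by nlinarith
    have h4 : 3 * x ^ 2 ≤ 3 * x ^ 2 * g.m := le_mul_of_one_le_right (by positivity) hm1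
    linarith
  have hμ1 : 1 ≤ μ := by nlinarith
  refine ⟨hμ1, ?_⟩
  have hs : 1000000 * y ≤ √μ := Real.le_sqrt_of_sq_le hμlow
  have e1 : 20 / √μ ≤ ε / 10000 := by
    rw [hεy, div_div, div_le_div_iff₀ (by positivity) (by positivity)]
    linarith
  have e2 : 3200 / μ ≤ ε / 10000 := by
    rw [hεy, div_div, div_le_div_iff₀ (by positivity) (by positivity)]
    nlinarith
  have hexp : (spacing g ε - 1) / g.mix = spacingFactor g ε - 1 := by
    obtain ⟨k, hk⟩ := Nat.exists_eq_succ_of_ne_zero (h.spacingFactor_pos hε0).ne'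
    have hmix := h.mix_pos
    rw [spacing, hk, Nat.succ_eq_add_one, Nat.add_sub_cancel, mul_add, mul_one,
      show g.mix * k + g.mix - 1 = g.mix * k + (g.mix - 1) by omega, Nat.mul_add_div hmix,
      Nat.div_eq_of_lt (by omega), add_zero]
  have hP := h.pow_le_two_pow_spacingFactor hε0 hε
  have hxn := h.halfSample_le_pow hε0 hε
  rw [← hx, ← hy] at hxn
  rw [← hy] at hP
  set N : ℝ := (g.n : ℝ) with hN
  have hN3 : 3 ≤ N := by rw [hN]; exact_mod_cast h.three_le_n
  set P : ℝ := 2 ^ spacingFactor g ε with hPdef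
  have hP0 : 0 < P := by positivity
  have hhalf : (2 : ℝ) * (1 / 2) ^ ((spacing g ε - 1) / g.mix) = 4 / P := by
    rw [hexp, hPdef]
    obtain ⟨k, hk⟩ := Nat.exists_eq_succ_of_ne_zero (h.spacingFactor_pos hε0).ne'
    rw [hk, Nat.succ_eq_add_one, Nat.add_sub_cancel, pow_succ, one_div, inv_pow]
    field_simp; norm_num
  have e3 : (halfSample g ε + halfSample g ε : ℕ) *
      (2 * (1 / 2) ^ ((spacing g ε - 1) / g.mix)) * (μ + 1) ≤ ε / 10000 := by
    rw [hhalf]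
    push_cast
    rw [← hx]
    have h1 : (x + x) * (4 / P) * (μ + 1) ≤ 48 * x ^ 3 / P := by
      rw [mul_div_assoc', div_mul_eq_mul_div]
      refine div_le_div_of_nonneg_right ?_ hP0.le
      nlinarith
    refine h1.trans ?_
    rw [hεy, div_div, div_le_div_iff₀ hP0 (by positivity), one_mul]
    calc 48 * x ^ 3 * (y * 10000) ≤ 48 * (2000002 * (N ^ 3 * y)) ^ 3 * (y * 10000) := by gcongr
      _ = (48 * 2000002 ^ 3 * 10000) * (N ^ 9 * y ^ 4) := by ring
      -- The numerical constant is absorbed by `3 ^ 61 ≤ n ^ 61`, as a triangle has three vertices.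
      _ ≤ 3 ^ 61 * (N ^ 9 * y ^ 70) := by
          refine mul_le_mul (by norm_num) ?_ (by positivity) (by norm_num)
          exact mul_le_mul_of_nonneg_left (pow_le_pow_right₀ hy1 (by norm_num)) (by positivity)
      _ ≤ N ^ 61 * (N ^ 9 * y ^ 70) := by gcongr
      _ = N ^ 70 * y ^ 70 := by ring
      _ ≤ P := hP
  linarith

theorem GraphStats.Admissible.walkLength_pos (h : g.Admissible) (hε0 : 0 < ε) :
    0 < walkLength g ε :=
  Nat.mul_pos (Nat.succ_pos _) (Nat.mul_pos h.mix_pos (h.spacingFactor_pos hε0))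

/-- The walk is long enough for the concentration of the number of assigned triangles. -/
theorem GraphStats.Admissible.le_walkLength (h : g.Admissible) (hε0 : 0 < ε) :
    2000000 * (g.mix * (√(g.m : ℝ) + g.m * g.tmax / g.T)) ≤ ε ^ 2 * walkLength g ε := by
  have h1 := h.le_halfSample (ε := ε)
  have h2 := h.one_div_le_spacingFactor hε0
  set a := √(g.m : ℝ) + g.m * g.tmax / g.T
  have ha : 0 ≤ a := by positivity
  have h3 : (walkLength g ε : ℝ) =
      (2 * halfSample g ε + 1) * (g.mix * spacingFactor g ε) := by
    rw [walkLength, spacing]; push_cast; ring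
  rw [h3]
  calc 2000000 * (g.mix * a) = ε ^ 2 * ((2 * (1000000 * (a / ε))) * (g.mix * (1 / ε))) := by
        field_simp
        ring
    _ ≤ ε ^ 2 * ((2 * halfSample g ε + 1) * (g.mix * spacingFactor g ε)) := by
        gcongr
        linarith

/-- The cost of all runs is within the claimed bound. -/
theorem GraphStats.Admissible.cost_le (h : g.Admissible) (hε0 : 0 < ε) (hε : ε ≤ 1) :
    ((44 * walkLength g ε + 8 * spacing g ε + 26 * trialCount g ε + 23 + 2 + 27 : ℕ) : ℝ) ≤
      20000000000 * complexityBound g ε := by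
  have hT : (0 : ℝ) < g.T := by exact_mod_cast h.T_pos
  have hmix : (1 : ℝ) ≤ g.mix := by exact_mod_cast h.mix_pos
  have hs := h.one_le_sqrt
  have hL := h.one_le_logb
  set L := Real.logb 2 g.n
  set a := √(g.m : ℝ) + g.m * g.tmax / g.T with ha
  have ha0 : 0 ≤ a := by positivity
  have hLε : 1 ≤ L / ε ^ 2 := by
    rw [one_le_div (by positivity)]
    have : ε ^ 2 ≤ 1 := pow_le_one₀ hε0.le hε
    linarith
  have hX : complexityBound g ε = L / ε ^ 2 * (a * g.mix) +
      L / ε ^ 2 * ((g.m : ℝ) * g.degen / g.T) := by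
    rw [complexityBound, ha]; ring
  have hX1 : 1 ≤ complexityBound g ε := by
    rw [hX]
    have h1 : 1 ≤ a * g.mix := by
      have : (0 : ℝ) ≤ g.m * g.tmax / g.T := by positivity
      have : 1 ≤ a := by rw [ha]; linarith
      nlinarith
    have h2 : 0 ≤ L / ε ^ 2 * ((g.m : ℝ) * g.degen / g.T) := by positivity
    nlinarith
  have hr : (walkLength g ε : ℝ) ≤ 282000423 * complexityBound g ε := by
    have h1 := h.halfSample_le hε0 hε
    have h2 := h.spacingFactor_le hε0 hε
    have h4 := h.sample_one_le hε0 hε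
    rw [← ha] at h1 h4
    have h3 : (walkLength g ε : ℝ) =
        (2 * halfSample g ε + 1) * (g.mix * spacingFactor g ε) := by
      rw [walkLength, spacing]; push_cast; ring
    calc (walkLength g ε : ℝ) = (2 * halfSample g ε + 1) * (g.mix * spacingFactor g ε) := h3
      _ ≤ (2000003 * (a / ε)) * (g.mix * (141 * (L / ε))) := by gcongr; linarith
      _ = 282000423 * (L / ε ^ 2 * (a * g.mix)) := by field_simp; ring
      _ ≤ 282000423 * complexityBound g ε := by
          rw [hX]
          have h2 : 0 ≤ L / ε ^ 2 * ((g.m : ℝ) * g.degen / g.T) := by positivity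
          linarith
  have hsp : (spacing g ε : ℝ) ≤ walkLength g ε := by
    have : spacing g ε ≤ walkLength g ε := Nat.le_mul_of_pos_left _ (Nat.succ_pos _)
    exact_mod_cast this
  have hℓ : (trialCount g ε : ℝ) ≤ 4000001 * complexityBound g ε := by
    have h1 := (Nat.ceil_lt_add_one
      (show 0 ≤ 4000000 * ((g.m : ℝ) * g.degen / g.T / ε ^ 2) by positivity)).le
    have h2 : (g.m : ℝ) * g.degen / g.T / ε ^ 2 ≤ complexityBound g ε := by
      rw [hX]
      have h3 : 0 ≤ L / ε ^ 2 * (a * g.mix) := by positivity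
      have h4 : (g.m : ℝ) * g.degen / g.T / ε ^ 2 ≤
          L / ε ^ 2 * ((g.m : ℝ) * g.degen / g.T) := by
        rw [div_mul_eq_mul_div]
        refine div_le_div_of_nonneg_right ?_ (by positivity)
        exact le_mul_of_one_le_left (by positivity) hL
      linarith
    rw [trialCount]
    linarith
  push_cast
  linarith

end Parameters

/-! ### Accuracy and cost of the estimator -/

section Conclusion

variable {V : Type} [Fintype V] [LinearOrder V] {G : SimpleGraph V} [DecidableRel G.Adj]

theorem admissible_graphStats (h : IsMixing G) (hT : 0 < triangleCount G) :
    (graphStats G).Admissible where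
  three_le_n := by
    obtain ⟨s, hs⟩ := Finset.card_pos.1 hT
    rw [SimpleGraph.mem_cliqueFinset_iff] at hs
    exact hs.card_eq ▸ Finset.card_le_univ s
  m_pos := h.card_edgeFinset_pos
  m_le := card_edgeFinset_le_sq G
  T_pos := hT
  mix_pos := h.mixingTime_pos
  tmax_le := maxAssigned_le_card G

open Classical in
/-- The chosen parameters satisfy the three moment bounds. -/
theorem mean_tetris_inaccurate_le_of_params (h : IsMixing G) (hT : 0 < triangleCount G) {ε : ℝ}
    (hε0 : 0 < ε) (hε : ε ≤ 1) (s : V) :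
    mean G (tetris (walkLength (graphStats G) ε) (trialCount (graphStats G) ε)
      (spacing (graphStats G) ε) s) (fun x => if Accurate G ε x then 0 else 1) ≤ 1 / 16 := by
  have hadm := admissible_graphStats h hT
  have hα : 0 < degeneracy G := have := h.nonempty; degeneracy_pos G h.degree_pos
  have hsp : 0 < spacing (graphStats G) ε := Nat.mul_pos hadm.mix_pos (hadm.spacingFactor_pos hε0)
  have hlen := hadm.le_walkLength hε0
  have hrpos := hadm.walkLength_pos hε0
  change (2000000 * ((mixingTime G : ℝ) * (√(G.edgeFinset.card : ℝ) +
    G.edgeFinset.card * maxAssigned G / triangleCount G)) ≤ _) at hlen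
  have hα1 : (1 : ℝ) ≤ degeneracy G := by exact_mod_cast hα
  have hm : (0 : ℝ) < G.edgeFinset.card := by exact_mod_cast h.card_edgeFinset_pos
  have hT' : (0 : ℝ) < triangleCount G := by exact_mod_cast hT
  have hr0 : (0 : ℝ) < walkLength (graphStats G) ε := by exact_mod_cast hrpos
  obtain ⟨hμ1, hμ2⟩ := hadm.edge_error_le hε0 hε rfl
  refine mean_tetris_inaccurate_le h hT hε0 hε (Nat.succ_pos _) hsp s (Nat.le_ceil _)
    ((h.walkMean_edgeEstimate_error_le hsp (hadm.two_le_halfSample hε0 hε) rfl hμ1 s).trans hμ2)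
    ?_ ?_
  · refine (h.walkMean_recordTriangles_sq_le _ s).trans ?_
    have hmean := (abs_le.1 (h.abs_walkMean_recordTriangles_sub_le
      (walkLength (graphStats G) ε) s)).2
    rw [walkLength] at hmean hlen hr0
    set r : ℝ := (((halfSample (graphStats G) ε + halfSample (graphStats G) ε + 1) *
      spacing (graphStats G) ε : ℕ) : ℝ)
    set a : ℝ := triangleCount G / G.edgeFinset.card with ha
    have ha0 : 0 < a := by positivity
    set B : ℝ := mixingTime G * maxAssigned G with hB
    have hB0 : 0 ≤ B := by positivity
    have hBr : 2000000 * B ≤ ε ^ 2 * (r * a) := by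
      have h1 : 2000000 * ((mixingTime G : ℝ) *
          (G.edgeFinset.card * maxAssigned G / triangleCount G)) ≤ ε ^ 2 * r := by
        have : 0 ≤ (mixingTime G : ℝ) * √(G.edgeFinset.card : ℝ) := by positivity
        linarith
      have h2 := mul_le_mul_of_nonneg_right h1 ha0.le
      have h3 : (2000000 * ((mixingTime G : ℝ) *
          (G.edgeFinset.card * maxAssigned G / triangleCount G))) * a = 2000000 * B := by
        rw [ha, hB]; field_simp
      linarith
    have hε2 : ε ^ 2 ≤ 1 := pow_le_one₀ hε0.le hε
    have hra : 0 < r * a := by positivity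
    have hBra : 2000000 * B ≤ r * a := by nlinarith
    have hEF := sub_le_iff_le_add.1 hmean
    calc _ ≤ 12 * mixingTime G * maxAssigned G * ((4 * mixingTime G * maxAssigned G + r * a) +
          r * a) := by gcongr
      _ = 12 * B * (4 * B + 2 * (r * a)) := by rw [hB]; ring
      _ ≤ 12 * B * (6 * (r * a)) := by
          refine mul_le_mul_of_nonneg_left ?_ (by positivity)
          linarith
      _ ≤ (ε * (r * a)) ^ 2 / 6400 := by nlinarith
  · refine (h.walkMean_edgeDeg_le _ s).trans ?_
    rw [walkLength] at hlen hr0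
    set r : ℝ := (((halfSample (graphStats G) ε + halfSample (graphStats G) ε + 1) *
      spacing (graphStats G) ε : ℕ) : ℝ)
    have hε2 : ε ^ 2 ≤ 1 := pow_le_one₀ hε0.le hε
    have h1 : 2000000 * ((mixingTime G : ℝ) * √(G.edgeFinset.card : ℝ)) ≤ r := by
      have h2 : 0 ≤ (mixingTime G : ℝ) * (G.edgeFinset.card * maxAssigned G / triangleCount G) := by
        positivity
      have h3 : ε ^ 2 * r ≤ r := by nlinarith
      linarith
    have hsqrt : √(2 * (G.edgeFinset.card : ℝ)) ≤ 2 * √(G.edgeFinset.card : ℝ) := by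
      rw [Real.sqrt_le_iff]
      refine ⟨by positivity, ?_⟩
      rw [mul_pow, Real.sq_sqrt hm.le]; linarith
    have h4 : 4 * (mixingTime G : ℝ) * √(2 * (G.edgeFinset.card : ℝ)) ≤ r := by
      have := mul_le_mul_of_nonneg_left hsqrt (show (0 : ℝ) ≤ 4 * mixingTime G by positivity)
      have h5 : 0 ≤ (mixingTime G : ℝ) * √(G.edgeFinset.card : ℝ) := by positivity
      linarith
    nlinarith

/-- Each of the `k` runs costs `n`, two more for recording its result and `27` for its share of
the computation of the median. -/
theorem within_tetrisMedian {n k r ℓ τ : ℕ} {s : V}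
    (hp : Within G (tetris r ℓ τ s) n fun _ => True) :
    Within G (tetrisMedian k r ℓ τ s) ((n + 2 + 27) * k) fun _ => True := by
  simp only [tetrisMedian]
  refine (within_repeatRuns G hp k).bind G (n' := 27 * k) (fun xs _ => ?_) (by ring_nf; omega)
  refine (within_spend G _).bind G (n' := 2 * k) (fun _ _ => ?_) (by omega)
  exact (within_reserve G _).bind G (n' := 0) (fun _ _ => within_pure G trivial) (by omega)

open Classical in
/-- The median of the runs is inaccurate with probability at most `δ`. -/
theorem mean_tetrisMedian_inaccurate_le (h : IsMixing G) (hT : 0 < triangleCount G) {ε δ : ℝ}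
    (hε0 : 0 < ε) (hε : ε ≤ 1) (hδ0 : 0 < δ) (s : V) :
    mean G (tetrisMedian (runCount δ) (walkLength (graphStats G) ε) (trialCount (graphStats G) ε)
      (spacing (graphStats G) ε) s) (fun x => if Accurate G ε x then 0 else 1) ≤ δ := by
  have hadm := admissible_graphStats h hT
  have hsp : 0 < spacing (graphStats G) ε := Nat.mul_pos hadm.mix_pos (hadm.spacingFactor_pos hε0)
  have hone := mean_tetris_inaccurate_le_of_params h hT hε0 hε s
  have hwithin := within_tetris h.degree_pos hsp (trialCount (graphStats G) ε) s
    (q := halfSample (graphStats G) ε + halfSample (graphStats G) ε + 1)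
  simp only [tetrisMedian, mean_bind, mean_spend, mean_reserve, mean_pure]
  by_cases hδ : 1 / 3 ≤ δ
  · have hmed : ∀ x : ℚ, median [x] = x := fun x => by simp [median]
    simp only [runCount, hδ, if_true, repeatRuns, mean_bind, mean_spend, mean_reserve, mean_pure,
      hmed]
    linarith
  · simp only [runCount, hδ, if_false]
    have hconn : ∀ x y z : ℚ, x ≤ y → y ≤ z → Accurate G ε x → Accurate G ε z →
        Accurate G ε y := by
      intro x y z hxy hyz hx hz
      have hxy' : (x : ℝ) ≤ y := by exact_mod_cast hxy
      have hyz' : (y : ℝ) ≤ z := by exact_mod_cast hyz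
      exact ⟨hx.1.trans hxy', hyz'.trans hz.2⟩
    refine (mean_median_le G hwithin hconn hone _).trans ?_
    have hlog : Real.logb 2 (1 / δ) ≤ (⌈Real.logb 2 (1 / δ)⌉₊ : ℝ) := Nat.le_ceil _
    rw [Real.logb_le_iff_le_rpow (by norm_num) (by positivity), Real.rpow_natCast] at hlog
    rw [one_div_pow, one_div_le (by positivity) hδ0]
    exact hlog

theorem runCount_le {δ : ℝ} (hδ0 : 0 < δ) :
    (runCount δ : ℝ) ≤ 2 * max 1 (Real.logb 2 (1 / δ)) := by
  have h1 := le_max_left 1 (Real.logb 2 (1 / δ))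
  have h2 := le_max_right 1 (Real.logb 2 (1 / δ))
  unfold runCount
  split_ifs with hδ
  · push_cast; linarith
  · have h0 : 0 ≤ Real.logb 2 (1 / δ) := by
      refine Real.logb_nonneg (by norm_num) ?_
      rw [one_le_div hδ0]; linarith
    have := (Nat.ceil_lt_add_one h0).le
    linarith

open Classical in
theorem estimatesTriangles_of_mean_le {p : Prog V ℚ} {ε δ : ℝ}
    (h : mean G p (fun x => if Accurate G ε x then 0 else 1) ≤ δ) :
    EstimatesTriangles G ε δ p := by
  have h1 := run_toOuterMeasure G p {x | Accurate G ε x}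
  have h2 : mean G p (fun x => if x ∈ {x | Accurate G ε x} then (1 : ℝ) else 0) =
      1 - mean G p (fun x => if Accurate G ε x then 0 else 1) := by
    rw [eq_sub_iff_add_eq, ← mean_add]
    refine Eq.trans ?_ (mean_const G p 1)
    congr 1; funext x
    by_cases hx : Accurate G ε x <;> simp [hx]
  rw [h2] at h1
  refine le_trans (ENNReal.ofReal_le_ofReal ?_) h1.ge
  linarith

end Conclusion

end Tetris

theorem mainTheorem1 :
    ∃ (C : ℝ) (r ℓ τ : Tetris.GraphStats → ℝ → ℕ) (k : ℝ → ℕ),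
      (∀ δ : ℝ, 1 / 3 ≤ δ → k δ = 1) ∧
      ∀ (V : Type) [Fintype V] [LinearOrder V] (G : SimpleGraph V) [DecidableRel G.Adj],
        G.Connected → 0 < Tetris.triangleCount G →
        ∀ ε δ : ℝ, 0 < ε → ε ≤ 1 → 0 < δ → δ ≤ 1 →
          Tetris.mixingTime G ≤ τ (Tetris.graphStats G) ε ∧
          ∀ s : V,
            Tetris.EstimatesTriangles G ε δ
              (Tetris.tetrisMedian (k δ) (r (Tetris.graphStats G) ε)
                (ℓ (Tetris.graphStats G) ε) (τ (Tetris.graphStats G) ε) s) ∧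
            Tetris.ResourcesAtMost G
              (C * (max 1 (Real.logb 2 (1 / δ)) *
                Tetris.complexityBound (Tetris.graphStats G) ε))
              (Tetris.tetrisMedian (k δ) (r (Tetris.graphStats G) ε)
                (ℓ (Tetris.graphStats G) ε) (τ (Tetris.graphStats G) ε) s) := by
  refine ⟨40000000000, Tetris.walkLength, Tetris.trialCount, Tetris.spacing, Tetris.runCount,
    fun δ hδ => if_pos hδ, ?_⟩
  intro V _ _ G _ hc hT ε δ hε0 hε hδ0 _
  obtain ⟨a, b, c, hab, hbc, hca⟩ := Tetris.exists_triangle G hT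
  have h := Tetris.IsMixing.of_connected G hc hab hbc hca
  have hadm := Tetris.admissible_graphStats h hT
  have hsf := hadm.spacingFactor_pos hε0
  refine ⟨Nat.le_mul_of_pos_right _ hsf, fun s => ⟨?_, ?_⟩⟩
  · exact Tetris.estimatesTriangles_of_mean_le
      (Tetris.mean_tetrisMedian_inaccurate_le h hT hε0 hε hδ0 s)
  · intro o ho
    have hcost := (Tetris.within_tetrisMedian (k := Tetris.runCount δ)
      (Tetris.within_tetris h.degree_pos (Nat.mul_pos hadm.mix_pos hsf)
      (Tetris.trialCount (Tetris.graphStats G) ε) s) o ho).2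
    have h1 := hadm.cost_le hε0 hε
    have h2 := Tetris.runCount_le hδ0
    have hX : 0 ≤ Tetris.complexityBound (Tetris.graphStats G) ε := by
      have : (0 : ℝ) ≤ ((44 * Tetris.walkLength (Tetris.graphStats G) ε +
        8 * Tetris.spacing (Tetris.graphStats G) ε +
        26 * Tetris.trialCount (Tetris.graphStats G) ε + 23 + 2 + 27 : ℕ) : ℝ) := by positivity
      linarith
    have h3 : (o.2.queries + o.2.steps + o.2.cells : ℝ) ≤ 40000000000 *
        (max 1 (Real.logb 2 (1 / δ)) * Tetris.complexityBound (Tetris.graphStats G) ε) := by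
      calc (o.2.queries + o.2.steps + o.2.cells : ℝ)
          ≤ ((44 * Tetris.walkLength (Tetris.graphStats G) ε +
            8 * Tetris.spacing (Tetris.graphStats G) ε +
            26 * Tetris.trialCount (Tetris.graphStats G) ε + 23 + 2 + 27 : ℕ) : ℝ) *
            Tetris.runCount δ := by exact_mod_cast hcost
        _ ≤ (20000000000 * Tetris.complexityBound (Tetris.graphStats G) ε) *
            (2 * max 1 (Real.logb 2 (1 / δ))) := by gcongr
        _ = _ := by ring
    have q0 : (0 : ℝ) ≤ o.2.queries := by positivity
    have s0 : (0 : ℝ) ≤ o.2.steps := by positivity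
    have c0 : (0 : ℝ) ≤ o.2.cells := by positivity
    refine ⟨?_, ?_, ?_⟩ <;> linarith
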